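/- **Diagrams.** An oriented link diagram $D$ is a finite collection of oriented piecewise smooth closed curves in the plane whose only singularities are finitely many transverse double points; each double point is either a classical crossing (one of the two passages is the over-passage) or a virtual crossing. Two diagrams represent the same virtual link type if they are related by a finite sequence of reparametrizations, planar isotopies, the three classical Reidemeister moves (with all orientations and all over/under choices), detour moves (an arc containing no classical crossing is replaced by any other arc with the same ends, all double points on the new arc being virtual), and inverses of these. **Universe graph and Euler systems.** The universe graph $U$ of $D$ is the abstract 4-regular graph whose vertices are the classical crossings of $D$ and whose edges are the arcs joining consecutive classical crossings along the link components, together with one free loop for each link component without classical crossings; $c(U)$ is its number of connected components, free loops included. At each vertex there are three transitions (pairings of the four half-edges): *straight* (following the link components), *oriented* (the smoothing respecting the orientations of the link components) and *disoriented* (the other smoothing). An Euler system $C$ of $U$ consists of one undirected Euler circuit for each connected component of $U$ that has vertices. **Marked graphs.** A marked graph is a finite graph in which each vertex may be looped or unlooped and is unmarked or carries one of the marks $c,r,u,cr,ur$, together with a number of free loops; marked graphs are considered up to isomorphism. The marked interlacement graph $\mathcal L(D,C)$ has the classical crossings of $D$ as vertices; a vertex is looped iff the crossing is negative; two distinct vertices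 $v,w$ are adjacent iff they are interlaced with respect to $C$, i.e. a circuit of $C$ meets them in the cyclic order $v,w,v,w$; there are $c(U)-1$ free loops ($0$ if $D$ is empty). A vertex at which $C$ uses the straight transition is unmarked if the oriented transition is consistent with an orientation of the incident circuit of $C$, and is marked $r$ otherwise; a vertex at which $C$ uses the oriented transition is marked $c$ if the straight transition is consistent with an orientation of the circuit, and $ur$ otherwise; a vertex at which $C$ uses the disoriented transition is marked $cr$ if the straight transition is consistent with an orientation of the circuit, and $u$ otherwise. **Operations.** The marked local complement $G^v_{cru}$ is obtained from $G$ by changing the mark of $v$ by (unmarked)$\leftrightarrow u$, $r\leftrightarrow ur$, $c\leftrightarrow cr$, changing the mark of each neighbor of $v$ by (unmarked)$\leftrightarrow r$, $c\leftrightarrow ur$, $u\leftrightarrow cr$, and toggling the adjacency of each pair of distinct neighbors of $v$. Put $G^{vz}_{cru}=((G^v_{cru})^z_{cru})^v_{cru}$ for adjacent $v,z$. The moves are the following and their inverses. * $\Omega.1$: remove an isolated vertex (looped or not) that is unmarked or marked $u$. * $\Omega.2$, where $v$ is looped, $w\neq v$ is unlooped, and $w$ is unmarked: (a) if $v$ is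 unmarked and $v,w$ have the same neighbors outside $\{v,w\}$, replace $G$ by $G-v-w$; (b) if $v$ is marked $c$, $v$ is the only neighbor of $w$, and $z\ne w$ is a neighbor of $v$, replace $G$ by $G^{vz}_{cru}-v-w$; (c) if $v$ is marked $c$, $v,w$ have the same neighbors outside $\{v,w\}$, and $z\notin\{v,w\}$ is a neighbor of both, replace $G$ by $G^{vz}_{cru}-v-w$; (d) if $v$ is marked $c$ and $v,w$ are each other's only neighbors, replace $G$ by $G-v-w$ with one more free loop. * $\Omega.3$: if $u,v,w$ are unmarked and pairwise adjacent, $u$ is looped, $v,w$ are unlooped, and every other vertex is adjacent to none or exactly two of $u,v,w$, remove the three edges among $u,v,w$; also the mirror image of this move (toggle all loops, apply the move, toggle all loops). A marked-graph Reidemeister move consists of marked local complementations, followed by one of these moves, followed by marked local complementations. **Theorem.** Let $D$ and $D'$ be oriented link diagrams representing the same virtual link type. Then for any Euler systems $C$ and $C'$ of the universe graphs of $D$ and $D'$, the marked graph $\mathcal L(D',C')$ can be obtained from $\mathcal L(D,C)$ by marked local complementations and marked-graph Reidemeister moves. -/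

import Mathlib

open scoped ContDiff

/-! ### Oriented virtual link diagrams in the plane

The plane is `ℂ` as a real vector space. A closed curve is a map from the circle `ℝ / ℤ`,
oriented by increasing parameter. -/

/-- A closed curve is piecewise smooth (and regular) if, off finitely many corners, it is cut into
closed pieces each of which is smooth with nonvanishing velocity up to and including its ends. -/
def IsPiecewiseSmooth (c : UnitAddCircle → ℂ) : Prop :=
  ∃ F : Set UnitAddCircle, F.Finite ∧
    ∀ a b : ℝ, a < b → (∀ t ∈ Set.Ioo a b, (t : UnitAddCircle) ∉ F) →
      ContDiffOn ℝ ∞ (fun t : ℝ => c t) (Set.Icc a b) ∧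
        ∀ t ∈ Set.Icc a b, derivWithin (fun t : ℝ => c t) (Set.Icc a b) t ≠ 0

/-- The determinant of the pair of plane vectors `(a, b)`. -/
def planeDet (a b : ℂ) : ℝ := a.re * b.im - a.im * b.re

/-- A parameter on a collection of `n` closed curves: a curve and a point of its circle. -/
abbrev CurveParam (n : ℕ) : Type := Fin n × UnitAddCircle

/-- An oriented (virtual) link diagram with `n` link components: `n` closed piecewise smooth
oriented curves in the plane whose only singularities are finitely many transverse double points.
Some of the double points are designated as classical crossings, and there the over-passage is
distinguished from the under-passage; the other double points are the virtual crossings. -/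
structure LinkDiagram (n : ℕ) where
  curve : Fin n → UnitAddCircle → ℂ
  piecewiseSmooth : ∀ i, IsPiecewiseSmooth (curve i)
  finite_double : {x : CurveParam n × CurveParam n |
    x.1 ≠ x.2 ∧ curve x.1.1 x.1.2 = curve x.2.1 x.2.2}.Finite
  no_triple : ∀ p q s : CurveParam n, curve p.1 p.2 = curve q.1 q.2 →
    curve q.1 q.2 = curve s.1 s.2 → p = q ∨ q = s ∨ p = s
  transverse : ∀ p q : CurveParam n, p ≠ q → curve p.1 p.2 = curve q.1 q.2 →
    DifferentiableAt ℝ (fun x : ℝ => curve p.1 (p.2 + (x : UnitAddCircle))) 0 ∧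
    DifferentiableAt ℝ (fun x : ℝ => curve q.1 (q.2 + (x : UnitAddCircle))) 0 ∧
    planeDet (deriv (fun x : ℝ => curve p.1 (p.2 + (x : UnitAddCircle))) 0)
      (deriv (fun x : ℝ => curve q.1 (q.2 + (x : UnitAddCircle))) 0) ≠ 0
  /-- The classical crossings, each given as the pair (over-passage, under-passage). -/
  crossings : Finset (CurveParam n × CurveParam n)
  crossing_double : ∀ x ∈ crossings, x.1 ≠ x.2 ∧ curve x.1.1 x.1.2 = curve x.2.1 x.2.2
  crossing_asymm : ∀ x ∈ crossings, (x.2, x.1) ∉ crossings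

namespace LinkDiagram

variable {n : ℕ}

/-- The point of the plane with a given parameter. -/
def pt (D : LinkDiagram n) (p : CurveParam n) : ℂ := D.curve p.1 p.2

/-- The velocity vector at a given parameter. -/
noncomputable def velocity (D : LinkDiagram n) (p : CurveParam n) : ℂ :=
  deriv (fun x : ℝ => D.curve p.1 (p.2 + (x : UnitAddCircle))) 0

/-- A classical crossing is negative if the velocities (over, under) form a negative frame. -/
def IsNegative (D : LinkDiagram n) (x : CurveParam n × CurveParam n) : Prop :=
  planeDet (D.velocity x.1) (D.velocity x.2) < 0

/-- `p` is the parameter of a passage through a classical crossing. -/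
def IsPassage (D : LinkDiagram n) (p : CurveParam n) : Prop :=
  ∃ x ∈ D.crossings, p = x.1 ∨ p = x.2

end LinkDiagram

/-! ### Virtual link types -/

/-- A diffeomorphism of the plane. -/
def IsPlaneDiffeo (φ : ℂ ≃ ℂ) : Prop := ContDiff ℝ ∞ φ ∧ ContDiff ℝ ∞ φ.symm

/-- The positions, in the unit disk, of `k` arcs parametrized by `[-1, 1]`, together with the set
of the classical crossings among these arcs, each given as (over-passage, under-passage). -/
structure Tangle (k : ℕ) where
  path : Fin k → ℝ → ℂ
  crossings : Set ((Fin k × ℝ) × (Fin k × ℝ))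

namespace Tangle

/-- Arcs stacked above each other: every double point involving two arcs is a classical crossing,
at which the arc with the larger height is the over-passage. -/
def layered {k : ℕ} (path : Fin k → ℝ → ℂ) (height : Equiv.Perm (Fin k)) : Tangle k where
  path := path
  crossings := {x | x.1.2 ∈ Set.Icc (-1 : ℝ) 1 ∧ x.2.2 ∈ Set.Icc (-1 : ℝ) 1 ∧
    height x.2.1 < height x.1.1 ∧ path x.1.1 x.1.2 = path x.2.1 x.2.2}

/-- A diameter of the disk. -/
def line : Tangle 1 where
  path := fun _ t => ⟨t, 0⟩
  crossings := ∅

/-- An arc with the ends of the diameter and one crossing, a double point with the parameters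
`-1/2` and `1/2`; the first passage is the under-passage or the over-passage. -/
noncomputable def kink (firstUnder : Bool) : Tangle 1 where
  path := fun _ t => ⟨(4 * t ^ 3 - t) / 3, (1 - t ^ 2) / 2⟩
  crossings := if firstUnder then {((0, 1 / 2), (0, -1 / 2))} else {((0, -1 / 2), (0, 1 / 2))}

/-- Two parallel chords. -/
noncomputable def parallel (height : Equiv.Perm (Fin 2)) : Tangle 2 :=
  layered ![fun t => ⟨4 * t / 5, 3 / 5⟩, fun t => ⟨4 * t / 5, -3 / 5⟩] height

/-- Two arcs with the same ends as the parallel chords, crossing each other twice (at the points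
with parameters `-1/2` and `1/2`), one of them always above the other. -/
noncomputable def clasp (height : Equiv.Perm (Fin 2)) : Tangle 2 :=
  layered ![fun t => ⟨4 * t / 5, (4 * t ^ 2 - 1) / 5⟩,
    fun t => ⟨4 * t / 5, -(4 * t ^ 2 - 1) / 5⟩] height

/-- Two diameters crossing each other in the center, and a third arc which crosses both of them
and runs above the center (`ε = 1`) or below it (`ε = -1`). -/
noncomputable def triangle (ε : ℝ) (height : Equiv.Perm (Fin 3)) : Tangle 3 :=
  layered ![fun t => ⟨t, ε * (8 / 9) * (1 - t ^ 2)⟩, fun t => ⟨3 * t / 5, 4 * t / 5⟩,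
    fun t => ⟨3 * t / 5, -(4 * t / 5)⟩] height

end Tangle

namespace LinkDiagram

variable {n : ℕ}

/-- `D` and `D'` are the same except for the order in which the link components are listed and the
(orientation-preserving) parametrizations of the curves. -/
def IsReparametrization (D D' : LinkDiagram n) : Prop :=
  ∃ (e : Equiv.Perm (Fin n)) (θ : Fin n → ℝ ≃o ℝ), (∀ i t, θ i (t + 1) = θ i t + 1) ∧
    (∀ i (t : ℝ), D'.pt (e i, (θ i t : UnitAddCircle)) = D.pt (i, (t : UnitAddCircle))) ∧
    ∀ i j (s t : ℝ),
      (((e i, (θ i s : UnitAddCircle)), (e j, (θ j t : UnitAddCircle))) ∈ D'.crossings ↔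
        ((i, (s : UnitAddCircle)), (j, (t : UnitAddCircle))) ∈ D.crossings)

/-- `D'` is the image of `D` under an orientation-preserving diffeomorphism of the plane. -/
def IsPlanarIsotopy (D D' : LinkDiagram n) : Prop :=
  ∃ φ : ℂ ≃ ℂ, IsPlaneDiffeo φ ∧ (∀ z, 0 < (fderiv ℝ φ z).det) ∧
    (∀ p, D'.pt p = φ (D.pt p)) ∧ D'.crossings = D.crossings

/-- Detour move: an arc (with parameters in `[a, b]`) of a link component, containing no classical
crossing, is replaced by another arc with the same ends; all the double points on the new arc are
virtual crossings. -/
def IsDetourMove (D D' : LinkDiagram n) : Prop :=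
  ∃ (i : Fin n) (a b : ℝ), a < b ∧ b < a + 1 ∧
    (∀ t ∈ Set.Icc a b, ¬ D.IsPassage (i, (t : UnitAddCircle))) ∧
    (∀ p : CurveParam n, (∀ t ∈ Set.Ioo a b, p ≠ (i, (t : UnitAddCircle))) →
      D'.pt p = D.pt p) ∧
    D'.crossings = D.crossings

/-- There is a disk in the plane (the image of the closed unit disk under a diffeomorphism `φ`)
which meets `D` in the image of the tangle `T` and `D'` in the image of the tangle `T'`, while `D`
and `D'` are the same outside of this disk. The `j`-th arc of the tangles lies on the link
component `comp j`, with an affine parameter change which may preserve or reverse orientation. -/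
def IsLocalMove {k : ℕ} (T T' : Tangle k) (D D' : LinkDiagram n) : Prop :=
  ∃ (φ : ℂ ≃ ℂ) (comp : Fin k → Fin n) (a l : Fin k → ℝ) (f : Fin k × ℝ → CurveParam n),
    IsPlaneDiffeo φ ∧
    (∀ x, f x = (comp x.1, ((a x.1 + l x.1 * x.2 : ℝ) : UnitAddCircle))) ∧
    Set.InjOn f {x | x.2 ∈ Set.Icc (-1 : ℝ) 1} ∧
    (∀ p, p ∉ f '' {x | x.2 ∈ Set.Icc (-1 : ℝ) 1} →
      D'.pt p = D.pt p ∧ D.pt p ∉ φ '' Metric.closedBall 0 1) ∧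
    (∀ p q, p ∉ f '' {x | x.2 ∈ Set.Icc (-1 : ℝ) 1} → q ∉ f '' {x | x.2 ∈ Set.Icc (-1 : ℝ) 1} →
      ((p, q) ∈ D'.crossings ↔ (p, q) ∈ D.crossings)) ∧
    (∀ j, ∀ t ∈ Set.Icc (-1 : ℝ) 1,
      D.pt (f (j, t)) = φ (T.path j t) ∧ D'.pt (f (j, t)) = φ (T'.path j t)) ∧
    ∀ x y : Fin k × ℝ, x.2 ∈ Set.Icc (-1 : ℝ) 1 → y.2 ∈ Set.Icc (-1 : ℝ) 1 →
      ((f x, f y) ∈ D.crossings ↔ (x, y) ∈ T.crossings) ∧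
      ((f x, f y) ∈ D'.crossings ↔ (x, y) ∈ T'.crossings)

/-- The elementary changes of a diagram that do not change the virtual link type: change of
parametrization, planar isotopy, the detour move and the three classical Reidemeister moves. -/
inductive Move : LinkDiagram n → LinkDiagram n → Prop
  | reparametrization {D D'} : IsReparametrization D D' → Move D D'
  | isotopy {D D'} : IsPlanarIsotopy D D' → Move D D'
  | detour {D D'} : IsDetourMove D D' → Move D D'
  | reidemeister1 {D D'} (firstUnder : Bool) :
      IsLocalMove Tangle.line (Tangle.kink firstUnder) D D' → Move D D'
  | reidemeister2 {D D'} (height : Equiv.Perm (Fin 2)) :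
      IsLocalMove (Tangle.parallel height) (Tangle.clasp height) D D' → Move D D'
  | reidemeister3 {D D'} (height : Equiv.Perm (Fin 3)) :
      IsLocalMove (Tangle.triangle 1 height) (Tangle.triangle (-1) height) D D' → Move D D'

/-- `D` and `D'` represent the same virtual link type. -/
def SameVirtualLinkType (D D' : LinkDiagram n) : Prop := Relation.EqvGen Move D D'

/-! ### The universe graph and its Euler systems -/

/-- The vertices of the universe graph are the classical crossings. -/
abbrev Vertex (D : LinkDiagram n) : Type := {x // x ∈ D.crossings}

/-- The passages of the link components through the classical crossings; the Boolean is `true`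
for the over-passage. -/
abbrev Passage (D : LinkDiagram n) : Type := D.Vertex × Bool

/-- The parameter of a passage. -/
def passageParam (D : LinkDiagram n) (p : D.Passage) : CurveParam n :=
  if p.2 then p.1.1.1 else p.1.1.2

/-- Following a link component in the direction of its orientation, `q` is the first passage
after `p`. (`q = p` if there is no other passage on this link component.) -/
def IsNextPassage (D : LinkDiagram n) (p q : D.Passage) : Prop :=
  ∃ (i : Fin n) (s d : ℝ), 0 < d ∧ D.passageParam p = (i, (s : UnitAddCircle)) ∧
    D.passageParam q = (i, ((s + d : ℝ) : UnitAddCircle)) ∧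
    ∀ e ∈ Set.Ioo 0 d, ∀ m : D.Passage, D.passageParam m ≠ (i, ((s + e : ℝ) : UnitAddCircle))

/-- The half-edges of the universe graph: `(x, b, o)` is at the vertex `x`, on the over-passage if
`b` is `true` and on the under-passage otherwise, and it leaves `x` with respect to the
orientation of the link component if `o` is `true` and enters `x` otherwise. -/
abbrev HalfEdge (D : LinkDiagram n) : Type := D.Vertex × Bool × Bool

/-- Two half-edges make up an edge of the universe graph, i.e. an arc of the diagram from a
classical passage to the next one. -/
def IsEdge (D : LinkDiagram n) (h h' : D.HalfEdge) : Prop :=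
  ∃ p q : D.Passage, D.IsNextPassage p q ∧
    ((h = (p.1, p.2, true) ∧ h' = (q.1, q.2, false)) ∨
      (h = (q.1, q.2, false) ∧ h' = (p.1, p.2, true)))

/-- The number of connected components of the universe graph, including one free loop for each
link component without classical crossings. -/
noncomputable def componentCount (D : LinkDiagram n) : ℕ :=
  Nat.card (Quot fun x y : D.Vertex => ∃ h h' : D.HalfEdge, D.IsEdge h h' ∧ h.1 = x ∧ h'.1 = y) +
    Nat.card {i : Fin n // ∀ s : UnitAddCircle, ¬ D.IsPassage (i, s)}

end LinkDiagram

/-- The three ways of pairing the four half-edges at a classical crossing: `straight` follows the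
link component(s), `oriented` is the smoothing that respects the orientations of the link
component(s), `disoriented` is the smoothing that does not. -/
inductive Transition
  | straight
  | oriented
  | disoriented

/-- The half-edge paired with a given half-edge at the same crossing. -/
def Transition.partner : Transition → Bool × Bool → Bool × Bool
  | .straight, (b, o) => (b, !o)
  | .oriented, (b, o) => (!b, !o)
  | .disoriented, (b, o) => (!b, o)

namespace LinkDiagram

variable {n : ℕ}

/-- An Euler system of the universe graph. A partition of the edges into (unoriented) circuits is
given by a transition at each vertex; it is an Euler system if each connected component is covered
by a single circuit. -/
structure EulerSystem (D : LinkDiagram n) where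
  transition : D.Vertex → Transition
  euler : ∀ h h' : D.HalfEdge,
    Relation.EqvGen (fun g g' : D.HalfEdge => D.IsEdge g g' ∨ g.1 = g'.1) h h' →
    Relation.EqvGen (fun g g' : D.HalfEdge =>
      D.IsEdge g g' ∨ g' = (g.1, (transition g.1).partner g.2)) h h'

namespace EulerSystem

variable {D : LinkDiagram n}

/-- Following a circuit of `C`: after leaving a vertex through the half-edge `h`, we traverse the
edge of `h` and leave the vertex at its other end through `h'`. -/
def Follows (C : D.EulerSystem) (h h' : D.HalfEdge) : Prop :=
  ∃ g : D.HalfEdge, D.IsEdge h g ∧ h' = (g.1, (C.transition g.1).partner g.2)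

/-- Following a circuit of `C` we encounter first `v`, then `w`, then `v` again and then `w` again
(within a single tour of the circuit). -/
def Alternates (C : D.EulerSystem) (v w : D.Vertex) : Prop :=
  ∃ (s : ℕ → D.HalfEdge) (i j k : ℕ), (∀ m, C.Follows (s m) (s (m + 1))) ∧
    0 < i ∧ i < j ∧ j < k ∧ Set.InjOn s (Set.Iic k) ∧
    (s 0).1 = v ∧ (s i).1 = w ∧ (s j).1 = v ∧ (s k).1 = w

/-- The interlacement relation on distinct vertices. -/
def interlacement (C : D.EulerSystem) : SimpleGraph D.Vertex := SimpleGraph.fromRel C.Alternates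

/-- With respect to an orientation of the incident circuit of `C`, the transition `T` at `v` pairs
half-edges entering `v` with half-edges leaving `v`: no tour of this circuit leaves `v` through
both of the half-edges of a pair. -/
def IsConsistent (C : D.EulerSystem) (v : D.Vertex) (T : Transition) : Prop :=
  ∀ x : Bool × Bool, ¬ Relation.ReflTransGen C.Follows (v, x) (v, T.partner x)

end EulerSystem

end LinkDiagram

/-! ### Marked graphs -/

/-- The six labels of the vertices of a marked graph. -/
inductive Mark
  | unmarked
  | c
  | r
  | u
  | cr
  | ur

/-- The effect of a marked local complementation on the mark of the vertex itself. -/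
def Mark.atVertex : Mark → Mark
  | .unmarked => .u
  | .u => .unmarked
  | .r => .ur
  | .ur => .r
  | .c => .cr
  | .cr => .c

/-- The effect of a marked local complementation on the marks of the neighbors of the vertex. -/
def Mark.atNeighbor : Mark → Mark
  | .unmarked => .r
  | .r => .unmarked
  | .c => .ur
  | .ur => .c
  | .u => .cr
  | .cr => .u

/-- A finite (multiply) marked graph, with looped and unlooped vertices and with free loops. -/
structure MarkedGraph where
  V : Type
  finite : Finite V
  graph : SimpleGraph V
  looped : V → Prop
  mark : V → Mark
  freeLoops : ℕ

namespace MarkedGraph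

/-- Isomorphism of marked graphs. -/
def IsIsomorphic (G G' : MarkedGraph) : Prop :=
  G.freeLoops = G'.freeLoops ∧ ∃ e : G.graph ≃g G'.graph,
    ∀ v, (G'.looped (e v) ↔ G.looped v) ∧ G'.mark (e v) = G.mark v

open Classical in
/-- The marked local complement of `G` with respect to `v`. -/
noncomputable def localComplement (G : MarkedGraph) (v : G.V) : MarkedGraph where
  V := G.V
  finite := G.finite
  graph := SimpleGraph.fromRel fun x y =>
    Xor (G.graph.Adj x y) (G.graph.Adj v x ∧ G.graph.Adj v y)
  looped := G.looped
  mark := fun x =>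
    if x = v then (G.mark x).atVertex
    else if G.graph.Adj v x then (G.mark x).atNeighbor
    else G.mark x
  freeLoops := G.freeLoops

/-- The marked pivot of `G` with respect to (adjacent vertices) `v` and `w`. -/
noncomputable def pivot (G : MarkedGraph) (v w : G.V) : MarkedGraph :=
  ((G.localComplement v).localComplement w).localComplement v

/-- Removal of a set of vertices. -/
def delete (G : MarkedGraph) (S : Set G.V) : MarkedGraph where
  V := {x : G.V // x ∉ S}
  finite := by
    have := G.finite
    infer_instance
  graph := G.graph.comap Subtype.val
  looped := fun x => G.looped x.1
  mark := fun x => G.mark x.1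
  freeLoops := G.freeLoops

/-- Adjoining a free loop. -/
def addFreeLoop (G : MarkedGraph) : MarkedGraph where
  V := G.V
  finite := G.finite
  graph := G.graph
  looped := G.looped
  mark := G.mark
  freeLoops := G.freeLoops + 1

/-- Toggling all the loops (at vertices). -/
def toggleLoops (G : MarkedGraph) : MarkedGraph where
  V := G.V
  finite := G.finite
  graph := G.graph
  looped := fun x => ¬ G.looped x
  mark := G.mark
  freeLoops := G.freeLoops

/-- Removal of the edges among the vertices in a set. -/
def deleteEdgesWithin (G : MarkedGraph) (S : Set G.V) : MarkedGraph where
  V := G.V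
  finite := G.finite
  graph := SimpleGraph.fromRel fun x y => G.graph.Adj x y ∧ ¬ (x ∈ S ∧ y ∈ S)
  looped := G.looped
  mark := G.mark
  freeLoops := G.freeLoops

/-- `Ω.1` (removal): an isolated vertex whose mark does not involve `c` or `r` is removed. -/
def Omega1 (G G' : MarkedGraph) : Prop :=
  ∃ v : G.V, (∀ x, ¬ G.graph.Adj v x) ∧ (G.mark v = .unmarked ∨ G.mark v = .u) ∧
    IsIsomorphic (G.delete {v}) G'

/-- `v` and `w` have the same neighbors outside of `{v, w}`. -/
def SameOutsideNeighbors (G : MarkedGraph) (v w : G.V) : Prop :=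
  ∀ x, x ≠ v → x ≠ w → (G.graph.Adj v x ↔ G.graph.Adj w x)

/-- `w` is the only neighbor of `v`. -/
def OnlyNeighbor (G : MarkedGraph) (v w : G.V) : Prop := ∀ x, G.graph.Adj v x ↔ x = w

/-- The four kinds of `Ω.2` moves (in the direction that removes vertices). -/
inductive Omega2 : MarkedGraph → MarkedGraph → Prop
  | a (G G' : MarkedGraph) (v w : G.V) : G.looped v → ¬ G.looped w →
      G.mark v = .unmarked → G.mark w = .unmarked → G.SameOutsideNeighbors v w →
      IsIsomorphic (G.delete {v, w}) G' → Omega2 G G'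
  | b (G G' : MarkedGraph) (v w z : G.V) : G.looped v → ¬ G.looped w →
      G.mark v = .c → G.mark w = .unmarked → G.OnlyNeighbor w v →
      z ≠ v → z ≠ w → G.graph.Adj v z →
      IsIsomorphic ((G.pivot v z).delete {v, w}) G' → Omega2 G G'
  | c (G G' : MarkedGraph) (v w z : G.V) : G.looped v → ¬ G.looped w →
      G.mark v = .c → G.mark w = .unmarked → G.SameOutsideNeighbors v w →
      z ≠ v → z ≠ w → G.graph.Adj v z → G.graph.Adj w z →
      IsIsomorphic ((G.pivot v z).delete {v, w}) G' → Omega2 G G'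
  | d (G G' : MarkedGraph) (v w : G.V) : G.looped v → ¬ G.looped w →
      G.mark v = .c → G.mark w = .unmarked → G.OnlyNeighbor w v → G.OnlyNeighbor v w →
      IsIsomorphic (G.addFreeLoop.delete {v, w}) G' → Omega2 G G'

/-- The basic `Ω.3` move: the three edges among `u`, `v`, `w` are removed. -/
def Omega3 (G G' : MarkedGraph) : Prop :=
  ∃ u v w : G.V, G.mark u = .unmarked ∧ G.mark v = .unmarked ∧ G.mark w = .unmarked ∧
    G.graph.Adj u v ∧ G.graph.Adj u w ∧ G.graph.Adj v w ∧
    G.looped u ∧ ¬ G.looped v ∧ ¬ G.looped w ∧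
    (∀ x, x ≠ u → x ≠ v → x ≠ w →
      (¬ G.graph.Adj x u ∧ ¬ G.graph.Adj x v ∧ ¬ G.graph.Adj x w) ∨
      (G.graph.Adj x u ∧ G.graph.Adj x v ∧ ¬ G.graph.Adj x w) ∨
      (G.graph.Adj x u ∧ ¬ G.graph.Adj x v ∧ G.graph.Adj x w) ∨
      (¬ G.graph.Adj x u ∧ G.graph.Adj x v ∧ G.graph.Adj x w)) ∧
    IsIsomorphic (G.deleteEdgesWithin {u, v, w}) G'

/-- The moves `Ω.1`, `Ω.2`, `Ω.3` and the mirror image of `Ω.3`, in one of the two directions. -/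
def OmegaForward (G G' : MarkedGraph) : Prop :=
  Omega1 G G' ∨ Omega2 G G' ∨ Omega3 G G' ∨ Omega3 G.toggleLoops G'.toggleLoops

/-- `G'` is a marked local complement of `G` (up to isomorphism). -/
def IsLocalComplementation (G G' : MarkedGraph) : Prop :=
  ∃ v : G.V, IsIsomorphic (G.localComplement v) G'

/-- A marked-graph Reidemeister move: marked local complementations, followed by one of the moves
`Ω.1`, `Ω.2`, `Ω.3` or an inverse, followed by marked local complementations. -/
def IsReidemeisterMove (G G' : MarkedGraph) : Prop :=
  ∃ H H' : MarkedGraph, Relation.ReflTransGen IsLocalComplementation G H ∧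
    (OmegaForward H H' ∨ OmegaForward H' H) ∧
    Relation.ReflTransGen IsLocalComplementation H' G'

/-- `G'` can be obtained (up to isomorphism) from `G` by using marked local complementation and
marked-graph Reidemeister moves. -/
def ObtainableFrom (G' G : MarkedGraph) : Prop :=
  Relation.ReflTransGen
    (fun H H' => IsIsomorphic H H' ∨ IsLocalComplementation H H' ∨ IsReidemeisterMove H H') G G'

end MarkedGraph

/-! ### Marked interlacement graphs of diagrams -/

namespace LinkDiagram

variable {n : ℕ} {D : LinkDiagram n}

open Classical in
/-- The mark of the vertex `v`, determined by how the link component(s) and the Euler system `C`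
pass through the crossing: it depends on which transition `C` uses at `v`, and on which of the two
other transitions is consistent with an orientation of the incident circuit of `C`. -/
noncomputable def EulerSystem.mark (C : D.EulerSystem) (v : D.Vertex) : Mark :=
  match C.transition v with
  | .straight => if C.IsConsistent v .oriented then .unmarked else .r
  | .oriented => if C.IsConsistent v .straight then .c else .ur
  | .disoriented => if C.IsConsistent v .straight then .cr else .u

/-- The marked interlacement graph of `D` with respect to the Euler system `C`. -/
noncomputable def markedInterlacementGraph (D : LinkDiagram n) (C : D.EulerSystem) :
    MarkedGraph where
  V := D.Vertex
  finite := inferInstance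
  graph := C.interlacement
  looped := fun v => D.IsNegative v.1
  mark := C.mark
  freeLoops := D.componentCount - 1

end LinkDiagram

set_option linter.unusedSectionVars false
set_option linter.unnecessarySeqFocus false

/-! Label the edges of the universe graph by elements of ℤ/2 so that the four labels at each
crossing have even sum. At one crossing, up to adding a constant, such a labelling is either trivial
or singles out one of the three transitions, so it is an element of the Klein group `Klein`. All
labellings together give a subspace `LinkDiagram.space` of `V → Klein`. This is an isotropic system
in the sense of Bouchet: its dimension is the number of crossings and it is its own orthogonal
complement under the symplectic form. The orientation of the link adds that every vector has an even
number of disoriented entries (`Gauss.quad_gaussVec`), so the space is Lagrangian for a quadratic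
form (`IsLagrangian`).

An Euler system selects a nonzero τ(v) at each vertex such that no nonzero vector of the space has
all its entries in {0, τ}. Cut a circuit at v and take the loop up to the first return. Its vector
has entries in {0, τ} away from v, is nonzero there exactly at the vertices interlaced with v, and
at v equals the other consistent transition χ(v). The mark of v is the pair (τ(v), χ(v)), so the
marked interlacement graph is the same thing as this fundamental basis (`EulerSystem.rep`). Marked
local complementation at v is the change of basis caused by replacing τ(v) with τ(v) + χ(v), and any
two fundamental bases of one space are connected by such changes (`Rep.reflTransGen`). Hence only
the space, the signs and the number of free loops matter (`State`), and for every move the Euler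
system may be chosen to suit: `IsLagrangian.exists_rep` extends admissible straight or oriented
choices at some vertices to all of them.

The first two Reidemeister moves add crossings whose straight smoothing gives back the old space,
and the monogon or bigon contributes a vector supported on the new crossings. For a bigon, Ω.2(a)
applies unless the vector with two straight entries lies in the space; in that case the bigon joins
two otherwise disconnected parts and Ω.2(d) applies. The kinds (b) and (c) are not needed.

The third move acts on vectors by a linear involution `phi`, which toggles the adjacencies within
the triangle if the Euler system goes straight at its corners. This is Ω.3 when the triangle is
coherently oriented. If no Euler system goes straight at all corners, auxiliary bigons (twins) are
first adjoined to destroy the obstructing vectors (`reidemeister3_coherent`). A triangle that is not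
coherent is traded for a coherent one by adjoining one bigon and removing another
(`reidemeister3_incoherent`). Ω.3 also requires that the three signs not be all equal; this holds
because the three strands are linearly ordered by height.

It remains to read off from the curves in the plane how each move affects the order of the passages
on the link components, the signs and the number of components. -/

/-! ### The Klein four-group with its symplectic form -/

/-- The Klein group of the transitions at a vertex; the first coordinate is the coefficient of the
straight transition, the second one is the coefficient of the oriented transition. -/
abbrev Klein : Type := ZMod 2 × ZMod 2

namespace Klein

/-- The straight transition. -/
abbrev s : Klein := (1, 0)

/-- The oriented transition. -/
abbrev o : Klein := (0, 1)

/-- The disoriented transition. -/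
abbrev d : Klein := (1, 1)

/-- The symplectic form of the Klein group. -/
def symp (x y : Klein) : ZMod 2 := x.1 * y.2 + x.2 * y.1

lemma symp_add_left (x y z : Klein) : symp (x + y) z = symp x z + symp y z := by
  simp only [symp, Prod.fst_add, Prod.snd_add]; ring

lemma symp_add_right (x y z : Klein) : symp x (y + z) = symp x y + symp x z := by
  simp only [symp, Prod.fst_add, Prod.snd_add]; ring

lemma symp_comm (x y : Klein) : symp x y = symp y x := by
  simp only [symp]; ring

@[simp] lemma symp_zero_left (x : Klein) : symp 0 x = 0 := by simp [symp]

@[simp] lemma symp_zero_right (x : Klein) : symp x 0 = 0 := by simp [symp]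

@[simp] lemma symp_self (x : Klein) : symp x x = 0 := by
  revert x; decide

lemma add_self (x : Klein) : x + x = 0 := by
  revert x; decide

end Klein

open Klein

lemma ZMod.two_cases (x : ZMod 2) : x = 0 ∨ x = 1 := by
  revert x; decide

namespace Mark

/-- The transition used by the Euler system at a vertex with a given mark. -/
def tau : Mark → Klein
  | .unmarked => s
  | .r => s
  | .c => o
  | .ur => o
  | .u => d
  | .cr => d

/-- The other consistent transition at a vertex with a given mark. -/
def chi : Mark → Klein
  | .unmarked => o
  | .r => d
  | .c => s
  | .ur => d
  | .u => o
  | .cr => s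

/-- Local complementation becomes linear in the coordinates (τ, χ): the vertex itself adds χ to τ,
and a neighbor adds τ to χ. -/
lemma tau_atVertex (m : Mark) : m.atVertex.tau = m.tau + m.chi := by cases m <;> decide
lemma chi_atVertex (m : Mark) : m.atVertex.chi = m.chi := by cases m <;> decide
lemma tau_atNeighbor (m : Mark) : m.atNeighbor.tau = m.tau := by cases m <;> decide
lemma chi_atNeighbor (m : Mark) : m.atNeighbor.chi = m.chi + m.tau := by cases m <;> decide
lemma tau_ne_zero (m : Mark) : m.tau ≠ 0 := by cases m <;> decide
lemma chi_ne_zero (m : Mark) : m.chi ≠ 0 := by cases m <;> decide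
lemma symp_chi_tau (m : Mark) : symp m.chi m.tau = 1 := by cases m <;> decide

lemma ext_tau_chi {m m' : Mark} (h : m.tau = m'.tau) (h' : m.chi = m'.chi) : m = m' := by
  cases m <;> cases m' <;> first | rfl | (exfalso; revert h h'; decide)

lemma cases_tau_chi (m : Mark) (k : Klein) :
    k = 0 ∨ k = m.tau ∨ k = m.chi ∨ k = m.tau + m.chi := by
  revert k; cases m <;> decide

lemma chi_eq_or (m m' : Mark) (h : m.tau = m'.tau) : m.chi = m'.chi ∨ m.chi = m'.chi + m'.tau := by
  cases m <;> cases m' <;> revert h <;> decide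

lemma symp_tau_eq_zero (m : Mark) (k : Klein) : symp k m.tau = 0 ↔ k = 0 ∨ k = m.tau := by
  revert k; cases m <;> decide

end Mark

/-! ### Vectors of transitions -/

namespace Isotropic

open scoped Classical in
/-- The symplectic form on vectors of transitions. -/
noncomputable def form {V : Type} [Fintype V] : LinearMap.BilinForm (ZMod 2) (V → Klein) :=
  LinearMap.mk₂ (ZMod 2) (fun a b => ∑ v, symp (a v) (b v))
    (fun a a' b => by simp [symp_add_left, Finset.sum_add_distrib])
    (fun c a b => by
      simp only [symp, Pi.smul_apply, Prod.smul_fst, Prod.smul_snd, smul_eq_mul, Finset.mul_sum]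
      exact Finset.sum_congr rfl fun _ _ => by ring)
    (fun a b b' => by simp [symp_add_right, Finset.sum_add_distrib])
    (fun c a b => by
      simp only [symp, Pi.smul_apply, Prod.smul_fst, Prod.smul_snd, smul_eq_mul, Finset.mul_sum]
      exact Finset.sum_congr rfl fun _ _ => by ring)

/-- The number of disoriented entries modulo two. -/
def quad {V : Type} [Fintype V] (a : V → Klein) : ZMod 2 := ∑ v, (a v).1 * (a v).2

variable {V : Type} [Fintype V]

lemma form_apply (a b : V → Klein) : form a b = ∑ v, symp (a v) (b v) := rfl

lemma form_comm (a b : V → Klein) : form a b = form b a := by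
  simp only [form_apply, symp_comm]

/-- The mixed terms of the product are the symplectic form, so `quad` is a quadratic form with
polarization `form`. A subspace on which `quad` vanishes is therefore isotropic. -/
lemma quad_add (a b : V → Klein) : quad (a + b) = quad a + quad b + form a b := by
  simp only [quad, form_apply, symp, ← Finset.sum_add_distrib, Pi.add_apply, Prod.fst_add,
    Prod.snd_add]
  exact Finset.sum_congr rfl fun _ _ => by ring

lemma quad_zero : quad (0 : V → Klein) = 0 := by simp [quad]

lemma vec_add_self (a : V → Klein) : a + a = 0 := funext fun v => Klein.add_self (a v)

lemma eq_of_add_eq_zero {a b : V → Klein} (h : a + b = 0) : a = b := by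
  have := congrArg (· + b) h
  simpa [add_assoc, vec_add_self] using this

open scoped Classical in
lemma form_single_left (v : V) (k : Klein) (a : V → Klein) :
    form (Pi.single v k) a = symp k (a v) := by
  rw [form_apply, Finset.sum_eq_single v]
  · simp
  · intro w _ hw; simp [hw]
  · simp

open scoped Classical in
lemma quad_single (v : V) (k : Klein) : quad (Pi.single v k : V → Klein) = k.1 * k.2 := by
  rw [quad, Finset.sum_eq_single v]
  · simp
  · intro w _ hw; simp [hw]
  · simp

lemma form_nondegenerate : (form (V := V)).Nondegenerate := by
  classical
  have key : ∀ a : V → Klein, (∀ b, form a b = 0) → a = 0 := by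
    intro a h
    funext v
    have h1 := h (Pi.single v s)
    have h2 := h (Pi.single v o)
    rw [form_comm, form_single_left] at h1 h2
    exact (show ∀ k : Klein, symp s k = 0 → symp o k = 0 → k = 0 by decide) _ h1 h2
  exact ⟨key, fun b h => key b fun a => by rw [form_comm]; exact h a⟩

/-! ### Lagrangian subspaces -/

/-- A subspace of vectors of transitions which is maximal among those on which the number of
disoriented entries is even. -/
structure IsLagrangian (L : Submodule (ZMod 2) (V → Klein)) : Prop where
  quad_eq_zero : ∀ a ∈ L, quad a = 0
  finrank_eq : Module.finrank (ZMod 2) L = Fintype.card V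

lemma IsLagrangian.form_eq_zero {L : Submodule (ZMod 2) (V → Klein)} (hL : IsLagrangian L)
    {a b : V → Klein} (ha : a ∈ L) (hb : b ∈ L) : form a b = 0 := by
  have h := hL.quad_eq_zero _ (L.add_mem ha hb)
  rw [quad_add, hL.quad_eq_zero _ ha, hL.quad_eq_zero _ hb] at h
  simpa using h

lemma finrank_vec : Module.finrank (ZMod 2) (V → Klein) = 2 * Fintype.card V := by
  rw [Module.finrank_pi_fintype]
  simp [Module.finrank_prod, mul_comm]

/-- The orthogonal complement contains `L` and has dimension 2|V| - |V| = |V|, so it equals `L`.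
Vectors can thus be recognized as elements of `L` without exhibiting an edge labelling. -/
lemma IsLagrangian.mem_of_form {L : Submodule (ZMod 2) (V → Klein)} (hL : IsLagrangian L)
    {a : V → Klein} (h : ∀ b ∈ L, form b a = 0) : a ∈ L := by
  have hrefl : (form (V := V)).IsRefl := fun x y h => by rw [form_comm]; exact h
  have h1 := LinearMap.BilinForm.finrank_orthogonal form_nondegenerate L
  have h2 : L ≤ form.orthogonal L := fun x hx y hy => hL.form_eq_zero hy hx
  have h3 : L = form.orthogonal L := by
    apply Submodule.eq_of_le_of_finrank_eq h2
    rw [h1, hL.finrank_eq, finrank_vec]; omega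
  rw [h3]
  exact fun b hb => h b hb

/-! ### Fundamental vectors of marked graphs -/

open scoped Classical in
/-- The fundamental vector of a vertex of a marked graph. -/
noncomputable def fund (g : SimpleGraph V) (m : V → Mark) (v : V) : V → Klein := fun w =>
  if w = v then (m v).chi else if g.Adj v w then (m w).tau else 0

/-- A vector with entries in the Euler system given by the marks. -/
def InEuler (m : V → Mark) (a : V → Klein) : Prop := ∀ w, a w = 0 ∨ a w = (m w).tau

/-- The marked graph represents the space `L`. -/
structure Rep (g : SimpleGraph V) (m : V → Mark) (L : Submodule (ZMod 2) (V → Klein)) : Prop where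
  fund_mem : ∀ v, fund g m v ∈ L
  eq_zero : ∀ a ∈ L, InEuler m a → a = 0

lemma fund_self (g : SimpleGraph V) (m : V → Mark) (v : V) : fund g m v v = (m v).chi := by
  simp [fund]

lemma fund_ne (g : SimpleGraph V) (m : V → Mark) {v w : V} (h : w ≠ v) :
    fund g m v w = 0 ∨ fund g m v w = (m w).tau := by
  simp only [fund, h, if_false]; split_ifs <;> simp

lemma fund_adj {g : SimpleGraph V} {m : V → Mark} {v w : V} (h : g.Adj v w) :
    fund g m v w = (m w).tau := by
  simp [fund, h, h.ne']

lemma fund_not_adj {g : SimpleGraph V} {m : V → Mark} {v w : V} (hw : w ≠ v) (h : ¬ g.Adj v w) :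
    fund g m v w = 0 := by
  simp [fund, h, hw]

lemma adj_iff_fund {g : SimpleGraph V} {m : V → Mark} {v w : V} (hw : w ≠ v) :
    g.Adj v w ↔ fund g m v w ≠ 0 := by
  by_cases h : g.Adj v w
  · simp [fund_adj h, h, Mark.tau_ne_zero]
  · simp [fund_not_adj hw h, h]

-- Pairing entrywise with τ sends the fundamental vectors to the standard basis. A vector of the
-- space is therefore identified as a sum of fundamental vectors by its pairings with τ.
open scoped Classical in
lemma symp_fund (g : SimpleGraph V) (m : V → Mark) (v w : V) :
    symp (fund g m v w) (m w).tau = if w = v then 1 else 0 := by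
  by_cases hv : w = v
  · subst hv; simp [fund_self, Mark.symp_chi_tau]
  · simp [hv, (Mark.symp_tau_eq_zero _ _).2 (fund_ne g m hv)]

/-- The sum of the two fundamental vectors at v has entries in {0, τ}: away from v each of them
does, and at v two possible values of χ differ by 0 or τ. Hence the sum vanishes, and τ alone
determines the graph and the marks. -/
lemma Rep.unique {g g' : SimpleGraph V} {m m' : V → Mark} {L : Submodule (ZMod 2) (V → Klein)}
    (h : Rep g m L) (h' : Rep g' m' L) (hm : ∀ v, (m v).tau = (m' v).tau) : g = g' ∧ m = m' := by
  have key : ∀ v, fund g m v = fund g' m' v := by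
    intro v
    apply eq_of_add_eq_zero
    apply h.eq_zero _ (L.add_mem (h.fund_mem v) (h'.fund_mem v))
    intro w
    by_cases hw : w = v
    · subst hw
      rw [Pi.add_apply, fund_self, fund_self]
      rcases Mark.chi_eq_or (m w) (m' w) (hm w) with h1 | h1
      · left; rw [h1, Klein.add_self]
      · right; rw [h1, add_comm, ← add_assoc, Klein.add_self, zero_add, hm]
    · rw [Pi.add_apply]
      have h1 := fund_ne g m hw
      have h2 := fund_ne g' m' hw
      rw [← hm] at h2
      rcases h1 with h1 | h1 <;> rcases h2 with h2 | h2 <;> simp [h1, h2, -Prod.mk_add_mk] <;>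
        exact Or.inl (Klein.add_self _)
  constructor
  · ext v w
    by_cases hw : w = v
    · subst hw; simp
    · rw [adj_iff_fund (m := m) hw, adj_iff_fund (m := m') hw, key]
  · funext v
    apply Mark.ext_tau_chi (hm v)
    rw [← fund_self g, ← fund_self g', key]

/-! ### Local complementation -/

/-- The graph of a local complement. -/
def lcGraph (g : SimpleGraph V) (v : V) : SimpleGraph V :=
  SimpleGraph.fromRel fun x y => Xor (g.Adj x y) (g.Adj v x ∧ g.Adj v y)

open Classical in
/-- The marks of a local complement. -/
noncomputable def lcMark (g : SimpleGraph V) (m : V → Mark) (v : V) : V → Mark := fun x =>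
  if x = v then (m x).atVertex else if g.Adj v x then (m x).atNeighbor else m x

/-- The marked graph with given data. -/
def _root_.MarkedGraph.ofData {V : Type} [Finite V] (g : SimpleGraph V) (m : V → Mark)
    (neg : V → Prop) (f : ℕ) : MarkedGraph := ⟨V, inferInstance, g, neg, m, f⟩

lemma lcGraph_adj (g : SimpleGraph V) (v x y : V) : (lcGraph g v).Adj x y ↔
    x ≠ y ∧ Xor (g.Adj x y) (g.Adj v x ∧ g.Adj v y) := by
  simp only [lcGraph, SimpleGraph.fromRel_adj, g.adj_comm y x, and_comm (a := g.Adj v y), or_self]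

lemma tau_lcMark_ne (g : SimpleGraph V) (m : V → Mark) {v w : V} (h : w ≠ v) :
    (lcMark g m v w).tau = (m w).tau := by
  simp only [lcMark, h, if_false]; split_ifs <;> simp [Mark.tau_atNeighbor]

lemma tau_lcMark_self (g : SimpleGraph V) (m : V → Mark) (v : V) :
    (lcMark g m v v).tau = (m v).tau + (m v).chi := by
  simp [lcMark, Mark.tau_atVertex]

lemma chi_lcMark_adj {g : SimpleGraph V} {m : V → Mark} {v w : V} (h : g.Adj v w) :
    (lcMark g m v w).chi = (m w).chi + (m w).tau := by
  simp [lcMark, h.ne', h, Mark.chi_atNeighbor]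

/-- Entries at common neighbors of v and w cancel, so the sum is supported on the symmetric
difference of the neighborhoods, exactly as in the local complement. At v the sum has τ + χ, which
is the new τ. -/
lemma fund_lc_adj {g : SimpleGraph V} {m : V → Mark} {v w : V} (h : g.Adj v w) :
    fund (lcGraph g v) (lcMark g m v) w = fund g m w + fund g m v := by
  funext x
  rw [Pi.add_apply]
  by_cases hx : x = w
  · subst hx
    rw [fund_self, fund_self, chi_lcMark_adj h, fund_adj h]
  by_cases hxv : x = v
  · subst hxv
    rw [fund_self, fund_adj h.symm, fund_adj, tau_lcMark_self]
    rw [lcGraph_adj]; exact ⟨h.ne', Or.inl ⟨h.symm, by simp⟩⟩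
  have e := lcGraph_adj g v w x
  by_cases h1 : g.Adj w x <;> by_cases h2 : g.Adj v x
  · rw [fund_not_adj hx (by simp [e, h1, h2, h, Xor]), fund_adj h1, fund_adj h2, Klein.add_self]
  · rw [fund_adj (e.2 ⟨Ne.symm hx, by simp [h1, h2, Xor]⟩), fund_adj h1, fund_not_adj hxv h2,
      add_zero, tau_lcMark_ne _ _ hxv]
  · rw [fund_adj (e.2 ⟨Ne.symm hx, by simp [h1, h2, h, Xor]⟩), fund_adj h2, fund_not_adj hx h1,
      zero_add, tau_lcMark_ne _ _ hxv]
  · rw [fund_not_adj hx (by simp [e, h1, h2, Xor]), fund_not_adj hx h1, fund_not_adj hxv h2,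
      add_zero]

lemma fund_lc_not_adj {g : SimpleGraph V} {m : V → Mark} {v w : V} (h : ¬ g.Adj v w) :
    fund (lcGraph g v) (lcMark g m v) w = fund g m w := by
  funext x
  by_cases hx : x = w
  · subst hx
    rw [fund_self, fund_self]
    by_cases hxv : x = v
    · simp [lcMark, hxv, Mark.chi_atVertex]
    · simp [lcMark, hxv, h]
  have e : (lcGraph g v).Adj w x ↔ g.Adj w x := by
    rw [lcGraph_adj]; simp [h, Ne.symm hx, Xor]
  by_cases h1 : g.Adj w x
  · rw [fund_adj (e.2 h1), fund_adj h1]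
    apply tau_lcMark_ne
    rintro rfl
    exact h h1.symm
  · rw [fund_not_adj hx (by rwa [e]), fund_not_adj hx h1]

/-- A nonzero vector with entries in the new transitions would have τ + χ at v. Adding the
fundamental vector of v turns this into τ, so the sum lies in the old Euler system and vanishes. The
vector then equals the fundamental vector, which has χ at v, and this forces τ = 0. -/
lemma Rep.localComplement {g : SimpleGraph V} {m : V → Mark}
    {L : Submodule (ZMod 2) (V → Klein)} (h : Rep g m L) (v : V) :
    Rep (lcGraph g v) (lcMark g m v) L := by
  refine ⟨fun w => ?_, fun a ha hE => ?_⟩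
  · by_cases hw : g.Adj v w
    · rw [fund_lc_adj hw]; exact L.add_mem (h.fund_mem w) (h.fund_mem v)
    · rw [fund_lc_not_adj hw]; exact h.fund_mem w
  · have hne : ∀ w, w ≠ v → a w = 0 ∨ a w = (m w).tau := fun w hw => by
      rw [← tau_lcMark_ne g m hw]; exact hE w
    rcases hE v with h0 | h1
    · apply h.eq_zero a ha
      intro w
      by_cases hw : w = v
      · subst hw; exact Or.inl h0
      · exact hne w hw
    · exfalso
      rw [tau_lcMark_self] at h1
      have : a = fund g m v := by
        apply eq_of_add_eq_zero
        apply h.eq_zero _ (L.add_mem ha (h.fund_mem v))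
        intro w
        by_cases hw : w = v
        · subst hw
          right
          rw [Pi.add_apply, fund_self, h1, add_assoc, Klein.add_self, add_zero]
        · rw [Pi.add_apply]
          rcases hne w hw with h1 | h1 <;> rcases fund_ne g m hw with h2 | h2 <;>
            simp [h1, h2, -Prod.mk_add_mk] <;> exact Or.inl (Klein.add_self _)
      rw [this, fund_self] at h1
      exact Mark.tau_ne_zero (m v) (by simpa using h1)

lemma _root_.MarkedGraph.IsIsomorphic.refl (G : MarkedGraph) : MarkedGraph.IsIsomorphic G G :=
  ⟨rfl, SimpleGraph.Iso.refl, fun _ => ⟨Iff.rfl, rfl⟩⟩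

lemma isLocalComplementation_ofData (g : SimpleGraph V) (m : V → Mark) (neg : V → Prop) (f : ℕ)
    (v : V) : MarkedGraph.IsLocalComplementation (MarkedGraph.ofData g m neg f)
      (MarkedGraph.ofData (lcGraph g v) (lcMark g m v) neg f) :=
  ⟨v, MarkedGraph.IsIsomorphic.refl _⟩

/-- Any two marked graphs representing the same space are related by marked local
complementations. -/
theorem Rep.reflTransGen {g g' : SimpleGraph V} {m m' : V → Mark}
    {L : Submodule (ZMod 2) (V → Klein)} (h : Rep g m L) (h' : Rep g' m' L)
    (neg : V → Prop) (f : ℕ) :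
    Relation.ReflTransGen MarkedGraph.IsLocalComplementation
      (MarkedGraph.ofData g m neg f) (MarkedGraph.ofData g' m' neg f) := by
  classical
  -- Induction on the number of vertices where the two Euler systems use different transitions.
  induction hn : (Finset.univ.filter fun v => (m v).tau ≠ (m' v).tau).card using
    Nat.strong_induction_on generalizing g m with
  | _ n ih =>
  -- If the wanted transition at v is τ + χ, local complementation at v corrects it and leaves τ
  -- unchanged at all other vertices.
  have step : ∀ (g₁ : SimpleGraph V) (m₁ : V → Mark) (v : V), Rep g₁ m₁ L →
      (m' v).tau = (m₁ v).tau + (m₁ v).chi →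
      (∀ w, (m₁ w).tau ≠ (m' w).tau → (m w).tau ≠ (m' w).tau) →
      Relation.ReflTransGen MarkedGraph.IsLocalComplementation
        (MarkedGraph.ofData g₁ m₁ neg f) (MarkedGraph.ofData g' m' neg f) := by
    intro g₁ m₁ v h₁ hv hsub
    refine Relation.ReflTransGen.head (isLocalComplementation_ofData g₁ m₁ neg f v) ?_
    refine ih _ ?_ (h₁.localComplement v) rfl
    rw [← hn]
    apply Finset.card_lt_card
    rw [Finset.ssubset_iff_of_subset]
    · refine ⟨v, ?_, ?_⟩
      · rw [Finset.mem_filter]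
        refine ⟨Finset.mem_univ _, hsub v ?_⟩
        rw [hv]
        intro hh
        exact Mark.chi_ne_zero (m₁ v) (by simpa using hh)
      · simp [tau_lcMark_self, hv]
    · intro w hw
      rw [Finset.mem_filter] at hw ⊢
      refine ⟨Finset.mem_univ _, hsub w ?_⟩
      by_cases hwv : w = v
      · subst hwv
        rw [hv, ← tau_lcMark_self g₁]
        exact absurd (by rw [tau_lcMark_self, hv]) hw.2
      · rw [← tau_lcMark_ne g₁ m₁ hwv]; exact hw.2
  by_cases hS : ∃ v, (m v).tau ≠ (m' v).tau
  · by_cases hc : ∃ v, (m' v).tau = (m v).tau + (m v).chi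
    · obtain ⟨v, hv⟩ := hc
      exact step g m v h hv fun w hw => hw
    · push Not at hc
      obtain ⟨v, hv⟩ := hS
      have hchi : ∀ w, (m w).tau ≠ (m' w).tau → (m' w).tau = (m w).chi := by
        intro w hw
        rcases Mark.cases_tau_chi (m w) (m' w).tau with h1 | h1 | h1 | h1
        · exact absurd h1 (Mark.tau_ne_zero _)
        · exact absurd h1.symm hw
        · exact h1
        · exact absurd h1 (hc w)
      -- At every differing vertex the wanted transition is now χ. If v had no differing neighbor,
      -- its fundamental vector would have all entries in the other Euler system, including χ at v
      -- itself, and would vanish.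
      have hw : ∃ w, (m w).tau ≠ (m' w).tau ∧ g.Adj v w := by
        by_contra hno
        push Not at hno
        have h0 : fund g m v = 0 := by
          apply h'.eq_zero _ (h.fund_mem v)
          intro w
          by_cases hwv : w = v
          · subst hwv; right; rw [fund_self, hchi w hv]
          · by_cases ht : (m w).tau = (m' w).tau
            · rw [← ht]; exact fund_ne g m hwv
            · left; exact fund_not_adj hwv (hno w ht)
        have := congrFun h0 v
        rw [fund_self] at this
        exact Mark.chi_ne_zero _ this
      obtain ⟨w, hw, hadj⟩ := hw
      -- After complementing at v the vertex w has χ + τ in place of χ, so its wanted transition is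
      -- now τ plus the new χ and `step` applies at w. The vertex v differed already, so the count
      -- has not grown in between.
      refine Relation.ReflTransGen.head (isLocalComplementation_ofData g m neg f v) ?_
      refine step _ _ w (h.localComplement v) ?_ ?_
      · rw [tau_lcMark_ne g m hadj.ne', chi_lcMark_adj hadj, hchi w hw, add_comm (m w).chi,
          ← add_assoc, Klein.add_self, zero_add]
      · intro x hx
        by_cases hxv : x = v
        · subst hxv; exact hv
        · rwa [tau_lcMark_ne g m hxv] at hx
  · push Not at hS
    obtain ⟨rfl, rfl⟩ := h.unique h' hS
    exact Relation.ReflTransGen.refl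

/-! ### Euler systems extending a partial choice of transitions -/

open scoped Classical in
/-- A partial choice of transitions, none of them disoriented, extends to an Euler system. -/
theorem IsLagrangian.exists_rep {L : Submodule (ZMod 2) (V → Klein)} (hL : IsLagrangian L)
    (W : Set V) (τ₀ : V → Klein) (hτ₀ : ∀ v, τ₀ v = s ∨ τ₀ v = o)
    (hW : ∀ a ∈ L, (∀ w ∉ W, a w = 0) → (∀ w ∈ W, a w = 0 ∨ a w = τ₀ w) → a = 0) :
    ∃ (g : SimpleGraph V) (m : V → Mark), Rep g m L ∧ (∀ w ∈ W, (m w).tau = τ₀ w) ∧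
      ∀ v, m v = .unmarked ∨ m v = .c := by
  -- the vectors of `L` with entries in the transitions `τ`
  let T : (V → Klein) → Submodule (ZMod 2) (V → Klein) := fun τ =>
    { carrier := {a | a ∈ L ∧ ∀ w, symp (a w) (τ w) = 0}
      add_mem' := fun ha hb => ⟨L.add_mem ha.1 hb.1, fun w => by
        rw [Pi.add_apply, symp_add_left, ha.2, hb.2, add_zero]⟩
      zero_mem' := ⟨L.zero_mem, by simp⟩
      smul_mem' := fun c a ha => ⟨L.smul_mem c ha.1, fun w => by
        rcases ZMod.two_cases c with rfl | rfl <;> simp [ha.2]⟩ }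
  have hso : ∀ x y : Klein, (y = s ∨ y = o) → (symp x y = 0 ↔ x = 0 ∨ x = y) := by decide
  have exists_min : ∃ τ : V → Klein, (∀ v, τ v = s ∨ τ v = o) ∧ (∀ w ∈ W, τ w = τ₀ w) ∧
      T τ = ⊥ := by
    -- Among the admissible choices take one for which the space of obstructing vectors has minimal
    -- dimension.
    let P : ℕ → Prop := fun k => ∃ τ : V → Klein, (∀ v, τ v = s ∨ τ v = o) ∧
      (∀ w ∈ W, τ w = τ₀ w) ∧ Module.finrank (ZMod 2) (T τ) = k
    have hP : ∃ k, P k := ⟨_, τ₀, hτ₀, fun _ _ => rfl, rfl⟩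
    obtain ⟨τ, h1, h2, h3⟩ := Nat.find_spec hP
    refine ⟨τ, h1, h2, ?_⟩
    by_contra hne
    obtain ⟨a, ha, ha0⟩ := (Submodule.ne_bot_iff _).1 hne
    have : ∃ v ∉ W, a v ≠ 0 := by
      by_contra hno
      push Not at hno
      refine ha0 (hW a ha.1 hno fun w hw => ?_)
      rw [← h2 w hw, ← hso _ _ (h1 w)]
      exact ha.2 w
    obtain ⟨v, hvW, hv⟩ := this
    -- Adding `d` exchanges `s` and `o`.
    let τ' : V → Klein := Function.update τ v (τ v + d)
    have hτ'v : τ' v = τ v + d := by simp [τ']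
    have hτ' : ∀ w, w ≠ v → τ' w = τ w := fun w hw => by simp [τ', hw]
    have hav : a v = τ v := by
      rcases (hso _ _ (h1 v)).1 (ha.2 v) with h | h
      · exact absurd h hv
      · exact h
    have hlt : T τ' < T τ := by
      -- Away from v the vectors a and b have entries in the same {0, τ}, so isotropy reduces to the
      -- term at v: the entry of b there is orthogonal to both τ and τ', hence zero. So b is an
      -- obstruction to τ as well, while a is no longer one.
      have hb : ∀ b ∈ T τ', b v = 0 := by
        intro b hb
        have hf := hL.form_eq_zero hb.1 ha.1
        rw [form_apply, Finset.sum_eq_single v] at hf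
        · have h4 := hb.2 v
          rw [hav] at hf
          rw [hτ'v] at h4
          revert hf h4
          rcases h1 v with h | h <;> rw [h] <;> generalize b v = k <;> revert k <;> decide
        · intro w _ hw
          have h4 := hb.2 w
          rw [hτ' w hw, hso _ _ (h1 w)] at h4
          have h5 := (hso _ _ (h1 w)).1 (ha.2 w)
          rcases h4 with h4 | h4 <;> rcases h5 with h5 | h5 <;> simp [h4, h5]
        · simp
      refine lt_of_le_of_ne (fun b hb' => ⟨hb'.1, fun w => ?_⟩) ?_
      · by_cases hw : w = v
        · subst hw; simp [hb b hb']
        · rw [← hτ' w hw]; exact hb'.2 w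
      · intro he
        exact hv (hb a (by rw [he]; exact ha))
    have hfin := Submodule.finrank_lt_finrank_of_lt hlt
    rw [h3] at hfin
    refine Nat.find_min hP hfin ⟨τ', fun w => ?_, fun w hw => ?_, rfl⟩
    · by_cases hw : w = v
      · subst hw
        rw [hτ'v]
        rcases h1 w with h | h <;> rw [h] <;> decide
      · rw [hτ' w hw]; exact h1 w
    · rw [hτ' w (by rintro rfl; exact hvW hw)]; exact h2 w hw
  obtain ⟨τ, hτ, hτW, hT⟩ := exists_min
  -- Pairing with τ is injective because there are no obstructing vectors, and bijective because `L`
  -- has dimension |V|. The preimages of the unit vectors will be the fundamental vectors.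
  let Φ : L →ₗ[ZMod 2] (V → ZMod 2) :=
    { toFun := fun a w => symp (a.1 w) (τ w)
      map_add' := fun a b => by funext w; simp [symp_add_left]
      map_smul' := fun c a => by
        funext w
        rcases ZMod.two_cases c with rfl | rfl <;> simp }
  have hinj : Function.Injective Φ := by
    rw [← LinearMap.ker_eq_bot, Submodule.eq_bot_iff]
    intro a ha
    have : a.1 ∈ T τ := ⟨a.2, fun w => congrFun ha w⟩
    rw [hT] at this
    exact Subtype.ext this
  have hsurj : Function.Surjective Φ := by
    rw [← LinearMap.injective_iff_surjective_of_finrank_eq_finrank]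
    · exact hinj
    · rw [hL.finrank_eq]; simp
  choose A hA using fun v => hsurj (Pi.single v 1)
  have hAself : ∀ v, symp ((A v).1 v) (τ v) = 1 := fun v => by
    have := congrFun (hA v) v
    simpa [Φ] using this
  have hAne : ∀ v w, w ≠ v → (A v).1 w = 0 ∨ (A v).1 w = τ w := fun v w hw => by
    rw [← hso _ _ (hτ w)]
    have := congrFun (hA v) w
    simpa [Φ, hw] using this
  have hτq : ∀ w, (τ w).1 * (τ w).2 = 0 := fun w => by
    rcases hτ w with h | h <;> rw [h] <;> decide
  -- Entries other than the one at v are 0, `s` or `o` and contribute nothing to `quad`, so the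
  -- entry at v is not disoriented. Here the quadratic form is needed and not only its polarization;
  -- it leaves only the marks unmarked and `c`.
  have hAd : ∀ v, ((A v).1 v).1 * ((A v).1 v).2 = 0 := by
    intro v
    have hq := hL.quad_eq_zero _ (A v).2
    rw [quad, Finset.sum_eq_single v] at hq
    · exact hq
    · intro w _ hw
      rcases hAne v w hw with h | h <;> rw [h]
      · simp
      · exact hτq w
    · simp
  have hsymm : ∀ v w, v ≠ w → (A v).1 w ≠ 0 → (A w).1 v ≠ 0 := by
    intro v w hvw hne h0
    have hf := hL.form_eq_zero (A v).2 (A w).2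
    rw [form_apply, Finset.sum_eq_single w] at hf
    · rw [(hAne v w hvw.symm).resolve_left hne, symp_comm, hAself] at hf
      exact one_ne_zero hf
    · intro x _ hx
      by_cases hxv : x = v
      · subst hxv; rw [h0]; simp
      · rcases hAne v x hxv with h1 | h1 <;> rcases hAne w x hx with h2 | h2 <;>
          simp [h1, h2]
    · simp
  let g : SimpleGraph V :=
    { Adj := fun v w => v ≠ w ∧ (A v).1 w ≠ 0
      symm := ⟨fun v w h => ⟨h.1.symm, hsymm v w h.1 h.2⟩⟩
      loopless := ⟨fun v h => h.1 rfl⟩ }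
  let m : V → Mark := fun v => if τ v = s then .unmarked else .c
  have hm : ∀ v, (m v).tau = τ v := by
    intro v
    simp only [m]
    rcases hτ v with h | h <;> rw [h] <;> decide
  have hmchi : ∀ v, (A v).1 v = (m v).chi := by
    intro v
    have h1 := hAself v
    have h2 := hAd v
    simp only [m]
    revert h1 h2
    rcases hτ v with h | h <;> rw [h] <;> generalize (A v).1 v = k <;> revert k <;> decide
  have hfund : ∀ v, fund g m v = (A v).1 := by
    intro v
    funext w
    by_cases hw : w = v
    · subst hw; rw [fund_self, hmchi]
    · by_cases h : (A v).1 w = 0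
      · rw [h, fund_not_adj hw]; exact fun h' => h'.2 h
      · rw [fund_adj (show g.Adj v w from ⟨Ne.symm hw, h⟩), hm]
        exact ((hAne v w hw).resolve_left h).symm
  refine ⟨g, m, ⟨fun v => by rw [hfund]; exact (A v).2, fun a ha hE => ?_⟩, fun w hw => ?_, ?_⟩
  · have : a ∈ T τ := ⟨ha, fun w => by rw [hso _ _ (hτ w), ← hm]; exact hE w⟩
    rw [hT] at this
    exact this
  · rw [hm, hτW w hw]
  · intro v
    simp only [m]
    split_ifs <;> simp

end Isotropic

namespace Isotropic

open MarkedGraph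

/-! ### Abstract diagrams and their equivalence -/

/-- An abstract diagram: a Lagrangian space of vectors of transitions, the signs of the vertices and
a number of free loops. -/
structure State where
  V : Type
  [fintype : Fintype V]
  L : Submodule (ZMod 2) (V → Klein)
  neg : V → Prop
  f : ℕ
  lagrangian : IsLagrangian L

attribute [instance] State.fintype

/-- Every marked graph representing `S'` is obtainable from every marked graph representing `S`. -/
def State.Reaches (S S' : State) : Prop :=
  ∀ (g : SimpleGraph S.V) (m : S.V → Mark) (g' : SimpleGraph S'.V) (m' : S'.V → Mark),
    Rep g m S.L → Rep g' m' S'.L →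
      ObtainableFrom (ofData g' m' S'.neg S'.f) (ofData g m S.neg S.f)

/-- The marked graphs representing `S` and `S'` are obtainable from each other. -/
def State.Equiv (S S' : State) : Prop := S.Reaches S' ∧ S'.Reaches S

lemma State.exists_rep (S : State) :
    ∃ (g : SimpleGraph S.V) (m : S.V → Mark), Rep g m S.L := by
  obtain ⟨g, m, h, -⟩ := S.lagrangian.exists_rep ∅ (fun _ => s) (fun _ => Or.inl rfl)
    (fun a _ h _ => funext fun w => h w (by simp))
  exact ⟨g, m, h⟩

lemma Rep.obtainable {V : Type} [Fintype V] {g g' : SimpleGraph V} {m m' : V → Mark}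
    {L : Submodule (ZMod 2) (V → Klein)} (h : Rep g m L) (h' : Rep g' m' L)
    (neg : V → Prop) (f : ℕ) : ObtainableFrom (ofData g' m' neg f) (ofData g m neg f) :=
  Relation.ReflTransGen.mono (fun _ _ h => Or.inr (Or.inl h)) _ _ (h.reflTransGen h' neg f)

/-- All graphs representing one space are obtainable from each other, so a single pair of
representatives decides. -/
lemma State.Equiv.of_rep {S S' : State} {g : SimpleGraph S.V} {m : S.V → Mark}
    {g' : SimpleGraph S'.V} {m' : S'.V → Mark} (h : Rep g m S.L) (h' : Rep g' m' S'.L)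
    (h₁ : ObtainableFrom (ofData g' m' S'.neg S'.f) (ofData g m S.neg S.f))
    (h₂ : ObtainableFrom (ofData g m S.neg S.f) (ofData g' m' S'.neg S'.f)) : S.Equiv S' :=
  ⟨fun _ _ _ _ k k' => ((k.obtainable h _ _).trans h₁).trans (h'.obtainable k' _ _),
    fun _ _ _ _ k k' => ((k.obtainable h' _ _).trans h₂).trans (h.obtainable k' _ _)⟩

lemma State.Equiv.refl (S : State) : S.Equiv S :=
  ⟨fun _ _ _ _ h h' => h.obtainable h' _ _, fun _ _ _ _ h h' => h.obtainable h' _ _⟩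

lemma State.Equiv.symm {S S' : State} (h : S.Equiv S') : S'.Equiv S := ⟨h.2, h.1⟩

lemma State.Equiv.trans {S S' S'' : State} (h : S.Equiv S') (h' : S'.Equiv S'') :
    S.Equiv S'' := by
  obtain ⟨g', m', k'⟩ := S'.exists_rep
  exact ⟨fun _ _ _ _ k k'' => (h.1 _ _ _ _ k k').trans (h'.1 _ _ _ _ k' k''),
    fun _ _ _ _ k k'' => (h'.2 _ _ _ _ k k').trans (h.2 _ _ _ _ k' k'')⟩

lemma State.Equiv.of_omega {S S' : State} {g : SimpleGraph S.V} {m : S.V → Mark}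
    {g' : SimpleGraph S'.V} {m' : S'.V → Mark} (h : Rep g m S.L) (h' : Rep g' m' S'.L)
    (hO : OmegaForward (ofData g m S.neg S.f) (ofData g' m' S'.neg S'.f)) : S.Equiv S' :=
  .of_rep h h'
    (Relation.ReflTransGen.single (Or.inr (Or.inr ⟨_, _, .refl, Or.inl hO, .refl⟩)))
    (Relation.ReflTransGen.single (Or.inr (Or.inr ⟨_, _, .refl, Or.inr hO, .refl⟩)))

/-! ### Smoothing vertices along the straight transition -/

section Smoothing

variable {V V' : Type} [Fintype V] [Fintype V'] {ι : V → V'}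
  {L : Submodule (ZMod 2) (V → Klein)} {L' : Submodule (ZMod 2) (V' → Klein)}

/-- `L` is obtained from `L'` by smoothing the vertices outside the range of `ι` along the straight
transition. -/
def IsSmoothing (ι : V → V') (L : Submodule (ZMod 2) (V → Klein))
    (L' : Submodule (ZMod 2) (V' → Klein)) : Prop :=
  ∀ a, a ∈ L ↔ ∃ a' ∈ L', a' ∘ ι = a ∧ ∀ w ∉ Set.range ι, (a' w).2 = 0

lemma Klein.eq_zero_or_s {k : Klein} (h : k.2 = 0) : k = 0 ∨ k = s := by
  revert k; decide

lemma Klein.snd_eq_zero {k : Klein} (h : k = 0 ∨ k = s) : k.2 = 0 := by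
  revert k; decide

lemma fund_comap (hι : Function.Injective ι) (g : SimpleGraph V') (m : V' → Mark) (z : V) :
    fund (g.comap ι) (m ∘ ι) z = fund g m (ι z) ∘ ι := by
  funext x
  by_cases hx : x = z
  · subst hx; simp [fund_self]
  · by_cases h : g.Adj (ι z) (ι x)
    · rw [fund_adj (show (g.comap ι).Adj z x from h)]; simp [fund_adj h]
    · rw [fund_not_adj hx (show ¬ (g.comap ι).Adj z x from h)]
      simp [fund_not_adj (fun h' => hx (hι h')) h]

/-- If the Euler system goes straight at the removed vertices, the fundamental vectors of the
remaining ones satisfy the smoothing condition automatically, so deleting vertices from the graph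
corresponds to smoothing the space. This is the reason for preferring Euler systems that go
straight. -/
lemma Rep.smoothing {g : SimpleGraph V'} {m : V' → Mark} (h : Rep g m L')
    (hι : Function.Injective ι) (hL : IsSmoothing ι L L')
    (hm : ∀ w ∉ Set.range ι, (m w).tau = s) : Rep (g.comap ι) (m ∘ ι) L := by
  refine ⟨fun z => ?_, fun a ha hE => ?_⟩
  · rw [fund_comap hι, hL]
    refine ⟨_, h.fund_mem (ι z), rfl, fun w hw => Klein.snd_eq_zero ?_⟩
    rw [← hm w hw]
    exact fund_ne g m (fun h' => hw ⟨z, h'.symm⟩)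
  · obtain ⟨a', ha', rfl, h0⟩ := (hL a).1 ha
    have : a' = 0 := h.eq_zero a' ha' fun w => by
      by_cases hw : w ∈ Set.range ι
      · obtain ⟨z, rfl⟩ := hw; exact hE z
      · rw [hm w hw]; exact Klein.eq_zero_or_s (h0 w hw)
    rw [this]; rfl

lemma isIsomorphic_ofData {V V' : Type} [Finite V] [Finite V'] (e : V ≃ V') {g : SimpleGraph V}
    {g' : SimpleGraph V'} {m : V → Mark} {m' : V' → Mark} {neg : V → Prop} {neg' : V' → Prop}
    (hadj : ∀ x y, g'.Adj (e x) (e y) ↔ g.Adj x y) (hm : ∀ x, m' (e x) = m x)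
    (hneg : ∀ x, neg' (e x) ↔ neg x) {f f' : ℕ} (hf : f = f') :
    IsIsomorphic (ofData g m neg f) (ofData g' m' neg' f') :=
  ⟨hf, ⟨e, fun {x y} => hadj x y⟩, fun x => ⟨hneg x, hm x⟩⟩

/-- Deleting vertices. -/
lemma isIsomorphic_delete (hι : Function.Injective ι) (W : Set V')
    (hW : ∀ x, x ∉ W ↔ x ∈ Set.range ι) (g : SimpleGraph V') (m : V' → Mark) {neg : V → Prop}
    {neg' : V' → Prop} (hneg : ∀ x, neg' (ι x) ↔ neg x) (f : ℕ) :
    IsIsomorphic ((ofData g m neg' f).delete W) (ofData (g.comap ι) (m ∘ ι) neg f) := by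
  let e : V ≃ {x : V' // x ∉ W} :=
    Equiv.ofBijective (fun x => ⟨ι x, (hW _).2 ⟨x, rfl⟩⟩)
      ⟨fun x y h => hι (congrArg Subtype.val h), fun y => by
        obtain ⟨x, hx⟩ := (hW _).1 y.2
        exact ⟨x, Subtype.ext hx⟩⟩
  have he : ∀ y, ι (e.symm y) = y.1 := fun y => congrArg Subtype.val (e.apply_symm_apply y)
  exact isIsomorphic_ofData (g := g.comap Subtype.val) (m := fun x => m x.1)
    (neg := fun x => neg' x.1) e.symm (fun y z => by simp [he]) (fun y => by simp [he])
    (fun y => by rw [← hneg, he]) rfl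

end Smoothing

theorem State.equiv_of_bijective {S S' : State} (ι : S.V → S'.V) (hι : Function.Bijective ι)
    (hL : ∀ a : S'.V → Klein, a ∘ ι ∈ S.L ↔ a ∈ S'.L) (hneg : ∀ x, S'.neg (ι x) ↔ S.neg x)
    (hf : S.f = S'.f) : S'.Equiv S := by
  obtain ⟨g, m, h⟩ := S'.exists_rep
  have hs : IsSmoothing ι S.L S'.L := by
    intro a
    constructor
    · intro ha
      refine ⟨a ∘ (Equiv.ofBijective ι hι).symm, ?_, ?_, fun w hw => absurd (hι.2 w) hw⟩
      · rw [← hL]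
        convert ha
        funext x
        simp [Equiv.ofBijective_symm_apply_apply]
      · funext x
        simp [Equiv.ofBijective_symm_apply_apply]
    · rintro ⟨a', ha', rfl, -⟩
      exact (hL a').2 ha'
  have h' := h.smoothing hι.1 hs (fun w hw => absurd (hι.2 w) hw)
  refine .of_rep h h' (Relation.ReflTransGen.single (Or.inl ?_))
    (Relation.ReflTransGen.single (Or.inl ?_))
  · have he := (Equiv.ofBijective ι hι).apply_symm_apply
    simp only [Equiv.ofBijective_apply] at he
    exact isIsomorphic_ofData (Equiv.ofBijective ι hι).symm (fun y z => by simp [he])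
      (fun y => by simp [he]) (fun y => by rw [← hneg, he]) hf.symm
  · exact isIsomorphic_ofData (Equiv.ofBijective ι hι) (fun y z => by simp)
      (fun y => by simp) hneg hf

/-! ### The first and the second Reidemeister move -/

open scoped Classical in
/-- First Reidemeister move. -/
theorem State.reidemeister1 {S S' : State} (ι : S.V → S'.V) (hι : Function.Injective ι)
    (v : S'.V) (hv : ∀ x, x ∉ Set.range ι ↔ x = v) (hs : IsSmoothing ι S.L S'.L)
    (hneg : ∀ x, S'.neg (ι x) ↔ S.neg x) (hf : S.f = S'.f)
    (ho : (Pi.single v o : S'.V → Klein) ∈ S'.L) : S'.Equiv S := by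
  -- Going straight at v is admissible: a vector of the space supported at v is orthogonal to the
  -- monogon vector `o`, so its entry is not `s`.
  obtain ⟨g, m, h, hm, hd⟩ := S'.lagrangian.exists_rep {v} (fun _ => s) (fun _ => Or.inl rfl) (by
    intro a ha h1 h2
    funext x
    by_cases hx : x = v
    · subst hx
      have := S'.lagrangian.form_eq_zero ho ha
      rw [form_single_left] at this
      rcases h2 x rfl with h2 | h2
      · exact h2
      · rw [h2] at this; exact absurd this (by decide)
    · exact h1 x hx)
  have hmv : m v = .unmarked := by
    rcases hd v with h1 | h1
    · exact h1
    · have := hm v rfl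
      rw [h1] at this; exact absurd this (by decide)
  -- The monogon vector is the fundamental vector of v, which makes v isolated.
  have hfv : fund g m v = Pi.single v o := by
    apply eq_of_add_eq_zero
    apply h.eq_zero _ (S'.L.add_mem (h.fund_mem v) ho)
    intro w
    by_cases hw : w = v
    · subst hw; left; simp [fund_self, hmv, Mark.chi, Klein.add_self, -Prod.mk_add_mk]
    · simpa [hw] using fund_ne g m hw
  have h' := h.smoothing hι hs (fun w hw => by rw [(hv w).1 hw, hm v rfl])
  have hisol : ∀ x, ¬ g.Adj v x := fun x hx => by
    have h1 := (adj_iff_fund (m := m) hx.ne').1 hx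
    rw [hfv] at h1
    exact h1 (by simp [hx.ne'])
  refine .of_omega h h' (Or.inl ⟨v, hisol, Or.inl hmv, ?_⟩)
  · rw [hf]
    exact isIsomorphic_delete hι {v} (fun x => by
      have := hv x
      rw [Set.mem_singleton_iff, ← hv x, not_not]) g m hneg S'.f

open scoped Classical in
/-- The vector with two equal entries. -/
noncomputable def pair {V : Type} (v w : V) (k : Klein) : V → Klein :=
  Pi.single v k + Pi.single w k

section pair

variable {V : Type} [Fintype V] {v w : V}

lemma pair_left (h : v ≠ w) (k : Klein) : pair v w k v = k := by
  classical
  simp [pair, h]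

lemma pair_right (h : v ≠ w) (k : Klein) : pair v w k w = k := by
  classical
  simp [pair, h.symm]

lemma pair_ne {x : V} (h : x ≠ v) (h' : x ≠ w) (k : Klein) : pair v w k x = 0 := by
  classical
  simp [pair, h, h']

lemma form_pair (k : Klein) (a : V → Klein) :
    form (pair v w k) a = symp k (a v) + symp k (a w) := by
  classical
  rw [pair, map_add, LinearMap.add_apply, form_single_left, form_single_left]

lemma pair_comm (k : Klein) : pair v w k = pair w v k := add_comm _ _

lemma pair_add (k l : Klein) : pair v w k + pair v w l = pair v w (k + l) := by
  classical
  simp only [pair, Pi.single_add]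
  abel

lemma IsLagrangian.pair_s_o {L : Submodule (ZMod 2) (V → Klein)} {x : Klein}
    (hx : x = o ∨ x = d) (hs : pair v w s ∈ L) (hxL : pair v w x ∈ L) : pair v w o ∈ L := by
  rcases hx with rfl | rfl
  · exact hxL
  · have := L.add_mem hs hxL
    rw [pair_add] at this
    exact this

end pair

/-- The only obstruction to going straight at both new crossings is the vector with straight entries
at v and w. If it is absent, the bigon vector is the sum of the fundamental vectors of v and w, so
they are twins as in Ω.2(a). If it is present, an Euler system oriented at v and straight at w leads
to Ω.2(d) and to one more free loop. -/
lemma State.reidemeister2_of_neg {S S' : State} (ι : S.V → S'.V) (hι : Function.Injective ι)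
    (v w : S'.V) (hvw : v ≠ w) (hv : ∀ x, x ∉ Set.range ι ↔ x = v ∨ x = w)
    (hs : IsSmoothing ι S.L S'.L) (hneg : ∀ x, S'.neg (ι x) ↔ S.neg x)
    (x : Klein) (hx : x = o ∨ x = d) (hxL : pair v w x ∈ S'.L)
    (hf : pair v w s ∉ S'.L → S.f = S'.f) (hf' : pair v w s ∈ S'.L → S.f = S'.f + 1)
    (hnv : S'.neg v) (hnw : ¬ S'.neg w) : S'.Equiv S := by
  classical
  have hW : ∀ x, x ∉ ({v, w} : Set S'.V) ↔ x ∈ Set.range ι := fun x => by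
    have := hv x
    rw [Set.mem_insert_iff, Set.mem_singleton_iff, ← this, not_not]
  by_cases hss : pair v w s ∈ S'.L
  · have hoo : pair v w o ∈ S'.L := IsLagrangian.pair_s_o hx hss hxL
    -- The pairs of `s` and of `o` both lie in the space and exclude every nonzero combination of
    -- `o` at v and `s` at w. They turn out to be the fundamental vectors of v and w, so these
    -- vertices form a component of their own.
    obtain ⟨g, m, h, hm, hd⟩ := S'.lagrangian.exists_rep {v, w} (fun y => if y = v then o else s)
      (fun y => by by_cases hy : y = v <;> simp [hy]) (by
      intro a ha h1 h2
      have e1 := S'.lagrangian.form_eq_zero hoo ha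
      have e2 := S'.lagrangian.form_eq_zero hss ha
      rw [form_pair] at e1 e2
      have h3 := h2 v (by simp)
      have h4 := h2 w (by simp)
      simp only [if_true, if_neg hvw.symm] at h3 h4
      funext y
      by_cases hy : y = v
      · subst hy
        rcases h3 with h3 | h3 <;> rcases h4 with h4 | h4 <;> rw [h3, h4] at e1 e2 <;>
          first | exact h3 | (exfalso; revert e1 e2; decide)
      · by_cases hy' : y = w
        · subst hy'
          rcases h3 with h3 | h3 <;> rcases h4 with h4 | h4 <;> rw [h3, h4] at e1 e2 <;>
            first | exact h4 | (exfalso; revert e1 e2; decide)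
        · exact h1 y (by simp [hy, hy']))
    have htv : (m v).tau = o := by simpa using hm v (by simp)
    have htw : (m w).tau = s := by simpa [hvw.symm] using hm w (by simp)
    have hmv : m v = .c := (hd v).resolve_left fun h1 => by
      rw [h1] at htv; revert htv; decide
    have hmw : m w = .unmarked := (hd w).resolve_right fun h1 => by
      rw [h1] at htw; revert htw; decide
    have hfv : fund g m v = pair v w s := by
      apply eq_of_add_eq_zero
      apply h.eq_zero _ (S'.L.add_mem (h.fund_mem v) hss)
      intro y
      rw [Pi.add_apply]
      by_cases hy : y = v
      · subst hy; rw [fund_self, pair_left hvw, hmv]; exact Or.inl (show s + s = 0 by decide)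
      · by_cases hy' : y = w
        · subst hy'
          rw [pair_right hvw, htw]
          rcases fund_ne g m hy with h1 | h1 <;> rw [h1]
          · exact Or.inr (zero_add _)
          · rw [htw]; exact Or.inl (Klein.add_self _)
        · rw [pair_ne hy hy', add_zero]; exact fund_ne g m hy
    have hfw : fund g m w = pair v w o := by
      apply eq_of_add_eq_zero
      apply h.eq_zero _ (S'.L.add_mem (h.fund_mem w) hoo)
      intro y
      rw [Pi.add_apply]
      by_cases hy : y = w
      · subst hy; rw [fund_self, pair_right hvw, hmw]; exact Or.inl (show o + o = 0 by decide)
      · by_cases hy' : y = v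
        · subst hy'
          rw [pair_left hvw, htv]
          rcases fund_ne g m hy with h1 | h1 <;> rw [h1]
          · exact Or.inr (zero_add _)
          · rw [htv]; exact Or.inl (Klein.add_self _)
        · rw [pair_ne hy' hy, add_zero]; exact fund_ne g m hy
    have hadj : g.Adj v w := by
      rw [adj_iff_fund (m := m) hvw.symm, hfv, pair_right hvw]; decide
    have onv : ∀ y, g.Adj v y ↔ y = w := fun y => by
      refine ⟨fun hy => ?_, fun hy => hy ▸ hadj⟩
      by_contra hne
      have hyv := hy.ne'
      rw [adj_iff_fund (m := m) hy.ne', hfv] at hy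
      exact hy (pair_ne hyv hne _)
    have onw : ∀ y, g.Adj w y ↔ y = v := fun y => by
      refine ⟨fun hy => ?_, fun hy => hy ▸ hadj.symm⟩
      by_contra hne
      have hyw := hy.ne'
      rw [adj_iff_fund (m := m) hy.ne', hfw] at hy
      exact hy (pair_ne hne hyw _)
    -- `Rep.smoothing` does not apply, as the Euler system is not straight at v. Instead,
    -- orthogonality to the pair of `o` makes the straight entries at v and w equal, and adding the
    -- pair of `s` removes both.
    have h' : Rep (g.comap ι) (m ∘ ι) S.L := by
      have hrv : v ∉ Set.range ι := (hv v).2 (Or.inl rfl)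
      have hrw : w ∉ Set.range ι := (hv w).2 (Or.inr rfl)
      refine ⟨fun z => ?_, fun a ha hE => ?_⟩
      · rw [fund_comap hι, hs]
        refine ⟨_, h.fund_mem (ι z), rfl, fun y hy => ?_⟩
        rw [fund_not_adj (fun h' => hy ⟨z, h'.symm⟩)]
        · rfl
        · intro hadj'
          rcases (hv y).1 hy with rfl | rfl
          · have := (onv _).1 hadj'.symm
            exact hrw ⟨z, this⟩
          · have := (onw _).1 hadj'.symm
            exact hrv ⟨z, this⟩
      · obtain ⟨a', ha', rfl, h0⟩ := (hs a).1 ha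
        have e1 := S'.lagrangian.form_eq_zero hoo ha'
        rw [form_pair] at e1
        have hv0 := Klein.eq_zero_or_s (h0 v hrv)
        have hw0 := Klein.eq_zero_or_s (h0 w hrw)
        have key : ∀ b ∈ S'.L, b v = 0 → b w = 0 → (∀ z, b (ι z) = a' (ι z)) → b = 0 := by
          intro b hb hbv hbw hbz
          apply h.eq_zero b hb
          intro y
          by_cases hy : y ∈ Set.range ι
          · obtain ⟨z, rfl⟩ := hy; rw [hbz]; exact hE z
          · rcases (hv y).1 hy with rfl | rfl
            · exact Or.inl hbv
            · exact Or.inl hbw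
        rcases hv0 with hv0 | hv0 <;> rcases hw0 with hw0 | hw0 <;> rw [hv0, hw0] at e1
        · have := key a' ha' hv0 hw0 fun _ => rfl
          rw [this]; rfl
        · exfalso; revert e1; decide
        · exfalso; revert e1; decide
        · have hpz : ∀ z, pair v w s (ι z) = 0 := fun z =>
            pair_ne (fun h => hrv ⟨z, h⟩) (fun h => hrw ⟨z, h⟩) _
          have := key (a' + pair v w s) (S'.L.add_mem ha' hss)
            (by rw [Pi.add_apply, hv0, pair_left hvw]; decide)
            (by rw [Pi.add_apply, hw0, pair_right hvw]; decide)
            (fun z => by rw [Pi.add_apply, hpz, add_zero])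
          funext z
          have hz := congrFun this (ι z)
          rw [Pi.add_apply, hpz, add_zero] at hz
          exact hz
    refine .of_omega h h' (Or.inr (Or.inl (.d _ _ v w hnv hnw hmv hmw onw onv ?_)))
    rw [hf' hss]
    exact isIsomorphic_delete hι {v, w} hW g m hneg (S'.f + 1)
  · obtain ⟨g, m, h, hm, hd⟩ := S'.lagrangian.exists_rep {v, w} (fun _ => s)
      (fun _ => Or.inl rfl) (by
      intro a ha h1 h2
      have e1 := S'.lagrangian.form_eq_zero hxL ha
      rw [form_pair] at e1
      have h3 := h2 v (by simp)
      have h4 := h2 w (by simp)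
      have hout : ∀ y, y ≠ v → y ≠ w → a y = 0 := fun y hy hy' => h1 y (by simp [hy, hy'])
      rcases h3 with h3 | h3 <;> rcases h4 with h4 | h4
      · funext y
        by_cases hy : y = v
        · rw [hy, h3]; rfl
        · by_cases hy' : y = w
          · rw [hy', h4]; rfl
          · exact hout y hy hy'
      · rw [h3, h4] at e1
        exfalso; rcases hx with rfl | rfl <;> revert e1 <;> decide
      · rw [h3, h4] at e1
        exfalso; rcases hx with rfl | rfl <;> revert e1 <;> decide
      · exfalso
        apply hss
        convert ha
        funext y
        by_cases hy : y = v
        · subst hy; rw [h3, pair_left hvw]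
        · by_cases hy' : y = w
          · subst hy'; rw [h4, pair_right hvw]
          · rw [hout y hy hy', pair_ne hy hy'])
    have hm' : ∀ y, (y = v ∨ y = w) → m y = .unmarked := fun y hy => by
      rcases hd y with h1 | h1
      · exact h1
      · have := hm y hy
        rw [h1] at this; exact absurd this (by decide)
    -- The sum is detected by its pairings with τ. It vanishes outside v and w, so v and w have the
    -- same neighbors there.
    have hsum : fund g m v + fund g m w = pair v w x := by
      apply eq_of_add_eq_zero
      apply h.eq_zero _ (S'.L.add_mem (S'.L.add_mem (h.fund_mem v) (h.fund_mem w)) hxL)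
      intro y
      rw [← Mark.symp_tau_eq_zero, Pi.add_apply, Pi.add_apply, symp_add_left, symp_add_left,
        symp_fund, symp_fund]
      by_cases hy : y = v
      · subst hy
        rw [pair_left hvw, hm' y (Or.inl rfl)]
        rcases hx with rfl | rfl <;> simp [hvw] <;> decide
      · by_cases hy' : y = w
        · subst hy'
          rw [pair_right hvw, hm' y (Or.inr rfl)]
          rcases hx with rfl | rfl <;> simp [hvw.symm] <;> decide
        · simp [pair_ne hy hy', hy, hy']
    have h' := h.smoothing hι hs (fun y hy => by rw [hm' y ((hv y).1 hy)]; rfl)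
    have hsame : ∀ y, y ≠ v → y ≠ w → (g.Adj v y ↔ g.Adj w y) := by
      intro y hyv hyw
      rw [adj_iff_fund (m := m) hyv, adj_iff_fund (m := m) hyw]
      have := congrFun hsum y
      rw [Pi.add_apply, pair_ne hyv hyw] at this
      have : fund g m v y = fund g m w y :=
        (show ∀ k l : Klein, k + l = 0 → k = l by decide) _ _ this
      rw [this]
    refine .of_omega h h' (Or.inr (Or.inl (.a _ _ v w hnv hnw (hm' v (Or.inl rfl))
      (hm' w (Or.inr rfl)) hsame ?_)))
    · rw [hf hss]
      exact isIsomorphic_delete hι {v, w} hW g m hneg S'.f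

/-- Second Reidemeister move. -/
theorem State.reidemeister2 {S S' : State} (ι : S.V → S'.V) (hι : Function.Injective ι)
    (v w : S'.V) (hvw : v ≠ w) (hv : ∀ x, x ∉ Set.range ι ↔ x = v ∨ x = w)
    (hs : IsSmoothing ι S.L S'.L) (hneg : ∀ x, S'.neg (ι x) ↔ S.neg x)
    (x : Klein) (hx : x = o ∨ x = d) (hxL : pair v w x ∈ S'.L)
    (hf : pair v w s ∉ S'.L → S.f = S'.f) (hf' : pair v w s ∈ S'.L → S.f = S'.f + 1)
    (hn : S'.neg v ↔ ¬ S'.neg w) : S'.Equiv S := by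
  by_cases hnv : S'.neg v
  · exact State.reidemeister2_of_neg ι hι v w hvw hv hs hneg x hx hxL hf hf' hnv (hn.1 hnv)
  · rw [pair_comm] at hxL hf hf'
    exact State.reidemeister2_of_neg ι hι w v hvw.symm (fun x => (hv x).trans or_comm) hs hneg x hx
      hxL hf hf' (not_not.1 fun h => hnv (hn.2 h)) hnv

end Isotropic

namespace Isotropic

open MarkedGraph

/-! ### The third Reidemeister move -/

section Phi

variable {V : Type} [Fintype V]

open scoped Classical in
/-- The effect of the third Reidemeister move at the crossings in `S` on vectors of transitions. -/
noncomputable def phi (S : Finset V) : (V → Klein) →ₗ[ZMod 2] (V → Klein) where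
  toFun a := fun x => a x + (if x ∈ S then (∑ y ∈ S, (a y).2) + (a x).2 else 0, 0)
  map_add' a b := by
    funext x
    by_cases hx : x ∈ S
    · ext <;> simp [hx, Finset.sum_add_distrib] <;> ring
    · ext <;> simp [hx]
  map_smul' c a := by
    funext x
    by_cases hx : x ∈ S
    · ext <;> simp [hx, ← Finset.mul_sum] <;> ring
    · simp [hx]

variable (S : Finset V) (a : V → Klein)

lemma phi_snd (x : V) : (phi S a x).2 = (a x).2 := by simp [phi]

lemma phi_notMem {x : V} (hx : x ∉ S) : phi S a x = a x := by simp [phi, hx]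

lemma phi_mem {x : V} (hx : x ∈ S) : phi S a x = a x + ((∑ y ∈ S, (a y).2) + (a x).2, 0) := by
  simp [phi, hx]

lemma phi_phi : phi S (phi S a) = a := by
  funext x
  by_cases hx : x ∈ S
  · rw [phi_mem S _ hx, phi_snd, Finset.sum_congr rfl fun y _ => phi_snd S a y, phi_mem S _ hx,
      add_assoc, Klein.add_self, add_zero]
  · rw [phi_notMem S _ hx, phi_notMem S _ hx]

lemma phi_eq_self (h : ∀ x ∈ S, (a x).2 = 0) : phi S a = a := by
  funext x
  by_cases hx : x ∈ S
  · rw [phi_mem S _ hx, Finset.sum_eq_zero h, h x hx]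
    exact add_zero _
  · exact phi_notMem S _ hx

lemma zmod_mul_self (x : ZMod 2) : x * x = x := by revert x; decide

lemma zmod_add_self (x : ZMod 2) : x + x = 0 := by revert x; decide

/-- With j the second coordinate and J its sum over S, the change is Σ (J + j) j = J² + J = 0 modulo
two. -/
lemma quad_phi : quad (phi S a) = quad a := by
  classical
  have h1 : quad (phi S a) = quad a +
      ∑ x ∈ S, ((∑ y ∈ S, (a y).2) + (a x).2) * (a x).2 := by
    have h2 : ∀ F : V → ZMod 2, ∑ x ∈ S, F x = ∑ x, if x ∈ S then F x else 0 := fun F => by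
      rw [Finset.sum_ite_mem, Finset.univ_inter]
    rw [quad, quad, h2 fun x => (_ + (a x).2) * (a x).2, ← Finset.sum_add_distrib]
    refine Finset.sum_congr rfl fun x _ => ?_
    by_cases hx : x ∈ S
    · rw [phi_mem S _ hx]; simp [hx]; ring
    · rw [phi_notMem S _ hx]; simp [hx]
  rw [h1]
  simp only [add_mul, Finset.sum_add_distrib, ← Finset.mul_sum, zmod_mul_self, zmod_add_self,
    add_zero]

/-- The space after a third Reidemeister move. -/
noncomputable def phiSpace (L : Submodule (ZMod 2) (V → Klein)) : Submodule (ZMod 2) (V → Klein) :=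
  L.comap (phi S)

lemma mem_phiSpace {L : Submodule (ZMod 2) (V → Klein)} {S : Finset V} {a : V → Klein} :
    a ∈ phiSpace S L ↔ phi S a ∈ L := Iff.rfl

lemma IsLagrangian.phiSpace {L : Submodule (ZMod 2) (V → Klein)} (hL : IsLagrangian L) :
    IsLagrangian (phiSpace S L) := by
  refine ⟨fun a ha => ?_, ?_⟩
  · rw [← quad_phi S a]; exact hL.quad_eq_zero _ ha
  · let e := LinearEquiv.ofInvolutive (phi S) (phi_phi S)
    have : Isotropic.phiSpace S L = L.map e.toLinearMap := by
      ext a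
      rw [mem_phiSpace, Submodule.mem_map]
      constructor
      · intro h; exact ⟨_, h, phi_phi S a⟩
      · rintro ⟨b, hb, rfl⟩
        change phi S (phi S b) ∈ L
        rwa [phi_phi]
    rw [this]
    exact (LinearEquiv.finrank_map_eq e L).trans hL.finrank_eq

/-- Toggling the adjacencies among the vertices in `S`. -/
def toggle (g : SimpleGraph V) (S : Finset V) : SimpleGraph V where
  Adj x y := x ≠ y ∧ Xor (g.Adj x y) (x ∈ S ∧ y ∈ S)
  symm := ⟨fun x y h => ⟨h.1.symm, by rw [g.adj_comm, and_comm]; exact h.2⟩⟩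
  loopless := ⟨fun _ h => h.1 rfl⟩

lemma toggle_toggle (g : SimpleGraph V) : toggle (toggle g S) S = g := by
  ext x y
  by_cases hxy : x = y
  · subst hxy; simp
  · simp only [toggle, ne_eq, hxy, not_false_eq_true, true_and, Xor]; tauto

variable {S}

/-- At unmarked vertices the second coordinate of the fundamental vector of z is 1 only at z. Hence
`phi` adds `s` = τ exactly at the other vertices of S if z is in S, and does nothing otherwise. -/
lemma fund_toggle {g : SimpleGraph V} {m : V → Mark} (hm : ∀ x ∈ S, m x = .unmarked) (z : V) :
    fund (toggle g S) m z = phi S (fund g m z) := by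
  classical
  have hj : ∀ y ∈ S, (fund g m z y).2 = if y = z then 1 else 0 := by
    intro y hy
    have h1 := symp_fund g m z y
    rw [hm y hy] at h1
    simp only [Mark.tau, symp, mul_zero, mul_one, zero_add] at h1
    exact h1
  funext x
  have htog : x ≠ z → ((toggle g S).Adj z x ↔ Xor (g.Adj z x) (z ∈ S ∧ x ∈ S)) := fun hx => by
    simp [toggle, Ne.symm hx]
  by_cases hx : x ∈ S
  · rw [phi_mem S _ hx, Finset.sum_congr rfl hj, Finset.sum_ite_eq', hj x hx]
    by_cases hxz : x = z
    · subst hxz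
      rw [fund_self, fund_self, if_pos hx, if_pos rfl, zmod_add_self]
      exact (add_zero _).symm
    · rw [if_neg hxz, add_zero]
      by_cases hz : z ∈ S
      · rw [if_pos hz]
        by_cases hzx : g.Adj z x
        · rw [fund_adj hzx, fund_not_adj hxz (by simp [htog hxz, hzx, hx, hz, Xor]), hm x hx]
          decide
        · rw [fund_not_adj hxz hzx, fund_adj ((htog hxz).2 (by simp [hzx, hx, hz, Xor])), hm x hx]
          decide
      · rw [if_neg hz]
        refine Eq.trans ?_ (add_zero _).symm
        by_cases hzx : g.Adj z x
        · rw [fund_adj hzx, fund_adj ((htog hxz).2 (by simp [hzx, hz, Xor]))]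
        · rw [fund_not_adj hxz hzx, fund_not_adj hxz (by simp [htog hxz, hzx, hz, Xor])]
  · rw [phi_notMem S _ hx]
    by_cases hxz : x = z
    · subst hxz; rw [fund_self, fund_self]
    · by_cases hzx : g.Adj z x
      · rw [fund_adj hzx, fund_adj ((htog hxz).2 (by simp [hzx, hx, Xor]))]
      · rw [fund_not_adj hxz hzx, fund_not_adj hxz (by simp [htog hxz, hzx, hx, Xor])]

lemma Rep.toggle {g : SimpleGraph V} {m : V → Mark} {L : Submodule (ZMod 2) (V → Klein)}
    (h : Rep g m L) (hm : ∀ x ∈ S, m x = .unmarked) : Rep (toggle g S) m (phiSpace S L) := by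
  refine ⟨fun z => ?_, fun a ha hE => ?_⟩
  · rw [mem_phiSpace, fund_toggle hm, phi_phi]; exact h.fund_mem z
  · have : phi S a = a := phi_eq_self S a fun x hx => Klein.snd_eq_zero (by
      have := hE x
      rwa [hm x hx] at this)
    rw [mem_phiSpace, this] at ha
    exact h.eq_zero a ha hE

end Phi

/-! ### Coherent triangles and the move Ω.3 -/

section Omega3

variable {V : Type} [Fintype V] {S : Finset V} {u v w : V}

lemma omega3_aux {g : SimpleGraph V} {m : V → Mark} {neg : V → Prop} (f : ℕ)
    (hS : ∀ x, x ∈ S ↔ x = u ∨ x = v ∨ x = w) (hm : ∀ x ∈ S, m x = .unmarked)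
    (huv : g.Adj u v) (huw : g.Adj u w) (hvw : g.Adj v w)
    (heven : ∀ x ∉ S, Xor (g.Adj x u) (g.Adj x v) ↔ g.Adj x w)
    (hu : neg u) (hv : ¬ neg v) (hw : ¬ neg w) :
    Omega3 (ofData g m neg f) (ofData (toggle g S) m neg f) := by
  refine ⟨u, v, w, hm u ((hS u).2 (by simp)), hm v ((hS v).2 (by simp)), hm w ((hS w).2 (by simp)),
    huv, huw, hvw, hu, hv, hw, fun (x : V) h1 h2 h3 => ?_, ?_⟩
  · have := heven x (fun h => by rcases (hS x).1 h with h | h | h <;> contradiction)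
    change (¬ g.Adj x u ∧ ¬ g.Adj x v ∧ ¬ g.Adj x w) ∨ (g.Adj x u ∧ g.Adj x v ∧ ¬ g.Adj x w) ∨
      (g.Adj x u ∧ ¬ g.Adj x v ∧ g.Adj x w) ∨ (¬ g.Adj x u ∧ g.Adj x v ∧ g.Adj x w)
    simp only [Xor] at this
    tauto
  · have hall : ∀ x ∈ S, ∀ y ∈ S, x ≠ y → g.Adj x y := by
      intro x hx y hy hxy
      rcases (hS x).1 hx with rfl | rfl | rfl <;> rcases (hS y).1 hy with rfl | rfl | rfl <;>
        first | exact absurd rfl hxy | assumption | (apply SimpleGraph.Adj.symm; assumption)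
    have hS' : ∀ x, x ∈ ({u, v, w} : Set V) ↔ x ∈ S := fun x => by rw [hS]; simp
    refine isIsomorphic_ofData (g := SimpleGraph.fromRel fun x y =>
      g.Adj x y ∧ ¬ (x ∈ ({u, v, w} : Set V) ∧ y ∈ ({u, v, w} : Set V))) (_root_.Equiv.refl V)
      (fun x y => ?_) (fun _ => rfl) (fun _ => Iff.rfl) rfl
    simp only [_root_.Equiv.refl_apply, SimpleGraph.fromRel_adj, hS', toggle, Xor,
      g.adj_comm y x]
    have := hall x
    tauto

/-- One of the three signs differs from the two others. Its vertex takes the role of the looped one,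
in the move itself or in its mirror image. -/
lemma omega3 {g : SimpleGraph V} {m : V → Mark} {neg : V → Prop} (f : ℕ)
    (hS : ∀ x, x ∈ S ↔ x = u ∨ x = v ∨ x = w) (hm : ∀ x ∈ S, m x = .unmarked)
    (huv : g.Adj u v) (huw : g.Adj u w) (hvw : g.Adj v w)
    (heven : ∀ x ∉ S, Xor (g.Adj x u) (g.Adj x v) ↔ g.Adj x w)
    (hneg : ¬ ((neg u ↔ neg v) ∧ (neg v ↔ neg w))) :
    OmegaForward (ofData g m neg f) (ofData (toggle g S) m neg f) := by
  have key : ∀ {u v w : V}, (∀ x, x ∈ S ↔ x = u ∨ x = v ∨ x = w) → g.Adj u v → g.Adj u w →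
      g.Adj v w → (∀ x ∉ S, Xor (g.Adj x u) (g.Adj x v) ↔ g.Adj x w) →
      (neg u ↔ ¬ neg v) → (neg v ↔ neg w) →
      OmegaForward (ofData g m neg f) (ofData (toggle g S) m neg f) := by
    intro u v w hS huv huw hvw heven h1 h2
    by_cases hu : neg u
    · exact Or.inr (Or.inr (Or.inl (omega3_aux f hS hm huv huw hvw heven hu (h1.1 hu)
        (fun h => h1.1 hu (h2.2 h)))))
    · have hv : neg v := by tauto
      exact Or.inr (Or.inr (Or.inr (omega3_aux (neg := fun x => ¬ neg x) f hS hm huv huw hvw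
        heven hu (not_not.2 hv) (not_not.2 (h2.1 hv)))))
  by_cases h1 : neg u ↔ neg v
  · refine key (u := w) (v := u) (w := v) (fun x => by rw [hS]; tauto) huw.symm hvw.symm huv
      (fun x hx => ?_) (by tauto) h1
    have := heven x hx
    simp only [Xor] at this ⊢
    tauto
  · by_cases h2 : neg v ↔ neg w
    · exact key hS huv huw hvw heven (by tauto) h2
    · refine key (u := v) (v := u) (w := w) (fun x => by rw [hS]; tauto) huv.symm hvw huw
        (fun x hx => ?_) (by tauto) (by tauto)
      have := heven x hx
      simp only [Xor] at this ⊢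
      tauto

open scoped Classical in
/-- The vector of a coherently oriented triangle. -/
noncomputable def coherent (S : Finset V) : V → Klein := fun x => if x ∈ S then o else 0

/-- A nonzero vector of straight transitions in a triangle. -/
def IsBad (L : Submodule (ZMod 2) (V → Klein)) (S : Finset V) (a : V → Klein) : Prop :=
  a ∈ L ∧ a ≠ 0 ∧ (∀ x ∉ S, a x = 0) ∧ ∀ x ∈ S, a x = 0 ∨ a x = s

lemma Klein.xor_of_add_eq_zero : ∀ a b c t : Klein, t ≠ 0 → (a = 0 ∨ a = t) → (b = 0 ∨ b = t) →
    (c = 0 ∨ c = t) → a + b + c = 0 → ((a ≠ 0 ∧ ¬ b ≠ 0 ∨ b ≠ 0 ∧ ¬ a ≠ 0) ↔ c ≠ 0) := by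
  rintro a b c t ht (rfl | rfl) (rfl | rfl) (rfl | rfl) h <;>
    simp_all [Klein.add_self, -Prod.mk_add_mk]

/-- Without bad vectors an Euler system can go straight at all three corners, which are then
unmarked. The triangle vector is the sum of their fundamental vectors. Its zero entries outside show
that every other vertex is adjacent to an even number of corners, and its entries `o` at the corners
show that the corners are pairwise adjacent or pairwise not adjacent. -/
lemma reidemeister3_of_not_bad {L : Submodule (ZMod 2) (V → Klein)} (hL : IsLagrangian L)
    (neg : V → Prop) (f : ℕ) (huv : u ≠ v) (huw : u ≠ w) (hvw : v ≠ w)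
    (hS : ∀ x, x ∈ S ↔ x = u ∨ x = v ∨ x = w) (ht : coherent S ∈ L)
    (hneg : ¬ ((neg u ↔ neg v) ∧ (neg v ↔ neg w))) (hbad : ∀ a, ¬ IsBad L S a) :
    (State.mk V L neg f hL).Equiv (State.mk V (phiSpace S L) neg f (hL.phiSpace S)) := by
  classical
  obtain ⟨g, m, h, hm, hd⟩ := hL.exists_rep (S : Set V) (fun _ => s) (fun _ => Or.inl rfl) (by
    intro a ha h1 h2
    by_contra h0
    exact hbad a ⟨ha, h0, h1, h2⟩)
  have hm' : ∀ x ∈ S, m x = .unmarked := fun x hx => by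
    rcases hd x with h1 | h1
    · exact h1
    · have := hm x hx
      rw [h1] at this; exact absurd this (by decide)
  have hu : u ∈ S := (hS u).2 (by simp)
  have hv : v ∈ S := (hS v).2 (by simp)
  have hw : w ∈ S := (hS w).2 (by simp)
  have hsum : fund g m u + fund g m v + fund g m w = coherent S := by
    apply eq_of_add_eq_zero
    apply h.eq_zero _ (L.add_mem (L.add_mem (L.add_mem (h.fund_mem u) (h.fund_mem v))
      (h.fund_mem w)) ht)
    intro y
    rw [← Mark.symp_tau_eq_zero, Pi.add_apply, Pi.add_apply, Pi.add_apply, symp_add_left,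
      symp_add_left, symp_add_left, symp_fund, symp_fund, symp_fund]
    by_cases hy : y ∈ S
    · simp only [coherent, hy, if_true, hm' y hy]
      rcases (hS y).1 hy with rfl | rfl | rfl
      · simp [huv, huw]; decide
      · simp [huv.symm, hvw]; decide
      · simp [huw.symm, hvw.symm]; decide
    · have h1 := hy
      rw [hS] at h1
      push Not at h1
      simp [coherent, hy, h1]
  have hpt : ∀ y, fund g m u y + fund g m v y + fund g m w y = if y ∈ S then o else 0 :=
    fun y => congrFun hsum y
  have hk : ∀ k l : Klein, o + k + l = o → (k = 0 ↔ l = 0) := by decide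
  have e1 : g.Adj v u ↔ g.Adj w u := by
    rw [adj_iff_fund (m := m) huv, adj_iff_fund (m := m) huw, not_iff_not]
    have := hpt u
    rw [fund_self, hm' u hu, if_pos hu] at this
    exact hk _ _ this
  have e2 : g.Adj u v ↔ g.Adj w v := by
    rw [adj_iff_fund (m := m) huv.symm, adj_iff_fund (m := m) hvw, not_iff_not]
    have := hpt v
    rw [fund_self, hm' v hv, if_pos hv, add_comm (fund g m u v)] at this
    exact hk _ _ this
  have heven : ∀ x ∉ S, Xor (g.Adj x u) (g.Adj x v) ↔ g.Adj x w := by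
    intro x hx
    have h1 := hx
    rw [hS] at h1
    push Not at h1
    have := hpt x
    rw [if_neg hx] at this
    rw [g.adj_comm x u, g.adj_comm x v, g.adj_comm x w, adj_iff_fund (m := m) h1.1,
      adj_iff_fund (m := m) h1.2.1, adj_iff_fund (m := m) h1.2.2]
    have hT := Mark.tau_ne_zero (m x)
    have f1 := fund_ne g m h1.1
    have f2 := fund_ne g m h1.2.1
    have f3 := fund_ne g m h1.2.2
    exact Klein.xor_of_add_eq_zero _ _ _ _ hT f1 f2 f3 this
  -- The edges of the triangle are present before the move or after it; accordingly Ω.3 is applied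
  -- forwards or backwards.
  by_cases hadj : g.Adj u v
  · exact .of_omega h (h.toggle hm') (omega3 f hS hm' hadj (e1.1 hadj.symm).symm
      (e2.1 hadj).symm heven hneg)
  · have a2 : ¬ g.Adj u w := fun h => hadj (e1.2 h.symm).symm
    have a3 : ¬ g.Adj v w := fun h => hadj (e2.2 h.symm)
    refine (State.Equiv.of_omega (h.toggle hm') h ?_).symm
    have htog : ∀ x y, x ∈ S → y ∈ S → x ≠ y → ¬ g.Adj x y → (toggle g S).Adj x y :=
      fun x y hx hy hxy h => ⟨hxy, by simp [hx, hy, h, Xor]⟩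
    have htog' : ∀ x ∉ S, ∀ y, (toggle g S).Adj x y ↔ g.Adj x y := fun x hx y => by
      simp only [toggle, hx, Xor, false_and, not_false_eq_true, and_true, or_false]
      exact ⟨fun h => h.2, fun h => ⟨h.ne, h⟩⟩
    have := omega3 (g := toggle g S) f hS hm' (htog u v hu hv huv hadj) (htog u w hu hw huw a2)
      (htog v w hv hw hvw a3) (fun x hx => by rw [htog' x hx, htog' x hx, htog' x hx, heven x hx])
      hneg
    rwa [toggle_toggle] at this

end Omega3

/-! ### Adjoining twins -/

section Twin

variable {V : Type} [Fintype V] (L : Submodule (ZMod 2) (V → Klein)) (n : V → Klein)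

/-- Adjoining two twins to a space: a parametrization of the new space. -/
noncomputable def twinMap : (V → Klein) × ZMod 2 × ZMod 2 →ₗ[ZMod 2] (V ⊕ Bool → Klein) where
  toFun y := Sum.elim (y.1 + y.2.2 • n)
    (fun i => if i then (form y.1 n, y.2.1) else (form y.1 n, y.2.1 + y.2.2))
  map_add' y z := by
    funext x
    rcases x with x | x
    · simp only [Sum.elim_inl, Pi.add_apply, Prod.fst_add, Prod.snd_add, add_smul]
      abel
    · cases x <;> ext <;> simp <;> ring
  map_smul' c y := by
    funext x
    rcases x with x | x
    · ext <;> simp <;> ring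
    · cases x <;> ext <;> simp <;> ring

/-- The space with two twins adjoined. -/
noncomputable def twinSpace : Submodule (ZMod 2) (V ⊕ Bool → Klein) :=
  LinearMap.range ((twinMap n).comp (L.subtype.prodMap LinearMap.id))

variable {L n}

lemma twinMap_inl (y : (V → Klein) × ZMod 2 × ZMod 2) (x : V) :
    twinMap n y (Sum.inl x) = y.1 x + y.2.2 • n x := rfl

lemma twinMap_true (y : (V → Klein) × ZMod 2 × ZMod 2) :
    twinMap n y (Sum.inr true) = (form y.1 n, y.2.1) := rfl

lemma twinMap_false (y : (V → Klein) × ZMod 2 × ZMod 2) :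
    twinMap n y (Sum.inr false) = (form y.1 n, y.2.1 + y.2.2) := rfl

lemma mem_twinSpace {a : V ⊕ Bool → Klein} :
    a ∈ twinSpace L n ↔ ∃ b ∈ L, ∃ β γ, twinMap n (b, β, γ) = a := by
  simp [twinSpace, LinearMap.mem_range]

lemma quad_smul (c : ZMod 2) (a : V → Klein) : quad (c • a) = c * quad a := by
  rcases ZMod.two_cases c with rfl | rfl <;> simp [quad_zero]

/-- The twins model a bigon made by two arcs, with n the vector of a path between these arcs: the
form of b with n is then the difference of the labels of b on the two arcs. The cross term γ·(b, n)
in `quad` of b + γn cancels the contribution (b, n)(β + β + γ) of the twins. -/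
lemma IsLagrangian.twinSpace (hL : IsLagrangian L) (hn : quad n = 0) :
    IsLagrangian (twinSpace L n) := by
  refine ⟨fun a ha => ?_, ?_⟩
  · obtain ⟨b, hb, β, γ, rfl⟩ := mem_twinSpace.1 ha
    have h1 : quad (twinMap n (b, β, γ)) = quad (b + γ • n) + (form b n * β +
        form b n * (β + γ)) := by
      simp only [quad, Fintype.sum_sum_type, Fintype.sum_bool, twinMap_inl, twinMap_true,
        twinMap_false, Pi.add_apply, Pi.smul_apply]
    rw [h1, quad_add, hL.quad_eq_zero b hb, quad_smul, hn, map_smul, smul_eq_mul]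
    have : ∀ x β γ : ZMod 2, 0 + γ * 0 + γ * x + (x * β + x * (β + γ)) = 0 := by decide
    exact this _ _ _
  · have hinj : Function.Injective (twinMap n) := by
      rw [← LinearMap.ker_eq_bot, Submodule.eq_bot_iff]
      rintro ⟨b, β, γ⟩ h
      have h : twinMap n (b, β, γ) = 0 := h
      have h1 := congrArg Prod.snd (congrFun h (Sum.inr true))
      have h2 := congrArg Prod.snd (congrFun h (Sum.inr false))
      rw [twinMap_true] at h1
      rw [twinMap_false] at h2
      simp only [Pi.zero_apply, Prod.snd_zero] at h1 h2
      subst h1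
      rw [zero_add] at h2
      subst h2
      have : b = 0 := funext fun x => by
        have := congrFun h (Sum.inl x)
        rw [twinMap_inl] at this
        simpa using this
      rw [this]; rfl
    rw [Isotropic.twinSpace, LinearMap.finrank_range_of_inj, Module.finrank_prod,
      Module.finrank_prod, hL.finrank_eq]
    · simp
    · rw [LinearMap.coe_comp]
      exact hinj.comp (Prod.map_injective.2 ⟨Subtype.val_injective, Function.injective_id⟩)

end Twin

end Isotropic

namespace Isotropic

open MarkedGraph

/-! ### Twins are created and removed by the second Reidemeister move -/

section TwinMoves

variable {V : Type} [Fintype V] {L : Submodule (ZMod 2) (V → Klein)} {n : V → Klein}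

lemma isSmoothing_twinSpace : IsSmoothing Sum.inl L (twinSpace L n) := by
  intro a
  constructor
  · intro ha
    refine ⟨twinMap n (a, 0, 0), mem_twinSpace.2 ⟨a, ha, 0, 0, rfl⟩, ?_, ?_⟩
    · funext x
      simp [twinMap_inl]
    · rintro (x | x) hx
      · exact absurd ⟨x, rfl⟩ hx
      · cases x <;> simp [twinMap_true, twinMap_false]
  · rintro ⟨a', ha', rfl, h⟩
    obtain ⟨b, hb, β, γ, rfl⟩ := mem_twinSpace.1 ha'
    have h1 := h (Sum.inr true) (by simp)
    have h2 := h (Sum.inr false) (by simp)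
    rw [twinMap_true] at h1
    rw [twinMap_false] at h2
    simp only at h1 h2
    subst h1
    rw [zero_add] at h2
    subst h2
    convert hb
    funext x
    simp [twinMap_inl]

lemma notMem_range_inl (x : V ⊕ Bool) :
    x ∉ Set.range (Sum.inl : V → V ⊕ Bool) ↔ x = Sum.inr true ∨ x = Sum.inr false := by
  rcases x with x | x
  · simp
  · cases x <;> simp

lemma pair_o_mem_twinSpace : pair (Sum.inr true) (Sum.inr false) o ∈ twinSpace L n := by
  refine mem_twinSpace.2 ⟨0, L.zero_mem, 1, 0, ?_⟩
  funext x
  rcases x with x | x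
  · rw [twinMap_inl, pair_ne (by simp) (by simp)]; simp
  · cases x
    · rw [twinMap_false, pair_right (by simp)]; simp
    · rw [twinMap_true, pair_left (by simp)]; simp

/-- Second coordinates zero at both twins mean β = γ = 0. The vector then restricts to b = 0, whose
form with n vanishes, so the twins cannot have straight entries. Hence adjoining twins leaves the
number of free loops unchanged. -/
lemma pair_s_notMem_twinSpace : pair (Sum.inr true) (Sum.inr false) s ∉ twinSpace L n := by
  intro h
  obtain ⟨b, hb, β, γ, h⟩ := mem_twinSpace.1 h
  have h1 := congrFun h (Sum.inr true)
  have h2 := congrFun h (Sum.inr false)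
  rw [twinMap_true, pair_left (by simp)] at h1
  rw [twinMap_false, pair_right (by simp)] at h2
  have h3 := congrArg Prod.snd h1
  have h4 := congrArg Prod.snd h2
  simp only at h3 h4
  subst h3
  rw [zero_add] at h4
  subst h4
  have : b = 0 := funext fun x => by
    have := congrFun h (Sum.inl x)
    rw [twinMap_inl, pair_ne (by simp) (by simp)] at this
    simpa using this
  subst this
  simp at h1

/-- The signs after adjoining two twins. -/
def twinNeg (neg : V → Prop) (σ : Prop) : V ⊕ Bool → Prop
  | .inl x => neg x
  | .inr true => σ
  | .inr false => ¬ σ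

lemma equiv_twin (hL : IsLagrangian L) (hn : quad n = 0) (neg : V → Prop) (f : ℕ) (σ : Prop) :
    (State.mk (V ⊕ Bool) (twinSpace L n) (twinNeg neg σ) f (hL.twinSpace hn)).Equiv
      (State.mk V L neg f hL) :=
  State.reidemeister2 (S := State.mk V L neg f hL)
    (S' := State.mk (V ⊕ Bool) (twinSpace L n) (twinNeg neg σ) f (hL.twinSpace hn))
    Sum.inl Sum.inl_injective (Sum.inr true) (Sum.inr false) (by simp)
    notMem_range_inl isSmoothing_twinSpace (fun _ => Iff.rfl) o (Or.inl rfl)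
    pair_o_mem_twinSpace (fun _ => rfl) (fun h => absurd h pair_s_notMem_twinSpace)
    (by simp [twinNeg])

variable {V' : Type} [Fintype V']

lemma phi_comp (ι : V ↪ V') (S : Finset V) (a : V' → Klein) :
    phi (S.map ι) a ∘ ι = phi S (a ∘ ι) := by
  funext x
  by_cases hx : x ∈ S
  · rw [Function.comp_apply, phi_mem _ _ (Finset.mem_map_of_mem ι hx), phi_mem _ _ hx,
      Finset.sum_map]
    rfl
  · rw [Function.comp_apply, phi_notMem _ _ (by simpa using hx), phi_notMem _ _ hx]
    rfl

/-- `phi` depends on second coordinates inside S only and preserves all second coordinates, so it is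
compatible with smoothing vertices outside S. -/
lemma IsSmoothing.phiSpace {ι : V ↪ V'} {L' : Submodule (ZMod 2) (V' → Klein)}
    (h : IsSmoothing ι L L') (S : Finset V) :
    IsSmoothing ι (phiSpace S L) (phiSpace (S.map ι) L') := by
  intro a
  rw [mem_phiSpace, h]
  constructor
  · rintro ⟨a', ha', h1, h2⟩
    refine ⟨phi (S.map ι) a', by rwa [mem_phiSpace, phi_phi], ?_, fun w hw => ?_⟩
    · rw [phi_comp, h1, phi_phi]
    · rw [phi_snd]; exact h2 w hw
  · rintro ⟨a', ha', rfl, h2⟩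
    exact ⟨phi (S.map ι) a', ha', phi_comp ι S a', fun w hw => by rw [phi_snd]; exact h2 w hw⟩

lemma pair_mem_phiSpace {S : Finset V} {v w : V} (hv : v ∉ S) (hw : w ∉ S) (k : Klein) :
    pair v w k ∈ Isotropic.phiSpace S L ↔ pair v w k ∈ L := by
  rw [mem_phiSpace, phi_eq_self]
  intro x hx
  rw [pair_ne (by rintro rfl; exact hv hx) (by rintro rfl; exact hw hx)]
  rfl

end TwinMoves

/-! ### The third Reidemeister move for arbitrary triangles -/

section Reidemeister3

lemma equiv_twin_phiSpace {V : Type} [Fintype V] {L : Submodule (ZMod 2) (V → Klein)}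
    {n : V → Klein} (hL : IsLagrangian L) (hn : quad n = 0) (S : Finset V)
    (neg : V → Prop) (f : ℕ) (σ : Prop) :
    (State.mk (V ⊕ Bool) (phiSpace (S.map ⟨Sum.inl, Sum.inl_injective⟩) (twinSpace L n))
      (twinNeg neg σ) f ((hL.twinSpace hn).phiSpace _)).Equiv
      (State.mk V (phiSpace S L) neg f (hL.phiSpace S)) := by
  refine State.reidemeister2 (S := State.mk V (phiSpace S L) neg f (hL.phiSpace S))
    (S' := State.mk (V ⊕ Bool) (phiSpace (S.map ⟨Sum.inl, Sum.inl_injective⟩) (twinSpace L n))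
      (twinNeg neg σ) f ((hL.twinSpace hn).phiSpace _))
    Sum.inl Sum.inl_injective (Sum.inr true) (Sum.inr false) (by simp)
    notMem_range_inl (IsSmoothing.phiSpace (ι := ⟨Sum.inl, Sum.inl_injective⟩)
      isSmoothing_twinSpace S) (fun _ => Iff.rfl) o (Or.inl rfl)
    ?_ (fun _ => rfl) (fun h => absurd h ?_) (by simp [twinNeg])
  · change _ ∈ phiSpace _ _
    rw [pair_mem_phiSpace (by simp) (by simp)]
    exact pair_o_mem_twinSpace
  · change _ ∉ phiSpace _ _
    rw [pair_mem_phiSpace (by simp) (by simp)]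
    exact pair_s_notMem_twinSpace

/-- Induction on the number of bad vectors. If a bad vector has a straight entry at a corner z,
adjoin twins along `o` at z. A bad vector of the new space is zero at the twins, so it restricts to
a bad vector orthogonal to n, and the chosen one is not. After the move the twins are removed again.
-/
lemma reidemeister3_coherent {V : Type} [Fintype V] {S : Finset V} {u v w : V}
    {L : Submodule (ZMod 2) (V → Klein)} (hL : IsLagrangian L)
    (neg : V → Prop) (f : ℕ) (huv : u ≠ v) (huw : u ≠ w) (hvw : v ≠ w)
    (hS : ∀ x, x ∈ S ↔ x = u ∨ x = v ∨ x = w) (ht : coherent S ∈ L)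
    (hneg : ¬ ((neg u ↔ neg v) ∧ (neg v ↔ neg w))) :
    (State.mk V L neg f hL).Equiv (State.mk V (phiSpace S L) neg f (hL.phiSpace S)) := by
  classical
  induction hN : {a | IsBad L S a}.ncard using Nat.strong_induction_on generalizing V with
  | _ N ih =>
  by_cases hbad : ∃ a, IsBad L S a
  · obtain ⟨a, ha⟩ := hbad
    obtain ⟨z, hz⟩ : ∃ z, a z ≠ 0 := by
      by_contra hno
      push Not at hno
      exact ha.2.1 (funext hno)
    have hzS : z ∈ S := by
      by_contra hzS
      exact hz (ha.2.2.1 z hzS)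
    have hzs : a z = s := (ha.2.2.2 z hzS).resolve_left hz
    set n : V → Klein := Pi.single z o
    have hn : quad n = 0 := by rw [quad_single]; rfl
    have hform : ∀ b, form b n = symp o (b z) := fun b => by
      rw [form_comm, form_single_left]
    -- The triangle vector survives because its entry `o` at z is orthogonal to n.
    have hcoh : coherent (S.map ⟨Sum.inl, Sum.inl_injective⟩ : Finset (V ⊕ Bool)) ∈
        twinSpace L n := by
      refine mem_twinSpace.2 ⟨_, ht, 0, 0, ?_⟩
      funext x
      have h0 : form (coherent S) n = 0 := by rw [hform]; simp [coherent, hzS]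
      rcases x with x | x
      · rw [twinMap_inl]; simp [coherent]
      · cases x
        · rw [twinMap_false]; simp only [h0]; simp [coherent]
        · rw [twinMap_true]; simp only [h0]; simp [coherent]
    refine (equiv_twin hL hn neg f True).symm.trans
      ((ih _ ?_ (hL.twinSpace hn) (twinNeg neg True) (u := Sum.inl u) (v := Sum.inl v)
        (w := Sum.inl w) (by simpa using huv) (by simpa using huw) (by simpa using hvw)
        (fun x => ?_) hcoh hneg rfl).trans (equiv_twin_phiSpace hL hn S neg f True))
    · rw [← hN]
      have key : ∀ b, IsBad (twinSpace L n) (S.map ⟨Sum.inl, Sum.inl_injective⟩) b →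
          b ∘ Sum.inl ∈ L ∧ form (b ∘ Sum.inl) n = 0 := by
        intro b hb
        obtain ⟨c, hc, β, γ, rfl⟩ := mem_twinSpace.1 hb.1
        have h1 := hb.2.2.1 (Sum.inr true) (by simp)
        have h2 := hb.2.2.1 (Sum.inr false) (by simp)
        rw [twinMap_true] at h1
        rw [twinMap_false] at h2
        have h3 := congrArg Prod.snd h1
        have h4 := congrArg Prod.snd h2
        have h5 := congrArg Prod.fst h1
        simp only [Prod.snd_zero, Prod.fst_zero] at h3 h4 h5
        subst h3
        rw [zero_add] at h4
        subst h4
        have : twinMap n (c, 0, 0) ∘ Sum.inl = c := by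
          funext x
          simp [twinMap_inl]
        rw [this]
        exact ⟨hc, h5⟩
      have hbout : ∀ b, IsBad (twinSpace L n) (S.map ⟨Sum.inl, Sum.inl_injective⟩) b →
          ∀ i, b (Sum.inr i) = 0 := fun b hb i => hb.2.2.1 _ (by simp)
      calc {b | IsBad (twinSpace L n) (S.map ⟨Sum.inl, Sum.inl_injective⟩) b}.ncard
          ≤ ({a' | IsBad L S a'} \ {a}).ncard := by
            refine Set.ncard_le_ncard_of_injOn (fun b => b ∘ Sum.inl) ?_ ?_ (Set.toFinite _)
            · intro b hb
              refine ⟨⟨(key b hb).1, fun h0 => hb.2.1 ?_, fun x hx => ?_, fun x hx => ?_⟩, ?_⟩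
              · funext x
                rcases x with x | x
                · exact congrFun h0 x
                · exact hbout b hb x
              · exact hb.2.2.1 _ (by simpa using hx)
              · exact hb.2.2.2 _ (by simpa using hx)
              · intro h
                have h0 := (key b hb).2
                rw [Set.mem_singleton_iff] at h
                rw [h, hform, hzs] at h0
                revert h0; decide
            · intro b hb b' hb' h
              funext x
              rcases x with x | x
              · exact congrFun h x
              · rw [hbout b hb, hbout b' hb']
        _ < _ := Set.ncard_sdiff_singleton_lt_of_mem ha (Set.toFinite _)
    · rw [Finset.mem_map]
      constructor
      · rintro ⟨y, hy, rfl⟩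
        rcases (hS y).1 hy with rfl | rfl | rfl <;> simp
      · rintro (rfl | rfl | rfl)
        · exact ⟨u, (hS u).2 (by simp), rfl⟩
        · exact ⟨v, (hS v).2 (by simp), rfl⟩
        · exact ⟨w, (hS w).2 (by simp), rfl⟩
  · push Not at hbad
    exact reidemeister3_of_not_bad hL neg f huv huw hvw hS ht hneg hbad

lemma sum_three {V : Type} {S : Finset V} {u v w : V}
    (huv : u ≠ v) (huw : u ≠ w) (hvw : v ≠ w) (hS : ∀ x, x ∈ S ↔ x = u ∨ x = v ∨ x = w)
    (F : V → ZMod 2) : ∑ x ∈ S, F x = F u + F v + F w := by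
  classical
  have : S = {u, v, w} := by ext x; simp [hS]
  rw [this, Finset.sum_insert (by simp [huv, huw]), Finset.sum_insert (by simp [hvw]),
    Finset.sum_singleton, add_assoc]

/-- The classical trick of deriving one third move from another with two second moves. Adjoin a
bigon so that one twin forms a coherent triangle with v and w, perform the coherent move there, and
then remove that twin together with u as a bigon. The remaining twin replaces u. -/
lemma reidemeister3_incoherent {V : Type} [Fintype V] {S : Finset V} {u v w : V}
    {L : Submodule (ZMod 2) (V → Klein)} (hL : IsLagrangian L)
    (neg : V → Prop) (f : ℕ) (huv : u ≠ v) (huw : u ≠ w) (hvw : v ≠ w)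
    (hS : ∀ x, x ∈ S ↔ x = u ∨ x = v ∨ x = w) (t : V → Klein) (ht : t ∈ L)
    (ht0 : ∀ x ∉ S, t x = 0) (htu : t u = o) (htv : t v = d) (htw : t w = d)
    (hneg : ¬ ((¬ neg u ↔ neg v) ∧ (neg v ↔ neg w))) :
    (State.mk V L neg f hL).Equiv (State.mk V (phiSpace S L) neg f (hL.phiSpace S)) := by
  classical
  -- Chosen so that t + n is 0 at u and `o` at v and w; moreover n is orthogonal to t. With β = γ =
  -- 1 the vector t becomes the triangle vector of the first twin, v and w.
  let n : V → Klein := Pi.single u o + Pi.single v s + Pi.single w s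
  have nu : n u = o := by simp [n, huv, huw]
  have nv : n v = s := by simp [n, huv.symm, hvw]
  have nw : n w = s := by simp [n, huw.symm, hvw.symm]
  have n0 : ∀ x ∉ S, n x = 0 := fun x hx => by
    rw [hS] at hx; push Not at hx; simp [n, hx]
  have hform : ∀ b, form b n = symp o (b u) + symp s (b v) + symp s (b w) := fun b => by
    rw [form_comm, map_add, map_add, LinearMap.add_apply, LinearMap.add_apply, form_single_left,
      form_single_left, form_single_left]
  have hn : quad n = 0 := by
    rw [quad_add, quad_add, quad_single, quad_single, quad_single, map_add, LinearMap.add_apply,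
      form_single_left, form_single_left, form_single_left]
    simp [huv, huw, hvw, symp]
  let S₁ : Finset (V ⊕ Bool) := {Sum.inr true, Sum.inl v, Sum.inl w}
  have hS₁ : ∀ x, x ∈ S₁ ↔ x = Sum.inr true ∨ x = Sum.inl v ∨ x = Sum.inl w := by simp [S₁]
  have d1 : (Sum.inr true : V ⊕ Bool) ≠ Sum.inl v := by simp
  have d2 : (Sum.inr true : V ⊕ Bool) ≠ Sum.inl w := by simp
  have d3 : (Sum.inl v : V ⊕ Bool) ≠ Sum.inl w := by simpa using hvw
  have hcoh : coherent S₁ ∈ twinSpace L n := by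
    refine mem_twinSpace.2 ⟨t, ht, 1, 1, ?_⟩
    have h0 : form t n = 0 := by rw [hform, htu, htv, htw]; decide
    funext x
    rcases x with x | x
    · rw [twinMap_inl]
      by_cases hx : x ∈ S
      · rcases (hS x).1 hx with rfl | rfl | rfl
        · simp [coherent, hS₁, huv, huw, htu, nu]; rfl
        · simp [coherent, hS₁, htv, nv]; decide
        · simp [coherent, hS₁, htw, nw]; decide
      · have := ht0 x hx
        have h1 := n0 x hx
        rw [hS] at hx; push Not at hx
        simp [coherent, hS₁, hx, this, h1]
    · cases x
      · rw [twinMap_false]; simp only [h0]; simp [coherent, hS₁]; rfl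
      · rw [twinMap_true]; simp only [h0]; simp [coherent, hS₁]
  have hL₁ := hL.twinSpace (n := n) hn
  -- The first twin receives the sign opposite to u, so that it later cancels against u, and the
  -- second twin receives the sign of u.
  refine (equiv_twin hL hn neg f (¬ neg u)).symm.trans
    ((reidemeister3_coherent hL₁ (twinNeg neg (¬ neg u)) f d1 d2 d3 hS₁ hcoh hneg).trans ?_)
  let ι : V → V ⊕ Bool := fun x => if x = u then Sum.inr false else Sum.inl x
  have ιu : ι u = Sum.inr false := by simp [ι]
  have ιne : ∀ x, x ≠ u → ι x = Sum.inl x := fun x hx => by simp [ι, hx]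
  have hι : Function.Injective ι := by
    intro x y h
    by_cases hx : x = u <;> by_cases hy : y = u
    · rw [hx, hy]
    · rw [hx, ιu, ιne y hy] at h; simp at h
    · rw [hy, ιu, ιne x hx] at h; simp at h
    · rw [ιne x hx, ιne y hy] at h; simpa using h
  have hrange : ∀ x, x ∉ Set.range ι ↔ x = Sum.inr true ∨ x = Sum.inl u := by
    intro x
    constructor
    · intro hx
      rcases x with x | x
      · by_cases h : x = u
        · right; rw [h]
        · exact absurd ⟨x, ιne x h⟩ hx
      · cases x
        · exact absurd ⟨u, ιu⟩ hx
        · left; rfl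
    · rintro (rfl | rfl) ⟨y, hy⟩
      · by_cases h : y = u
        · rw [h, ιu] at hy; simp at hy
        · rw [ιne y h] at hy; simp at hy
      · by_cases h : y = u
        · rw [h, ιu] at hy; simp at hy
        · rw [ιne y h] at hy; exact h (by simpa using hy)
  have hform' : ∀ b, form b n = (b u).1 + (b v).2 + (b w).2 := fun b => by
    rw [hform]; simp [symp]
  -- The choice β = 0, γ = (b u).2 makes the second coordinates vanish at the first twin and at u,
  -- as required for smoothing both. What remains is `phi S b`, with the second twin read as u.
  have main : ∀ b, phi S₁ (twinMap n (b, 0, (b u).2)) ∘ ι = phi S b := by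
    intro b
    have hsum₁ : ∑ y ∈ S₁, (twinMap n (b, 0, (b u).2) y).2 = (b v).2 + (b w).2 := by
      rw [sum_three d1 d2 d3 hS₁, twinMap_true, twinMap_inl, twinMap_inl, nv, nw]
      simp
    funext x
    rw [Function.comp_apply]
    by_cases hx : x ∈ S
    · rw [phi_mem S b hx, sum_three huv huw hvw hS]
      rcases (hS x).1 hx with rfl | rfl | rfl
      · rw [ιu, phi_notMem _ _ (by simp [hS₁]), twinMap_false, hform']
        ext
        · simp only [Prod.fst_add]
          generalize (b x).2 = p
          generalize (b v).2 = q
          generalize (b w).2 = r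
          generalize (b x).1 = k
          revert p q r k; decide
        · simp
      · rw [ιne _ huv.symm, phi_mem _ _ ((hS₁ _).2 (by simp)), hsum₁, twinMap_inl, nv]
        ext
        · simp only [Prod.fst_add, Prod.snd_add, Prod.smul_fst, Prod.smul_snd, smul_eq_mul]
          generalize (b x).2 = p
          generalize (b u).2 = q
          generalize (b w).2 = r
          generalize (b x).1 = k
          revert p q r k; decide
        · simp
      · rw [ιne _ huw.symm, phi_mem _ _ ((hS₁ _).2 (by simp)), hsum₁, twinMap_inl, nw]
        ext
        · simp only [Prod.fst_add, Prod.snd_add, Prod.smul_fst, Prod.smul_snd, smul_eq_mul]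
          generalize (b x).2 = p
          generalize (b u).2 = q
          generalize (b v).2 = r
          generalize (b x).1 = k
          revert p q r k; decide
        · simp
    · have hx' := hx
      rw [hS] at hx'; push Not at hx'
      rw [phi_notMem S b hx, ιne x hx'.1, phi_notMem _ _ (by simp [hS₁, hx']), twinMap_inl,
        n0 x hx, smul_zero, add_zero]
  have hpair : pair (Sum.inr true) (Sum.inl u) o ∈ phiSpace S₁ (twinSpace L n) := by
    refine mem_twinSpace.2 ⟨0, L.zero_mem, 1, 1, ?_⟩
    have dp : (Sum.inr true : V ⊕ Bool) ≠ Sum.inl u := by simp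
    have hsum₁ : ∑ y ∈ S₁, (pair (Sum.inr true) (Sum.inl u) o y : Klein).2 = 1 := by
      rw [sum_three d1 d2 d3 hS₁, pair_left dp, pair_ne d1.symm (by simpa using huv.symm),
        pair_ne d2.symm (by simpa using huw.symm)]
      rfl
    funext x
    rcases x with x | x
    · rw [twinMap_inl]
      by_cases hx : x ∈ S
      · rcases (hS x).1 hx with rfl | rfl | rfl
        · rw [phi_notMem _ _ (by simp [hS₁, huv, huw]), pair_right dp, nu]; simp
        · rw [phi_mem _ _ (by simp [hS₁]), hsum₁, pair_ne d1.symm (by simpa using huv.symm), nv]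
          simp
        · rw [phi_mem _ _ (by simp [hS₁]), hsum₁, pair_ne d2.symm (by simpa using huw.symm), nw]
          simp
      · have h1 := n0 x hx
        rw [hS] at hx; push Not at hx
        rw [phi_notMem _ _ (by simp [hS₁, hx]), h1, pair_ne (by simp) (by simpa using hx.1)]
        simp
    · cases x
      · rw [twinMap_false, phi_notMem _ _ (by simp [hS₁]), pair_ne (by simp) (by simp)]
        simp [zmod_add_self]
      · rw [twinMap_true, phi_mem _ _ (by simp [hS₁]), hsum₁, pair_left dp]
        simp [zmod_add_self]
  have hpair' : pair (Sum.inr true) (Sum.inl u) s ∉ phiSpace S₁ (twinSpace L n) := by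
    have dp : (Sum.inr true : V ⊕ Bool) ≠ Sum.inl u := by simp
    intro h
    rw [mem_phiSpace, phi_eq_self] at h
    · obtain ⟨b, hb, β, γ, h⟩ := mem_twinSpace.1 h
      have h1 := congrFun h (Sum.inr true)
      have h2 := congrFun h (Sum.inr false)
      rw [twinMap_true, pair_left dp] at h1
      rw [twinMap_false, pair_ne (by simp) (by simp)] at h2
      have h3 := congrArg Prod.fst h1
      have h4 := congrArg Prod.fst h2
      simp only [Prod.fst_zero] at h3 h4
      rw [h3] at h4
      exact one_ne_zero h4
    · intro x hx
      by_cases h1 : x = Sum.inr true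
      · rw [h1, pair_left dp]
      · by_cases h2 : x = Sum.inl u
        · rw [h2, pair_right dp]
        · rw [pair_ne h1 h2]; rfl
  refine State.reidemeister2 (S := State.mk V (phiSpace S L) neg f (hL.phiSpace S))
    (S' := State.mk (V ⊕ Bool) (phiSpace S₁ (twinSpace L n)) (twinNeg neg (¬ neg u)) f
      (hL₁.phiSpace S₁)) ι hι (Sum.inr true) (Sum.inl u) (by simp) hrange ?_ ?_ o (Or.inl rfl)
    hpair (fun _ => rfl) (fun h => absurd h hpair') Iff.rfl
  · intro a
    constructor
    · intro ha
      refine ⟨phi S₁ (twinMap n (phi S a, 0, (phi S a u).2)), ?_, ?_, ?_⟩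
      · change _ ∈ phiSpace S₁ _
        rw [mem_phiSpace, phi_phi]
        exact mem_twinSpace.2 ⟨_, ha, _, _, rfl⟩
      · rw [main, phi_phi]
      · intro x hx
        rw [phi_snd]
        rcases (hrange x).1 hx with rfl | rfl
        · rw [twinMap_true]
        · rw [twinMap_inl, nu]
          simp [zmod_add_self]
    · rintro ⟨a', ha', rfl, h⟩
      change _ ∈ phiSpace S₁ _ at ha'
      rw [mem_phiSpace] at ha'
      obtain ⟨b, hb, β, γ, hb'⟩ := mem_twinSpace.1 ha'
      have h1 := h (Sum.inr true) ((hrange _).2 (Or.inl rfl))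
      have h2 := h (Sum.inl u) ((hrange _).2 (Or.inr rfl))
      rw [← phi_snd S₁, ← hb'] at h1 h2
      rw [twinMap_true] at h1
      rw [twinMap_inl, nu] at h2
      simp only at h1
      subst h1
      have hγ : γ = (b u).2 := by
        simp only [Prod.snd_add, Prod.smul_snd, smul_eq_mul, mul_one] at h2
        exact ((show ∀ x y : ZMod 2, x + y = 0 → y = x by decide) _ _ h2)
      subst hγ
      have : a' ∘ ι = phi S b := by rw [← main, hb', phi_phi]
      rw [this]
      change phi S b ∈ phiSpace S L
      rw [mem_phiSpace, phi_phi]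
      exact hb
  · intro x
    by_cases hx : x = u
    · subst hx; simp only [ιu, twinNeg, not_not]
    · simp only [ιne x hx, twinNeg]

/-- Third Reidemeister move. -/
theorem State.reidemeister3 {V : Type} [Fintype V] {S : Finset V} {u v w : V}
    {L : Submodule (ZMod 2) (V → Klein)} (hL : IsLagrangian L)
    (neg : V → Prop) (f : ℕ) (huv : u ≠ v) (huw : u ≠ w) (hvw : v ≠ w)
    (hS : ∀ x, x ∈ S ↔ x = u ∨ x = v ∨ x = w) (t : V → Klein) (ht : t ∈ L)
    (ht0 : ∀ x ∉ S, t x = 0) (ht1 : ∀ x ∈ S, t x = o ∨ t x = d)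
    (hneg : ¬ (((neg u ↔ t u = o) ↔ (neg v ↔ t v = o)) ∧
      ((neg v ↔ t v = o) ↔ (neg w ↔ t w = o)))) :
    (State.mk V L neg f hL).Equiv (State.mk V (phiSpace S L) neg f (hL.phiSpace S)) := by
  classical
  have hq := hL.quad_eq_zero t ht
  -- An even number of disoriented corners: none or two of the three.
  have hq' : (t u).1 * (t u).2 + (t v).1 * (t v).2 + (t w).1 * (t w).2 = 0 := by
    rw [← hq, quad, ← sum_three huv huw hvw hS (fun x => (t x).1 * (t x).2)]
    refine Finset.sum_subset (Finset.subset_univ _) fun x _ hx => ?_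
    rw [ht0 x hx]; simp
  have hdo : ¬ (d = o) := by decide
  rcases ht1 u ((hS u).2 (by simp)) with hu | hu <;>
    rcases ht1 v ((hS v).2 (by simp)) with hv | hv <;>
    rcases ht1 w ((hS w).2 (by simp)) with hw | hw <;>
    rw [hu, hv, hw] at hq' hneg
  · refine reidemeister3_coherent hL neg f huv huw hvw hS ?_ (by simpa using hneg)
    convert ht
    funext x
    by_cases hx : x ∈ S
    · rcases (hS x).1 hx with rfl | rfl | rfl <;> simp [coherent, *]
    · simp [coherent, hx, ht0]
  · exact absurd hq' (by decide)
  · exact absurd hq' (by decide)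
  · exact reidemeister3_incoherent hL neg f huv huw hvw hS t ht ht0 hu hv hw (by
      simp only [hdo, iff_true, iff_false] at hneg; tauto)
  · exact absurd hq' (by decide)
  · exact reidemeister3_incoherent hL neg f huv.symm hvw huw (fun x => by rw [hS]; tauto) t ht ht0
      hv hu hw (by simp only [hdo, iff_true, iff_false] at hneg; tauto)
  · exact reidemeister3_incoherent hL neg f huw.symm hvw.symm huv (fun x => by rw [hS]; tauto) t ht
      ht0 hw hu hv (by simp only [hdo, iff_true, iff_false] at hneg; tauto)
  · exact absurd hq' (by decide)

end Reidemeister3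

end Isotropic

/-! ### Gauss diagrams

The two passages of a vertex `v : V` are `(v, true)` and `(v, false)`. A Gauss diagram is given by
the link component `κ p` and the position `t p` on this link component of each passage `p`. -/

namespace Gauss

open Isotropic

variable {V I : Type} [Fintype V] [Fintype I]

open scoped Classical in
/-- The value, just before the passage `p`, of the edge labelling which has the value `b i` at the
base point of the link component `i` and jumps by `j v` at each passage through `v`. -/
noncomputable def inVal (κ : V × Bool → I) (t : V × Bool → ℝ) (b : I → ZMod 2) (j : V → ZMod 2)
    (p : V × Bool) : ZMod 2 :=
  b (κ p) + ∑ q, if κ q = κ p ∧ t q < t p then j q.1 else 0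

open scoped Classical in
/-- The total jump on a link component. -/
noncomputable def totalJump (κ : V × Bool → I) (j : V → ZMod 2) (i : I) : ZMod 2 :=
  ∑ q, if κ q = i then j q.1 else 0

/-- The vector of transitions of an edge labelling. -/
noncomputable def gaussVec (κ : V × Bool → I) (t : V × Bool → ℝ) (b : I → ZMod 2)
    (j : V → ZMod 2) : V → Klein := fun v =>
  (inVal κ t b j (v, true) + j v + inVal κ t b j (v, false), j v)

variable (κ : V × Bool → I) (t : V × Bool → ℝ)

lemma inVal_add (b b' : I → ZMod 2) (j j' : V → ZMod 2) (p : V × Bool) :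
    inVal κ t (b + b') (j + j') p = inVal κ t b j p + inVal κ t b' j' p := by
  classical
  have : ∀ q, (if κ q = κ p ∧ t q < t p then j q.1 + j' q.1 else 0) =
    (if κ q = κ p ∧ t q < t p then j q.1 else 0) +
      (if κ q = κ p ∧ t q < t p then j' q.1 else 0) := fun q => by split_ifs <;> simp
  simp only [inVal, this, Finset.sum_add_distrib, Pi.add_apply]
  ring

lemma inVal_smul (c : ZMod 2) (b : I → ZMod 2) (j : V → ZMod 2) (p : V × Bool) :
    inVal κ t (c • b) (c • j) p = c * inVal κ t b j p := by
  rcases ZMod.two_cases c with rfl | rfl <;> simp [inVal]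

/-- The vector of transitions as a linear function of an edge labelling. -/
noncomputable def gaussMap : (I → ZMod 2) × (V → ZMod 2) →ₗ[ZMod 2] (V → Klein) where
  toFun y := gaussVec κ t y.1 y.2
  map_add' y z := by
    funext v
    ext
    · simp only [gaussVec, Prod.fst_add, Prod.snd_add, inVal_add, Pi.add_apply]; ring
    · simp [gaussVec]
  map_smul' c y := by
    funext v
    ext
    · simp only [gaussVec, Prod.smul_fst, Prod.smul_snd, inVal_smul, Pi.smul_apply, smul_eq_mul,
        RingHom.id_apply]; ring
    · simp [gaussVec]

/-- The total jumps as a linear function of an edge labelling. -/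
noncomputable def jumpMap : (I → ZMod 2) × (V → ZMod 2) →ₗ[ZMod 2] (I → ZMod 2) where
  toFun y := totalJump κ y.2
  map_add' y z := by
    funext i
    simp only [totalJump, Pi.add_apply, ← Finset.sum_add_distrib]
    exact Finset.sum_congr rfl fun q _ => by split_ifs <;> simp
  map_smul' c y := by
    funext i
    rcases ZMod.two_cases c with rfl | rfl <;> simp [totalJump]

/-- The space of the vectors of transitions of all the edge labellings. -/
noncomputable def gaussSpace : Submodule (ZMod 2) (V → Klein) :=
  (LinearMap.ker (jumpMap κ)).map (gaussMap κ t)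

variable {κ t}

lemma mem_gaussSpace {a : V → Klein} :
    a ∈ gaussSpace κ t ↔ ∃ b j, totalJump κ j = 0 ∧ gaussVec κ t b j = a := by
  simp only [gaussSpace, Submodule.mem_map, LinearMap.mem_ker, Prod.exists]
  rfl

lemma gaussVec_snd (b : I → ZMod 2) (j : V → ZMod 2) (v : V) : (gaussVec κ t b j v).2 = j v := rfl

-- In the order given by t, the value after one passage is the value before the next one. The
-- induction adds the last passage.
open scoped Classical in
lemma telescope {α : Type} (Q : Finset α) (t : α → ℝ) (ht : Set.InjOn t Q) (j : α → ZMod 2)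
    (F : ZMod 2 → ZMod 4) (b : ZMod 2) :
    ∑ p ∈ Q, (F (b + (∑ q ∈ Q, if t q < t p then j q else 0) + j p) -
      F (b + ∑ q ∈ Q, if t q < t p then j q else 0)) = F (b + ∑ q ∈ Q, j q) - F b := by
  induction Q using Finset.induction_on_max_value t with
  | empty => simp
  | insert a Q ha hmax ih =>
    have h1 : ∀ p ∈ Q, (∑ q ∈ insert a Q, if t q < t p then j q else 0) =
        ∑ q ∈ Q, if t q < t p then j q else 0 := fun p hp => by
      rw [Finset.sum_insert ha, if_neg (not_lt.2 (hmax p hp)), zero_add]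
    have h2 : (∑ q ∈ insert a Q, if t q < t a then j q else 0) = ∑ q ∈ Q, j q := by
      rw [Finset.sum_insert ha, if_neg (lt_irrefl _), zero_add]
      refine Finset.sum_congr rfl fun q hq => if_pos (lt_of_le_of_ne (hmax q hq) fun h => ?_)
      have := ht (by simp [hq]) (by simp) h
      exact ha (this ▸ hq)
    have h3 : ∑ p ∈ Q, (F (b + (∑ q ∈ insert a Q, if t q < t p then j q else 0) + j p) -
        F (b + ∑ q ∈ insert a Q, if t q < t p then j q else 0)) = _ :=
      (Finset.sum_congr rfl fun p hp => by rw [h1 p hp]).trans (ih (ht.mono (by simp)))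
    rw [Finset.sum_insert ha, h2, h3, Finset.sum_insert ha]
    rw [add_comm (j a), ← add_assoc]
    ring

/-- Doubling, as a map from `ℤ / 2` to `ℤ / 4`. -/
def double : ZMod 2 →+ ZMod 4 where
  toFun x := if x = 0 then 0 else 2
  map_zero' := by decide
  map_add' := by decide

/-- Lift the labels to 0 and 1 in ℤ/4 and add the increments at all passages. Around each closed
link component they sum to zero. At a crossing with a jump the two increments are ±1, and their sum
is 2 exactly if the entry is disoriented and 0 if it is oriented. -/
lemma quad_gaussVec (hinj : ∀ p q, κ p = κ q → t p = t q → p = q) {j : V → ZMod 2}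
    (hj : totalJump κ j = 0) (b : I → ZMod 2) : quad (gaussVec κ t b j) = 0 := by
  classical
  let F : ZMod 2 → ZMod 4 := fun x => if x = 0 then 0 else 1
  have h1 : ∑ p : V × Bool, (F (inVal κ t b j p + j p.1) - F (inVal κ t b j p)) = 0 := by
    rw [← Finset.sum_fiberwise Finset.univ κ]
    refine Finset.sum_eq_zero fun i _ => ?_
    have h2 := telescope (Finset.univ.filter fun p => κ p = i) t
      (fun p hp q hq h => hinj p q (by simp at hp hq; rw [hp, hq]) h) (fun p => j p.1) F (b i)
    have h3 : ∑ q ∈ Finset.univ.filter (fun p => κ p = i), j q.1 = 0 := by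
      rw [Finset.sum_filter]; exact congrFun hj i
    rw [h3, add_zero, sub_self] at h2
    rw [← h2]
    refine Finset.sum_congr rfl fun p hp => ?_
    have h4 : inVal κ t b j p = b i + ∑ q ∈ Finset.univ.filter (fun p => κ p = i),
        if t q < t p then j q.1 else 0 := by
      simp only [Finset.mem_filter, Finset.mem_univ, true_and] at hp
      rw [inVal, hp, Finset.sum_filter]
      congr 1
      exact Finset.sum_congr rfl fun q _ => by rw [ite_and]
    rw [h4]
  rw [Fintype.sum_prod_type] at h1
  have h5 : ∀ v, ∑ i : Bool, (F (inVal κ t b j (v, i) + j v) - F (inVal κ t b j (v, i))) =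
      double ((gaussVec κ t b j v).1 * (gaussVec κ t b j v).2) := by
    intro v
    rw [Fintype.sum_bool]
    simp only [gaussVec]
    generalize inVal κ t b j (v, true) = x
    generalize inVal κ t b j (v, false) = y
    generalize j v = z
    revert x y z
    decide
  rw [Finset.sum_congr rfl fun v _ => h5 v, ← map_sum] at h1
  exact (show ∀ x, double x = 0 → x = 0 by decide) _ h1

/-! ### Dimension of the space of a Gauss diagram -/

open scoped Classical in
/-- The incidence matrix of link components and crossings. -/
noncomputable def incidence (κ : V × Bool → I) : Matrix V I (ZMod 2) := fun v i =>
  (if κ (v, true) = i then 1 else 0) + (if κ (v, false) = i then 1 else 0)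

lemma incidence_mulVec (b : I → ZMod 2) (v : V) :
    (incidence κ).mulVec b v = b (κ (v, true)) + b (κ (v, false)) := by
  classical
  simp [Matrix.mulVec, dotProduct, incidence, add_mul, Finset.sum_add_distrib]

lemma incidence_transpose_mulVec (j : V → ZMod 2) :
    (incidence κ).transpose.mulVec j = totalJump κ j := by
  classical
  funext i
  simp [Matrix.mulVec, dotProduct, incidence, totalJump, Fintype.sum_prod_type, add_mul]

lemma gaussVec_eq_zero_iff (b : I → ZMod 2) (j : V → ZMod 2) :
    gaussVec κ t b j = 0 ↔ j = 0 ∧ ∀ v, b (κ (v, true)) + b (κ (v, false)) = 0 := by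
  constructor
  · intro h
    have hj : j = 0 := funext fun v => congrArg Prod.snd (congrFun h v)
    subst hj
    refine ⟨rfl, fun v => ?_⟩
    have := congrArg Prod.fst (congrFun h v)
    simpa [gaussVec, inVal] using this
  · rintro ⟨rfl, h⟩
    funext v
    ext
    · simpa [gaussVec, inVal] using h v
    · rfl

/-- Let r be the rank of the incidence matrix. Labellings whose total jumps vanish have dimension
|I| + |V| - r, since the jumps are computed by the transposed matrix. Labellings with zero vector
have no jumps and lie in the kernel of the matrix itself, of dimension |I| - r. The difference is
|V|. -/
theorem isLagrangian_gaussSpace (hinj : ∀ p q, κ p = κ q → t p = t q → p = q) :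
    IsLagrangian (gaussSpace κ t) := by
  classical
  refine ⟨fun a ha => ?_, ?_⟩
  · obtain ⟨b, j, hj, rfl⟩ := mem_gaussSpace.1 ha
    exact quad_gaussVec hinj hj b
  · have h1 := LinearMap.finrank_range_add_finrank_ker
      ((gaussMap κ t).domRestrict (LinearMap.ker (jumpMap κ)))
    have h2 := LinearMap.finrank_range_add_finrank_ker (jumpMap κ)
    have h3 := LinearMap.finrank_range_add_finrank_ker (incidence κ).mulVecLin
    have h4 : Module.finrank (ZMod 2) (LinearMap.range (jumpMap κ)) =
        Module.finrank (ZMod 2) (LinearMap.range (incidence κ).mulVecLin) := by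
      have : LinearMap.range (jumpMap κ) =
          LinearMap.range (incidence κ).transpose.mulVecLin := by
        ext x
        simp only [LinearMap.mem_range, Prod.exists, Matrix.mulVecLin_apply,
          incidence_transpose_mulVec]
        exact ⟨fun ⟨_, j, h⟩ => ⟨j, h⟩, fun ⟨j, h⟩ => ⟨0, j, h⟩⟩
      rw [this]
      exact Matrix.rank_transpose (incidence κ)
    have h5 : Module.finrank (ZMod 2) (LinearMap.ker
        ((gaussMap κ t).domRestrict (LinearMap.ker (jumpMap κ)))) =
        Module.finrank (ZMod 2) (LinearMap.ker (incidence κ).mulVecLin) := by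
      symm
      have hzero : totalJump κ (0 : V → ZMod 2) = 0 := by funext i; simp [totalJump]
      let e : LinearMap.ker (incidence κ).mulVecLin →ₗ[ZMod 2]
          LinearMap.ker ((gaussMap κ t).domRestrict (LinearMap.ker (jumpMap κ))) :=
        { toFun := fun b => ⟨⟨(b.1, 0), hzero⟩, (gaussVec_eq_zero_iff _ _).2 ⟨rfl, fun v => by
            rw [← incidence_mulVec]; exact congrFun b.2 v⟩⟩
          map_add' := fun b b' => by ext <;> simp
          map_smul' := fun c b => by ext <;> simp }
      refine LinearEquiv.finrank_eq (LinearEquiv.ofBijective e ⟨?_, ?_⟩)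
      · intro b b' h
        have := congrArg (fun x => x.1.1.1) h
        exact Subtype.ext this
      · rintro ⟨⟨⟨b, j⟩, h⟩, h'⟩
        obtain ⟨rfl, h''⟩ := (gaussVec_eq_zero_iff (κ := κ) (t := t) b j).1 h'
        exact ⟨⟨b, funext fun v => by rw [Matrix.mulVecLin_apply, incidence_mulVec]; exact h'' v⟩,
          rfl⟩
    have h6 : LinearMap.range ((gaussMap κ t).domRestrict (LinearMap.ker (jumpMap κ))) =
        gaussSpace κ t := LinearMap.range_domRestrict _ _
    rw [h6, h5] at h1
    rw [h4] at h2
    simp only [Module.finrank_prod, Module.finrank_fintype_fun_eq_card] at h1 h2 h3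
    omega

/-- Change of base points. -/
lemma exists_inVal_rotate {t' : V × Bool → ℝ} (k : V × Bool → ℤ) (hk : ∀ p, t' p = t p + k p)
    (ht : ∀ p q, κ p = κ q → |t p - t q| < 1) (ht' : ∀ p q, κ p = κ q → |t' p - t' q| < 1)
    {j : V → ZMod 2} (hj : totalJump κ j = 0) (b : I → ZMod 2) :
    ∃ b', ∀ p, inVal κ t' b' j p = inVal κ t b j p := by
  classical
  -- On one link component k takes at most two values, and these are consecutive. M holds for the
  -- passages with the larger value: those which the base point has moved past.
  let M : V × Bool → Prop := fun p => ∃ q, κ q = κ p ∧ k q < k p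
  have hdiff : ∀ p q, κ p = κ q → k p ≤ k q + 1 := by
    intro p q h
    have h1 := abs_lt.1 (ht p q h)
    have h2 := abs_lt.1 (ht' p q h)
    rw [hk p, hk q] at h2
    have : (k p : ℝ) < k q + 2 := by linarith
    have : k p < k q + 2 := by exact_mod_cast this
    omega
  have h11 : ∀ p q, κ p = κ q → M p → M q → k p = k q := by
    rintro p q h ⟨r, hr, hr'⟩ ⟨x, hx, hx'⟩
    have := hdiff p x (h.trans hx.symm)
    have := hdiff q r (h.symm.trans hr.symm)
    omega
  have h00 : ∀ p q, κ p = κ q → ¬ M p → ¬ M q → k p = k q := by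
    intro p q h hp hq
    by_contra hne
    rcases lt_or_gt_of_ne hne with h1 | h1
    · exact hq ⟨p, h, h1⟩
    · exact hp ⟨q, h.symm, h1⟩
  have h10 : ∀ p q, κ p = κ q → M p → ¬ M q → k p = k q + 1 := by
    rintro p q h ⟨r, hr, hr'⟩ hq
    have h1 := hdiff p q h
    have h2 : k q ≤ k r := by
      by_contra h3
      exact hq ⟨r, hr.trans h, not_le.1 h3⟩
    omega
  -- The new base value adds the jumps of the passages that the base point has moved past.
  refine ⟨fun i => b i + ∑ q, if κ q = i ∧ M q then j q.1 else 0, fun p => ?_⟩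
  rw [inVal, inVal, add_assoc, ← Finset.sum_add_distrib]
  congr 1
  by_cases hp : M p
  -- For a passage in M, the new value contains every jump of the component once more than the old
  -- one, and these jumps sum to zero.
  · have h0 := congrFun hj (κ p)
    rw [totalJump, Pi.zero_apply] at h0
    rw [← sub_eq_zero, ← Finset.sum_sub_distrib]
    refine Eq.trans (Finset.sum_congr rfl fun q _ => ?_) h0
    by_cases hq : κ q = κ p
    · by_cases hM : M q
      · have := h11 q p hq hM hp
        have e : t' q < t' p ↔ t q < t p := by rw [hk, hk, this]; simp
        simp only [hq, hM, e, true_and, if_true]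
        ring
      · have := h10 p q hq.symm hp hM
        have h2 := abs_lt.1 (ht p q hq.symm)
        have h3 := abs_lt.1 (ht' p q hq.symm)
        rw [hk, hk, this] at h3
        push_cast at h3
        have e1 : t' q < t' p := by rw [hk, hk, this]; push_cast; linarith
        have e2 : ¬ t q < t p := by linarith
        simp [hq, hM, e1, e2]
    · simp [hq]
  · refine Finset.sum_congr rfl fun q _ => ?_
    by_cases hq : κ q = κ p
    · by_cases hM : M q
      · have := h10 q p hq hM hp
        have h2 := abs_lt.1 (ht q p hq)
        have h3 := abs_lt.1 (ht' q p hq)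
        rw [hk, hk, this] at h3
        push_cast at h3
        have e1 : ¬ t' q < t' p := by rw [hk, hk, this]; push_cast; linarith
        have e2 : t q < t p := by linarith
        simp [hq, hM, e1, e2]
      · have := h00 q p hq hM hp
        have e : t' q < t' p ↔ t q < t p := by rw [hk, hk, this]; simp
        simp [hq, hM, e]
    · simp [hq]

lemma gaussSpace_rotate {t' : V × Bool → ℝ} (k : V × Bool → ℤ) (hk : ∀ p, t' p = t p + k p)
    (ht : ∀ p q, κ p = κ q → |t p - t q| < 1) (ht' : ∀ p q, κ p = κ q → |t' p - t' q| < 1) :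
    gaussSpace κ t' = gaussSpace κ t := by
  have key : ∀ {t t' : V × Bool → ℝ} (k : V × Bool → ℤ), (∀ p, t' p = t p + k p) →
      (∀ p q, κ p = κ q → |t p - t q| < 1) → (∀ p q, κ p = κ q → |t' p - t' q| < 1) →
      gaussSpace κ t ≤ gaussSpace κ t' := by
    intro t t' k hk ht ht' a ha
    obtain ⟨b, j, hj, rfl⟩ := mem_gaussSpace.1 ha
    obtain ⟨b', hb'⟩ := exists_inVal_rotate k hk ht ht' hj b
    refine mem_gaussSpace.2 ⟨b', j, hj, ?_⟩
    funext v
    simp only [gaussVec, hb']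
  exact le_antisymm (key (fun p => -k p) (fun p => by rw [hk p]; push_cast; ring) ht' ht)
    (key k hk ht ht')

/-! ### Reidemeister moves of Gauss diagrams -/

lemma sum_passages {V' : Type} [Fintype V'] {ι : V → V'} (hι : Function.Injective ι)
    {F : V' × Bool → ZMod 2} (hF : ∀ q, q.1 ∉ Set.range ι → F q = 0) :
    ∑ q, F q = ∑ q : V × Bool, F (ι q.1, q.2) := by
  symm
  refine Fintype.sum_of_injective (fun q : V × Bool => (ι q.1, q.2)) ?_ _ _ ?_ (fun _ => rfl)
  · intro p q h
    simp only [Prod.mk.injEq] at h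
    exact Prod.ext (hι h.1) h.2
  · intro q hq
    exact hF q fun ⟨x, hx⟩ => hq ⟨(x, q.2), Prod.ext hx rfl⟩

/-- Removing crossings from a Gauss diagram. -/
theorem isSmoothing_gaussSpace {V' I' : Type} [Fintype V'] [Fintype I'] {κ' : V' × Bool → I'}
    {t' : V' × Bool → ℝ} {ι : V → V'} (hι : Function.Injective ι) (π : I ≃ I')
    (hκ : ∀ v i, κ' (ι v, i) = π (κ (v, i)))
    (ht : ∀ p q : V × Bool, κ p = κ q →
      (t' (ι p.1, p.2) < t' (ι q.1, q.2) ↔ t p < t q)) :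
    IsSmoothing ι (gaussSpace κ t) (gaussSpace κ' t') := by
  classical
  have hin : ∀ (b : I' → ZMod 2) (j : V' → ZMod 2), (∀ v, v ∉ Set.range ι → j v = 0) →
      ∀ p : V × Bool, inVal κ' t' b j (ι p.1, p.2) = inVal κ t (b ∘ π) (j ∘ ι) p := by
    intro b j hj p
    rw [inVal, inVal, sum_passages hι (fun q hq => by rw [hj _ hq, ite_self])]
    have hκp : κ' (ι p.1, p.2) = π (κ p) := hκ p.1 p.2
    rw [hκp]
    refine congrArg₂ _ rfl (Finset.sum_congr rfl fun q _ => ?_)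
    have : κ' (ι q.1, q.2) = π (κ q) := hκ q.1 q.2
    rw [this, π.apply_eq_iff_eq]
    by_cases h : κ q = κ p
    · simp [ht q p h]
    · simp [h]
  have htot : ∀ (j : V' → ZMod 2), (∀ v, v ∉ Set.range ι → j v = 0) →
      ∀ i, totalJump κ' j (π i) = totalJump κ (j ∘ ι) i := by
    intro j hj i
    rw [totalJump, totalJump, sum_passages hι (fun q hq => by rw [hj _ hq, ite_self])]
    refine Finset.sum_congr rfl fun q _ => ?_
    have : κ' (ι q.1, q.2) = π (κ q) := hκ q.1 q.2
    rw [this, π.apply_eq_iff_eq]; rfl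
  have hvec : ∀ (b : I' → ZMod 2) (j : V' → ZMod 2), (∀ v, v ∉ Set.range ι → j v = 0) →
      gaussVec κ' t' b j ∘ ι = gaussVec κ t (b ∘ π) (j ∘ ι) := by
    intro b j hj
    funext v
    have h1 := hin b j hj (v, true)
    have h2 := hin b j hj (v, false)
    simp only at h1 h2
    simp only [Function.comp_apply, gaussVec, h1, h2]
  intro a
  constructor
  · intro ha
    obtain ⟨b, j, hj, rfl⟩ := mem_gaussSpace.1 ha
    -- Extension by zero: a removed crossing is passed straight, without a jump.
    let j' : V' → ZMod 2 := Function.extend ι j 0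
    have hj' : ∀ v, v ∉ Set.range ι → j' v = 0 := fun v hv =>
      Function.extend_apply' _ _ _ (fun ⟨x, hx⟩ => hv ⟨x, hx⟩)
    have hjι : j' ∘ ι = j := funext fun v => hι.extend_apply _ _ _
    refine ⟨gaussVec κ' t' (b ∘ π.symm) j', mem_gaussSpace.2 ⟨_, _, ?_, rfl⟩, ?_, hj'⟩
    · funext i
      rw [← π.apply_symm_apply i, htot j' hj', hjι, hj]; rfl
    · rw [hvec _ _ hj', hjι]
      congr 1
      funext i
      simp
  · rintro ⟨a', ha', rfl, h⟩
    obtain ⟨b, j, hj, rfl⟩ := mem_gaussSpace.1 ha'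
    refine mem_gaussSpace.2 ⟨b ∘ π, j ∘ ι, ?_, (hvec b j h).symm⟩
    funext i
    rw [← htot j h, hj]; rfl

/-! ### Monogons, bigons and triangles as matchings of passages -/

/-- A matching of the passages through the vertices in `S`, in which matched passages are
neighbors on their link component. -/
structure IsMatching (κ : V × Bool → I) (t : V × Bool → ℝ) (S : Finset V)
    (σ : V × Bool → V × Bool) : Prop where
  mem : ∀ p, p.1 ∈ S → (σ p).1 ∈ S
  invol : ∀ p, p.1 ∈ S → σ (σ p) = p
  ne : ∀ p, p.1 ∈ S → σ p ≠ p
  comp : ∀ p, p.1 ∈ S → κ (σ p) = κ p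
  adjacent : ∀ p, p.1 ∈ S → ∀ q, q ≠ p → q ≠ σ p → κ q = κ p → (t p < t q ↔ t (σ p) < t q)

open scoped Classical in
/-- The vector of transitions determined by a matching. -/
noncomputable def matchVec (t : V × Bool → ℝ) (S : Finset V) (σ : V × Bool → V × Bool) :
    V → Klein := fun v =>
  if v ∈ S then
    if (t (σ (v, true)) < t (v, true) ↔ t (σ (v, false)) < t (v, false)) then d else o
  else 0

/-- This is the vector of the labelling which is 1 on the segments between matched passages and 0
elsewhere. At a vertex, two segments that both arrive or both leave give a disoriented entry; one
arriving and one leaving give an oriented entry. -/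
lemma IsMatching.matchVec_mem {S : Finset V} {σ : V × Bool → V × Bool}
    (h : IsMatching κ t S σ) : matchVec t S σ ∈ gaussSpace κ t := by
  classical
  let j : V → ZMod 2 := fun v => if v ∈ S then 1 else 0
  -- Jumps of matched passages cancel in pairs as long as R does not separate them.
  have hsum : ∀ (R : V × Bool → Prop) [DecidablePred R] (e : Finset (V × Bool)),
      (∀ p, p.1 ∈ S → p ∉ e → (R p ↔ R (σ p))) → (∀ p, p.1 ∈ S → p ∉ e → σ p ∉ e) →
      ∑ q ∈ Finset.univ \ e, (if R q then j q.1 else 0) = 0 := by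
    intro R _ e hR he
    refine Finset.sum_involution (fun p _ => if p.1 ∈ S then σ p else p) ?_ ?_ ?_ ?_
    · intro p hp
      have hpe : p ∉ e := by simpa using hp
      by_cases hpS : p.1 ∈ S
      · rw [if_pos hpS]
        simp only [j, hpS, h.mem p hpS, if_true, ← hR p hpS hpe]
        split_ifs <;> decide
      · simp [j, hpS]
    · intro p hp hne
      by_cases hpS : p.1 ∈ S
      · rw [if_pos hpS]; exact h.ne p hpS
      · simp [j, hpS] at hne
    · intro p hp
      have hpe : p ∉ e := by simpa using hp
      by_cases hpS : p.1 ∈ S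
      · rw [if_pos hpS]; simpa using he p hpS hpe
      · rw [if_neg hpS]; exact hp
    · intro p hp
      by_cases hpS : p.1 ∈ S
      · simp only [if_pos hpS, if_pos (h.mem p hpS), h.invol p hpS]
      · simp [hpS]
  -- All pairs before p cancel except that of p itself, so the value before p is 1 exactly if p is
  -- the later one of its pair.
  have hin : ∀ p, inVal κ t 0 j p = if p.1 ∈ S ∧ t (σ p) < t p then 1 else 0 := by
    intro p
    rw [inVal, Pi.zero_apply, zero_add]
    by_cases hpS : p.1 ∈ S
    · rw [← Finset.sum_sdiff (Finset.subset_univ {p, σ p}), hsum]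
      · rw [zero_add, Finset.sum_pair (h.ne p hpS).symm, if_neg (by simp), zero_add]
        simp [j, h.mem p hpS, h.comp p hpS, hpS]
      · intro q hqS hq
        simp only [Finset.mem_insert, Finset.mem_singleton, not_or] at hq
        rw [h.comp q hqS]
        refine and_congr_right fun hκ => ?_
        refine h.adjacent q hqS p (Ne.symm hq.1) ?_ hκ.symm
        rintro rfl
        exact hq.2 (h.invol q hqS).symm
      · intro q hqS hq
        simp only [Finset.mem_insert, Finset.mem_singleton, not_or] at hq ⊢
        refine ⟨fun h' => hq.2 ?_, fun h' => hq.1 ?_⟩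
        · rw [← h', h.invol q hqS]
        · rw [← h.invol q hqS, h', h.invol p hpS]
    · have := hsum (fun q => κ q = κ p ∧ t q < t p) ∅ ?_ (by simp)
      · rw [Finset.sdiff_empty] at this
        rw [this]; simp [hpS]
      · intro q hqS _
        rw [h.comp q hqS]
        refine and_congr_right fun hκ => ?_
        refine h.adjacent q hqS p ?_ ?_ hκ.symm
        · rintro rfl; exact hpS hqS
        · rintro rfl; exact hpS (h.mem q hqS)
  refine mem_gaussSpace.2 ⟨0, j, ?_, ?_⟩
  · funext i
    have := hsum (fun q => κ q = i) ∅ (fun p hp _ => by rw [h.comp p hp]) (by simp)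
    rw [Finset.sdiff_empty] at this
    exact this
  · funext v
    by_cases hv : v ∈ S
    · simp only [gaussVec, hin, matchVec, hv, if_true, true_and, j]
      by_cases h1 : t (σ (v, true)) < t (v, true) <;>
        by_cases h2 : t (σ (v, false)) < t (v, false) <;> simp only [h1, h2] <;> decide
    · simp only [gaussVec, hin, matchVec, hv, if_false, false_and, j]
      rfl

/-- Exchanging the matched passages. -/
theorem IsMatching.gaussSpace_eq_phiSpace {S : Finset V} {σ : V × Bool → V × Bool}
    (h : IsMatching κ t S σ) {t' : V × Bool → ℝ}
    (ht : ∀ p q, κ q = κ p → q ≠ p → ¬ (p.1 ∈ S ∧ q = σ p) → (t' q < t' p ↔ t q < t p))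
    (ht' : ∀ p, p.1 ∈ S → (t' (σ p) < t' p ↔ ¬ t (σ p) < t p))
    (hσ : ∀ v ∈ S, ∀ j : V → ZMod 2,
      j (σ (v, true)).1 + j (σ (v, false)).1 = ∑ x ∈ S, j x + j v) :
    gaussSpace κ t' = phiSpace S (gaussSpace κ t) := by
  classical
  -- In exactly one of the two orders the partner of p precedes p, so exchanging them adds the jump
  -- of the partner; no other comparison changes.
  have hin : ∀ b j p, inVal κ t' b j p =
      inVal κ t b j p + if p.1 ∈ S then j (σ p).1 else 0 := by
    intro b j p
    rw [inVal, inVal, add_assoc]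
    congr 1
    have h1 : (if p.1 ∈ S then j (σ p).1 else 0) =
        ∑ q, if p.1 ∈ S ∧ q = σ p then j q.1 else 0 := by
      by_cases hp : p.1 ∈ S <;> simp [hp]
    rw [h1, ← Finset.sum_add_distrib]
    refine Finset.sum_congr rfl fun q _ => ?_
    by_cases hκ : κ q = κ p
    · by_cases hq : p.1 ∈ S ∧ q = σ p
      · obtain ⟨hp, rfl⟩ := hq
        by_cases h3 : t (σ p) < t p
        · simp [hκ, hp, ht' p hp, h3, zmod_add_self]
        · simp [hκ, hp, ht' p hp, h3]
      · by_cases hqp : q = p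
        · subst hqp; simp [hq]
        · simp [hκ, ht p q hκ hqp hq, hq]
    · have : ¬ (p.1 ∈ S ∧ q = σ p) := by
        rintro ⟨hp, rfl⟩; exact hκ (h.comp p hp)
      simp [hκ, this]
  have hvec : ∀ b j, gaussVec κ t' b j = phi S (gaussVec κ t b j) := by
    intro b j
    funext v
    by_cases hv : v ∈ S
    · rw [phi_mem S _ hv]
      have h1 := hσ v hv j
      ext
      · simp only [gaussVec, hin, hv, if_true, Prod.fst_add]
        rw [← h1]
        ring
      · simp [gaussVec]
    · rw [phi_notMem S _ hv]
      simp [gaussVec, hin, hv]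
  ext a
  rw [mem_phiSpace, mem_gaussSpace, mem_gaussSpace]
  constructor
  · rintro ⟨b, j, hj, rfl⟩
    exact ⟨b, j, hj, by rw [hvec, phi_phi]⟩
  · rintro ⟨b, j, hj, he⟩
    exact ⟨b, j, hj, by rw [hvec, he, phi_phi]⟩

end Gauss

/-! ### Representatives of points of the circle -/

/-- The representative in `[θ, θ + 1)` of a point of the circle. -/
noncomputable def circleRep (θ : ℝ) (x : UnitAddCircle) : ℝ := (AddCircle.equivIco 1 θ x).1

lemma coe_circleRep (θ : ℝ) (x : UnitAddCircle) : ((circleRep θ x : ℝ) : UnitAddCircle) = x :=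
  (AddCircle.equivIco 1 θ).symm_apply_apply x

lemma circleRep_mem (θ : ℝ) (x : UnitAddCircle) : circleRep θ x ∈ Set.Ico θ (θ + 1) :=
  (AddCircle.equivIco 1 θ x).2

lemma circle_coe_eq_iff {x y : ℝ} : (x : UnitAddCircle) = y ↔ ∃ m : ℤ, y = x + m := by
  rw [eq_comm, ← sub_eq_zero, ← AddCircle.coe_sub, AddCircle.coe_eq_zero_iff]
  constructor
  · rintro ⟨m, hm⟩
    exact ⟨m, by simp at hm; linarith⟩
  · rintro ⟨m, hm⟩
    exact ⟨m, by simp; linarith⟩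

lemma circle_coe_add_int (x : ℝ) (m : ℤ) : ((x + m : ℝ) : UnitAddCircle) = x :=
  (circle_coe_eq_iff.2 ⟨m, rfl⟩).symm

lemma circleRep_coe {θ x : ℝ} (hx : x ∈ Set.Ico θ (θ + 1)) : circleRep θ x = x := by
  obtain ⟨m, hm⟩ := circle_coe_eq_iff.1 (coe_circleRep θ x)
  have h := circleRep_mem θ x
  have h1 : ((m : ℤ) : ℝ) < 1 := by linarith [hx.2, h.1]
  have h2 : (-1 : ℝ) < (m : ℤ) := by linarith [hx.1, h.2]
  have h3 : m < 1 := by exact_mod_cast h1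
  have h4 : -1 < m := by exact_mod_cast h2
  have : m = 0 := by omega
  subst this
  simpa using hm.symm

lemma circleRep_injective (θ : ℝ) : Function.Injective (circleRep θ) := fun x y h => by
  rw [← coe_circleRep θ x, h, coe_circleRep]

/-! ### Half-edges at a vertex -/

namespace Transition

/-- The transition as an element of the Klein group. -/
def toKlein : Transition → Klein
  | .straight => s
  | .oriented => o
  | .disoriented => d

lemma partner_partner (T : Transition) (x : Bool × Bool) : T.partner (T.partner x) = x := by
  rcases x with ⟨a, b⟩; cases T <;> simp [partner]

lemma partner_ne (T : Transition) (x : Bool × Bool) : T.partner x ≠ x := by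
  rcases x with ⟨a, b⟩; cases T <;> simp [partner]

/-- The transition class of an even labelling of the half-edges at a vertex. -/
def klein (β : Bool × Bool → ZMod 2) : Klein :=
  (β (true, true) + β (false, false), β (true, true) + β (true, false))

lemma sum_halfEdges (β : Bool × Bool → ZMod 2) : ∑ x, β x =
    β (true, true) + β (true, false) + (β (false, true) + β (false, false)) := by
  simp [Fintype.sum_prod_type]

/-- The even labellings at a vertex are the orthogonal complement of the constant labelling, and
`klein` is their quotient by constants. The dot product descends to the symplectic form. -/
lemma symp_klein {ρ β : Bool × Bool → ZMod 2} (hρ : ∑ x, ρ x = 0) (hβ : ∑ x, β x = 0) :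
    symp (klein ρ) (klein β) = ∑ x, ρ x * β x := by
  rw [sum_halfEdges] at hρ hβ
  rw [sum_halfEdges, klein, klein, symp]
  have h1 : ρ (false, true) = ρ (true, true) + ρ (true, false) + ρ (false, false) :=
    (show ∀ a b c d : ZMod 2, a + b + (c + d) = 0 → c = a + b + d by decide) _ _ _ _ hρ
  have h2 : β (false, true) = β (true, true) + β (true, false) + β (false, false) :=
    (show ∀ a b c d : ZMod 2, a + b + (c + d) = 0 → c = a + b + d by decide) _ _ _ _ hβ
  rw [h1, h2]
  exact (show ∀ a b c a' b' c' : ZMod 2, (a + c) * (a' + b') + (a + b) * (a' + c') =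
    a * a' + b * b' + ((a + b + c) * (a' + b' + c') + c * c') by decide) _ _ _ _ _ _

lemma klein_of_partner {T : Transition} {β : Bool × Bool → ZMod 2}
    (h : ∀ x, β (T.partner x) = β x) :
    ∑ x, β x = 0 ∧ (klein β = 0 ∨ klein β = T.toKlein) := by
  rw [sum_halfEdges, klein]
  have h1 := h (true, true)
  have h2 := h (false, false)
  have h3 := h (true, false)
  cases T <;> simp only [partner, Bool.not_true, Bool.not_false] at h1 h2 h3 <;>
    revert h1 h2 h3 <;>
    generalize β (true, true) = a <;> generalize β (true, false) = b <;>
    generalize β (false, true) = c <;> generalize β (false, false) = e <;>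
    revert a b c e <;> decide

lemma partner_of_klein {T : Transition} {β : Bool × Bool → ZMod 2} (hβ : ∑ x, β x = 0)
    (h : klein β = 0 ∨ klein β = T.toKlein) (x : Bool × Bool) : β (T.partner x) = β x := by
  rw [sum_halfEdges] at hβ
  rw [klein] at h
  rcases x with ⟨p, q⟩
  cases T <;> cases p <;> cases q <;>
    simp only [partner, Bool.not_true, Bool.not_false] <;> revert h hβ <;>
    generalize β (true, true) = a <;> generalize β (true, false) = b <;>
    generalize β (false, true) = c <;> generalize β (false, false) = e <;>
    revert a b c e <;> decide

lemma klein_pair {T : Transition} {β : Bool × Bool → ZMod 2} (x : Bool × Bool)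
    (h : ∀ y, β y = if y = x ∨ y = T.partner x then 1 else 0) :
    ∑ x, β x = 0 ∧ klein β = T.toKlein := by
  rw [sum_halfEdges, klein, h, h, h, h]
  rcases x with ⟨p, q⟩
  cases T <;> cases p <;> cases q <;> decide

lemma const_of_klein {β : Bool × Bool → ZMod 2} (hβ : ∑ x, β x = 0) (h : klein β = 0)
    (x y : Bool × Bool) : β x = β y := by
  rw [sum_halfEdges] at hβ
  rw [klein] at h
  have h1 : ∀ x, β x = β (true, true) := by
    rintro ⟨p, q⟩
    cases p <;> cases q <;> revert h hβ <;>
      generalize β (true, true) = a <;> generalize β (true, false) = b <;>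
      generalize β (false, true) = c <;> generalize β (false, false) = e <;>
      revert a b c e <;> decide
  rw [h1, h1 y]

/-- The four half-edges are x, z and their partners. Each of the two transitions other than `T`
pairs x either with z or with the partner of z. -/
lemma exists_partner_eq {T : Transition} {x z : Bool × Bool} (h : z ≠ x)
    (h' : T.partner z ≠ x) : ∃ T' T'' : Transition, T' ≠ T ∧ T'' ≠ T ∧ T' ≠ T'' ∧
      T'.partner x = z ∧ T''.partner x = T.partner z ∧
      ∀ y, y = x ∨ y = z ∨ y = T.partner x ∨ y = T.partner z := by
  rcases x with ⟨p, q⟩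
  rcases z with ⟨p', q'⟩
  cases T <;> cases p <;> cases q <;> cases p' <;> cases q' <;>
    first
    | exact absurd rfl h
    | exact absurd rfl h'
    | exact ⟨.oriented, .disoriented, nofun, nofun, nofun, rfl, rfl, by decide⟩
    | exact ⟨.disoriented, .oriented, nofun, nofun, nofun, rfl, rfl, by decide⟩
    | exact ⟨.straight, .disoriented, nofun, nofun, nofun, rfl, rfl, by decide⟩
    | exact ⟨.disoriented, .straight, nofun, nofun, nofun, rfl, rfl, by decide⟩
    | exact ⟨.straight, .oriented, nofun, nofun, nofun, rfl, rfl, by decide⟩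
    | exact ⟨.oriented, .straight, nofun, nofun, nofun, rfl, rfl, by decide⟩

end Transition

/-! ### Passages -/

namespace LinkDiagram

open Isotropic Gauss

variable {n : ℕ} (D : LinkDiagram n)

/-- As there are no triple points, crossings sharing a parameter also share the other one. They are
equal as pairs or opposite to each other, and `crossing_asymm` excludes the latter. -/
lemma passageParam_injective : Function.Injective D.passageParam := by
  have hpt : ∀ (x : D.Vertex) (b c : Bool), D.pt (D.passageParam (x, b)) =
      D.pt (D.passageParam (x, c)) := by
    intro x b c
    have := (D.crossing_double x.1 x.2).2
    cases b <;> cases c <;> simp [passageParam, pt, this]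
  have hne : ∀ (x : D.Vertex) (b : Bool), D.passageParam (x, b) ≠ D.passageParam (x, !b) := by
    intro x b
    have := (D.crossing_double x.1 x.2).1
    cases b <;> simp [passageParam, this, this.symm]
  rintro ⟨x, b⟩ ⟨y, c⟩ h
  have h3 : D.passageParam (y, !c) = D.passageParam (x, !b) := by
    rcases D.no_triple (D.passageParam (x, b)) (D.passageParam (x, !b)) (D.passageParam (y, !c))
      (hpt x _ _) ((hpt x (!b) b).trans ((congrArg D.pt h).trans (hpt y _ _))) with h1 | h1 | h1
    · exact absurd h1 (hne x b)
    · exact h1.symm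
    · exact absurd (h.symm.trans h1) (hne y c)
  have key : ∀ b : Bool, x.1 = if b then (D.passageParam (x, b), D.passageParam (x, !b)) else
      (D.passageParam (x, !b), D.passageParam (x, b)) := by
    intro b; cases b <;> simp [passageParam]
  have key' : ∀ b : Bool, y.1 = if b then (D.passageParam (y, b), D.passageParam (y, !b)) else
      (D.passageParam (y, !b), D.passageParam (y, b)) := by
    intro b; cases b <;> simp [passageParam]
  have hx := key b
  have hy := key' c
  rw [← h, h3] at hy
  by_cases hbc : b = c
  · subst hbc
    have : x = y := Subtype.ext (hx.trans hy.symm)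
    rw [this]
  · exfalso
    have hc : c = !b := by cases b <;> cases c <;> simp_all
    subst hc
    have h5 : (x.1.2, x.1.1) = y.1 := by
      rw [hx, hy]; cases b <;> simp
    exact D.crossing_asymm x.1 x.2 (h5 ▸ y.2)

/-- The link component of a passage. -/
def passageComp (p : D.Passage) : Fin n := (D.passageParam p).1

/-- The position of a passage on its link component, with respect to given base points. -/
noncomputable def position (θ : Fin n → ℝ) (p : D.Passage) : ℝ :=
  circleRep (θ (D.passageComp p)) (D.passageParam p).2

lemma position_injective (θ : Fin n → ℝ) (p q : D.Passage) (h : D.passageComp p = D.passageComp q)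
    (h' : D.position θ p = D.position θ q) : p = q := by
  apply D.passageParam_injective
  refine Prod.ext h ?_
  rw [position, position, h] at h'
  exact circleRep_injective _ h'

lemma position_mem (θ : Fin n → ℝ) (p : D.Passage) :
    D.position θ p ∈ Set.Ico (θ (D.passageComp p)) (θ (D.passageComp p) + 1) :=
  circleRep_mem _ _

lemma position_sub_lt (θ : Fin n → ℝ) (p q : D.Passage) (h : D.passageComp p = D.passageComp q) :
    |D.position θ p - D.position θ q| < 1 := by
  have h1 := D.position_mem θ p
  have h2 := D.position_mem θ q
  rw [h] at h1
  rw [abs_lt]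
  constructor <;> linarith [h1.1, h1.2, h2.1, h2.2]

lemma exists_position_eq (θ θ' : Fin n → ℝ) :
    ∃ k : D.Passage → ℤ, ∀ p, D.position θ' p = D.position θ p + k p := by
  have : ∀ p, ∃ k : ℤ, D.position θ' p = D.position θ p + k := fun p => by
    rw [← circle_coe_eq_iff, position, position, coe_circleRep, coe_circleRep]
  choose k hk using this
  exact ⟨k, hk⟩

/-- The space of vectors of transitions of a diagram. -/
noncomputable def space : Submodule (ZMod 2) (D.Vertex → Klein) :=
  gaussSpace D.passageComp (D.position 0)

lemma space_eq (θ : Fin n → ℝ) : D.space = gaussSpace D.passageComp (D.position θ) := by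
  obtain ⟨k, hk⟩ := D.exists_position_eq θ 0
  exact gaussSpace_rotate k hk (D.position_sub_lt _) (D.position_sub_lt _)

lemma isLagrangian_space : IsLagrangian D.space := isLagrangian_gaussSpace (D.position_injective 0)

/-- The abstract diagram of a diagram. -/
noncomputable def toState : State where
  V := D.Vertex
  L := D.space
  neg := fun v => D.IsNegative v.1
  f := D.componentCount - 1
  lagrangian := D.isLagrangian_space

/-! ### Consecutive passages -/

variable {D}

lemma IsNextPassage.unique {p q q' : D.Passage} (h : D.IsNextPassage p q)
    (h' : D.IsNextPassage p q') : q = q' := by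
  obtain ⟨i, s, e, he, hp, hq, hm⟩ := h
  obtain ⟨i', s', e', he', hp', hq', hm'⟩ := h'
  rw [hp, Prod.mk.injEq] at hp'
  obtain ⟨rfl, hs⟩ := hp'
  apply D.passageParam_injective
  have h1 : ¬ e < e' := fun hlt => hm' e ⟨he, hlt⟩ q (by
    rw [hq, AddCircle.coe_add, hs, ← AddCircle.coe_add])
  have h2 : ¬ e' < e := fun hlt => hm e' ⟨he', hlt⟩ q' (by
    rw [hq', AddCircle.coe_add, ← hs, ← AddCircle.coe_add])
  have : e = e' := le_antisymm (not_lt.1 h2) (not_lt.1 h1)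
  rw [hq, hq', this, AddCircle.coe_add, hs, ← AddCircle.coe_add]

lemma IsNextPassage.unique' {p p' q : D.Passage} (h : D.IsNextPassage p q)
    (h' : D.IsNextPassage p' q) : p = p' := by
  obtain ⟨i, s, e, he, hp, hq, hm⟩ := h
  obtain ⟨i', s', e', he', hp', hq', hm'⟩ := h'
  rw [hq, Prod.mk.injEq] at hq'
  obtain ⟨rfl, hs⟩ := hq'
  obtain ⟨m, hm0⟩ := circle_coe_eq_iff.1 hs
  apply D.passageParam_injective
  have h1 : ¬ e < e' := fun hlt => hm' (e' - e) ⟨by linarith, by linarith⟩ p (by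
    rw [hp, show s' + (e' - e) = s + m by linarith, circle_coe_add_int])
  have h2 : ¬ e' < e := fun hlt => hm (e - e') ⟨by linarith, by linarith⟩ p' (by
    rw [hp', show s + (e - e') = s' + (-m : ℤ) by push_cast; linarith, circle_coe_add_int])
  have : e = e' := le_antisymm (not_lt.1 h2) (not_lt.1 h1)
  rw [hp, hp', show s' = s + m by linarith, circle_coe_add_int]

lemma exists_isNextPassage (p : D.Passage) : ∃ q, D.IsNextPassage p q := by
  classical
  set i := D.passageComp p with hi
  set s := circleRep 0 (D.passageParam p).2
  have hs : (s : UnitAddCircle) = (D.passageParam p).2 := coe_circleRep _ _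
  let θ : Fin n → ℝ := fun _ => s
  -- The passage p itself is at distance 1, not 0: it is its own successor after a full turn if it
  -- is alone on its component.
  let dist : D.Passage → ℝ := fun m => if D.position θ m = s then 1 else D.position θ m - s
  obtain ⟨q, hq, hmin⟩ := Finset.exists_min_image
    (Finset.univ.filter fun m => D.passageComp m = i) dist ⟨p, by simp [hi]⟩
  simp only [Finset.mem_filter, Finset.mem_univ, true_and] at hq hmin
  have hpos : ∀ m, D.position θ m ∈ Set.Ico s (s + 1) := fun m => D.position_mem θ m
  have hdist : 0 < dist q := by
    simp only [dist]
    split_ifs with h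
    · exact one_pos
    · have := (hpos q).1
      exact sub_pos.2 (lt_of_le_of_ne this (Ne.symm h))
  have hle : dist q ≤ 1 := by
    simp only [dist]
    split_ifs with h
    · exact le_rfl
    · linarith [(hpos q).2]
  refine ⟨q, i, s, dist q, hdist, Prod.ext rfl hs.symm, Prod.ext hq ?_, ?_⟩
  · have h1 : ((D.position θ q : ℝ) : UnitAddCircle) = (D.passageParam q).2 := coe_circleRep _ _
    rw [← h1]
    change _ = ((s + dist q : ℝ) : UnitAddCircle)
    simp only [dist]
    split_ifs with h
    · rw [h, ← circle_coe_add_int s 1]; simp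
    · congr 1; ring
  · intro e he m hm
    have h1 : D.position θ m = s + e := by
      rw [position, hm]
      exact circleRep_coe ⟨by simp only [θ]; linarith [he.1], by simp only [θ]; linarith [he.2]⟩
    have h2 : dist m = e := by
      simp only [dist]
      rw [if_neg (by rw [h1]; linarith [he.1]), h1]; ring
    have h3 := hmin m (by rw [passageComp, hm])
    rw [h2] at h3
    linarith [he.2]

variable (D) in
/-- The next passage, as a permutation of the passages. -/
noncomputable def nextPassage : Equiv.Perm D.Passage :=
  Equiv.ofBijective (fun p => (exists_isNextPassage p).choose)
    (Finite.injective_iff_bijective.1 fun p p' h =>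
      (exists_isNextPassage p).choose_spec.unique' (by
        rw [show (exists_isNextPassage p).choose = (exists_isNextPassage p').choose from h]
        exact (exists_isNextPassage p').choose_spec))

lemma isNextPassage_iff {p q : D.Passage} : D.IsNextPassage p q ↔ D.nextPassage p = q := by
  have h : D.IsNextPassage p (D.nextPassage p) := (exists_isNextPassage p).choose_spec
  exact ⟨fun h' => h.unique h', fun h' => h' ▸ h⟩

/-- The other half of the edge of a half-edge. -/
noncomputable def edge (h : D.HalfEdge) : D.HalfEdge :=
  if h.2.2 then
    ((D.nextPassage (h.1, h.2.1)).1, (D.nextPassage (h.1, h.2.1)).2, false)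
  else ((D.nextPassage.symm (h.1, h.2.1)).1, (D.nextPassage.symm (h.1, h.2.1)).2, true)

lemma isEdge_iff {h h' : D.HalfEdge} : D.IsEdge h h' ↔ edge h = h' := by
  obtain ⟨v, b, c⟩ := h
  constructor
  · rintro ⟨p, q, hpq, ⟨h1, rfl⟩ | ⟨h1, rfl⟩⟩
    · rw [isNextPassage_iff] at hpq
      rw [h1]
      simp [edge, hpq]
    · rw [isNextPassage_iff, ← Equiv.eq_symm_apply] at hpq
      rw [h1]
      simp [edge, hpq]
  · rintro rfl
    cases c
    · exact ⟨D.nextPassage.symm (v, b), (v, b), isNextPassage_iff.2 (by simp), Or.inr ⟨rfl, rfl⟩⟩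
    · exact ⟨(v, b), D.nextPassage (v, b), isNextPassage_iff.2 rfl, Or.inl ⟨rfl, rfl⟩⟩

lemma edge_edge (h : D.HalfEdge) : edge (edge h) = h := by
  rw [← isEdge_iff]
  obtain ⟨p, q, hpq, h1⟩ := isEdge_iff.2 (rfl : edge h = edge h)
  exact ⟨p, q, hpq, h1.symm.imp And.symm And.symm⟩

lemma edge_ne (h : D.HalfEdge) : edge h ≠ h := by
  obtain ⟨p, q, -, ⟨h1, h2⟩ | ⟨h1, h2⟩⟩ := isEdge_iff.2 (rfl : edge h = edge h) <;>
    rw [h2, h1] <;> simp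

/-! ### Edge labellings as labellings of half-edges -/

/-- The labelling of the half-edges given by an edge labelling. -/
noncomputable def halfLabel (θ : Fin n → ℝ) (b : Fin n → ZMod 2) (j : D.Vertex → ZMod 2)
    (h : D.HalfEdge) : ZMod 2 :=
  inVal D.passageComp (D.position θ) b j (h.1, h.2.1) + if h.2.2 then j h.1 else 0

/-- Move the base point to p. Then no passage precedes p, and only p precedes q. If the step is a
full turn, p is alone on its component and the vanishing of the total jump gives j = 0 there. -/
lemma inVal_next {p q : D.Passage} (h : D.IsNextPassage p q) (θ : Fin n → ℝ)
    (b : Fin n → ZMod 2) {j : D.Vertex → ZMod 2} (hj : totalJump D.passageComp j = 0) :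
    inVal D.passageComp (D.position θ) b j q =
      inVal D.passageComp (D.position θ) b j p + j p.1 := by
  classical
  obtain ⟨i, s, e, he, hp, hq, hm⟩ := h
  obtain ⟨k, hk⟩ := D.exists_position_eq θ (fun _ => s)
  obtain ⟨b', hb'⟩ := exists_inVal_rotate k hk (D.position_sub_lt _) (D.position_sub_lt _) hj b
  rw [← hb', ← hb']
  set t := D.position fun _ => s
  have htp : t p = s := by
    simp only [t, position, hp]
    exact circleRep_coe ⟨le_rfl, by linarith⟩
  have hmem : ∀ m, t m ∈ Set.Ico s (s + 1) := fun m => D.position_mem (fun _ => s) m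
  have hcoe : ∀ m, D.passageComp m = i → D.passageParam m = (i, ((t m : ℝ) : UnitAddCircle)) :=
    fun m hmi => Prod.ext hmi (coe_circleRep _ _).symm
  have hpc : D.passageComp p = i := by rw [passageComp, hp]
  have hqc : D.passageComp q = i := by rw [passageComp, hq]
  have hp1 : D.passageParam p = (i, ((s + 1 : ℝ) : UnitAddCircle)) := by
    rw [hp, ← circle_coe_add_int s 1]; simp
  have hle : e ≤ 1 := by
    by_contra hlt
    exact hm 1 ⟨one_pos, not_le.1 hlt⟩ p hp1
  have hbetween : ∀ m, D.passageComp m = i → t m < s + e → m = p := by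
    intro m hmi hlt
    by_contra hne
    have h1 : t m ≠ s := fun h => hne (D.position_injective _ m p (hmi.trans hpc.symm)
      (h.trans htp.symm))
    refine hm (t m - s) ⟨sub_pos.2 (lt_of_le_of_ne (hmem m).1 h1.symm), by linarith⟩ m ?_
    rw [hcoe m hmi, add_sub_cancel]
  have hinp : inVal D.passageComp t b' j p = b' i := by
    rw [inVal, hpc, Finset.sum_eq_zero, add_zero]
    intro m _
    rw [if_neg]
    rintro ⟨_, hlt⟩
    rw [htp] at hlt
    exact absurd (hmem m).1 (not_le.2 hlt)
  rcases lt_or_eq_of_le hle with hlt | rfl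
  · have htq : t q = s + e := by
      simp only [t, position, hq]
      exact circleRep_coe ⟨by linarith, by linarith⟩
    rw [hinp, inVal, hqc, Finset.sum_eq_single p, if_pos ⟨hpc, by rw [htp, htq]; linarith⟩]
    · intro m _ hne
      rw [if_neg]
      rintro ⟨hmi, hlt'⟩
      exact hne (hbetween m hmi (by rwa [htq] at hlt'))
    · simp
  · have hpq : q = p := D.passageParam_injective (hq.trans hp1.symm)
    have h0 := congrFun hj i
    rw [totalJump, Pi.zero_apply, Finset.sum_eq_single p, if_pos hpc] at h0
    · rw [hpq, h0, add_zero]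
    · intro m _ hne
      rw [if_neg]
      intro hmi
      exact hne (hbetween m hmi (hmem m).2)
    · simp

lemma halfLabel_edge (θ : Fin n → ℝ) (b : Fin n → ZMod 2) {j : D.Vertex → ZMod 2}
    (hj : totalJump D.passageComp j = 0) (h : D.HalfEdge) :
    halfLabel θ b j (edge h) = halfLabel θ b j h := by
  obtain ⟨p, q, hpq, h1⟩ := isEdge_iff.2 (rfl : edge h = edge h)
  have h2 := inVal_next hpq θ b hj
  rcases h1 with ⟨h1, h3⟩ | ⟨h1, h3⟩ <;> rw [h3, h1] <;> simp [halfLabel, h2]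

lemma klein_halfLabel (θ : Fin n → ℝ) (b : Fin n → ZMod 2) (j : D.Vertex → ZMod 2)
    (v : D.Vertex) : Transition.klein (fun x => halfLabel θ b j (v, x)) =
      gaussVec D.passageComp (D.position θ) b j v ∧ ∑ x, halfLabel θ b j (v, x) = 0 := by
  rw [Transition.sum_halfEdges, Transition.klein]
  simp only [halfLabel, gaussVec, if_true, Bool.false_eq_true, if_false, add_zero]
  refine ⟨Prod.ext rfl ?_, ?_⟩
  · exact (show ∀ x y : ZMod 2, x + y + x = y by decide) _ _
  · exact (show ∀ x y z : ZMod 2, x + y + x + (z + y + z) = 0 by decide) _ _ _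

end LinkDiagram

/-! ### Circuits of an Euler system -/

lemma Transition.partner_comm (T T' : Transition) (x : Bool × Bool) :
    T.partner (T'.partner x) = T'.partner (T.partner x) := by
  rcases x with ⟨p, q⟩
  cases T <;> cases T' <;> simp [Transition.partner]

namespace LinkDiagram

open Isotropic Gauss

variable {n : ℕ} {D : LinkDiagram n}

lemma edge_injective : Function.Injective (edge : D.HalfEdge → D.HalfEdge) :=
  Function.LeftInverse.injective edge_edge

namespace EulerSystem

variable (C : D.EulerSystem)

/-- The half-edge paired with a given half-edge at the same vertex. -/
def part (h : D.HalfEdge) : D.HalfEdge := (h.1, (C.transition h.1).partner h.2)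

lemma part_part (h : D.HalfEdge) : C.part (C.part h) = h := by
  simp [part, Transition.partner_partner]

lemma part_ne (h : D.HalfEdge) : C.part h ≠ h := fun h' =>
  Transition.partner_ne _ _ (congrArg Prod.snd h')

/-- The next half-edge on a circuit. -/
noncomputable def step (h : D.HalfEdge) : D.HalfEdge := C.part (edge h)

lemma follows_iff {h h' : D.HalfEdge} : C.Follows h h' ↔ h' = C.step h := by
  constructor
  · rintro ⟨g, hg, rfl⟩
    rw [isEdge_iff] at hg
    subst hg
    rfl
  · rintro rfl
    exact ⟨edge h, isEdge_iff.2 rfl, rfl⟩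

lemma part_step (h : D.HalfEdge) : C.part (C.step h) = edge h := C.part_part _

lemma edge_step (h : D.HalfEdge) : edge (C.part (C.step h)) = h := by rw [part_step, edge_edge]

lemma step_part_step (h : D.HalfEdge) : C.step (C.part (C.step h)) = C.part h := by
  rw [step, edge_step]

lemma step_injective : Function.Injective C.step := fun x y h => by
  rw [← C.edge_step x, h, C.edge_step]

lemma reflTransGen_iff {h h' : D.HalfEdge} :
    Relation.ReflTransGen C.Follows h h' ↔ ∃ k, C.step^[k] h = h' := by
  constructor
  · intro H
    induction H with
    | refl => exact ⟨0, rfl⟩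
    | tail _ h2 ih =>
      obtain ⟨k, rfl⟩ := ih
      exact ⟨k + 1, by rw [Function.iterate_succ_apply', (C.follows_iff).1 h2]⟩
  · rintro ⟨k, rfl⟩
    induction k with
    | zero => exact .refl
    | succ k ih =>
      rw [Function.iterate_succ_apply']
      exact ih.tail ((C.follows_iff).2 rfl)

/-- Reversing the direction of travel: `part` composed with `step` is the involution `edge`. -/
lemma step_part_of_step {h h' : D.HalfEdge} (k : ℕ) (hk : C.step^[k] h = h') :
    C.step^[k] (C.part h') = C.part h := by
  induction k generalizing h with
  | zero => rw [← hk]; rfl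
  | succ k ih =>
    rw [Function.iterate_succ_apply', ih hk, step_part_step]

/-- A tour never turns back on itself. By reversal, a tour from h to its partner contains one from
the second half-edge to its partner that is two steps shorter; after finitely many reductions `part`
or `edge` would have a fixed point. -/
lemma step_ne_part (k : ℕ) (h : D.HalfEdge) : C.step^[k] h ≠ C.part h := by
  induction k using Nat.strong_induction_on generalizing h with
  | _ k ih =>
    match k with
    | 0 => exact (C.part_ne h).symm
    | 1 =>
      intro h'
      have h1 : C.part (C.part (edge h)) = C.part (C.part h) := congrArg C.part h'
      rw [part_part, part_part] at h1
      exact edge_ne h h1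
    | k + 2 =>
      intro h'
      rw [Function.iterate_succ_apply, Function.iterate_succ_apply', ← step_part_step] at h'
      exact ih k (by omega) _ (C.step_injective h')

lemma exists_step_eq_self (h : D.HalfEdge) : ∃ p, 0 < p ∧ C.step^[p] h = h :=
  Function.mem_periodicPts.1 (C.step_injective.mem_periodicPts h)

lemma exists_step_symm {h h' : D.HalfEdge} (H : ∃ k, C.step^[k] h = h') :
    ∃ k, C.step^[k] h' = h := by
  obtain ⟨k, rfl⟩ := H
  obtain ⟨p, hp, hp'⟩ := C.exists_step_eq_self h
  refine ⟨p * k - k, ?_⟩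
  rw [← Function.iterate_add_apply, Nat.sub_add_cancel (Nat.le_mul_of_pos_left k hp)]
  exact Function.IsPeriodicPt.mul_const (f := C.step) (m := p) hp' k

/-- The half-edges lie on the same circuit. -/
lemma exists_step_of_eqvGen {h h' : D.HalfEdge} (H : Relation.EqvGen (fun g g' : D.HalfEdge =>
    D.IsEdge g g' ∨ g' = (g.1, (C.transition g.1).partner g.2)) h h') :
    (∃ k, C.step^[k] h = h') ∨ ∃ k, C.step^[k] h = C.part h' := by
  have comp : ∀ {x y z : D.HalfEdge}, (∃ k, C.step^[k] x = y) → (∃ k, C.step^[k] y = z) →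
      ∃ k, C.step^[k] x = z := by
    rintro x y z ⟨k, rfl⟩ ⟨m, rfl⟩
    exact ⟨m + k, Function.iterate_add_apply _ _ _ _⟩
  have flip : ∀ {x y : D.HalfEdge}, (∃ k, C.step^[k] x = C.part y) →
      ∃ k, C.step^[k] y = C.part x := by
    rintro x y ⟨k, hk⟩
    exact ⟨k, by simpa [part_part] using C.step_part_of_step k hk⟩
  induction H with
  | rel x y h =>
    right
    rcases h with h | rfl
    · exact ⟨1, by rw [isEdge_iff] at h; rw [← h]; rfl⟩
    · exact ⟨0, (C.part_part x).symm⟩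
  | refl x => exact Or.inl ⟨0, rfl⟩
  | symm x y _ ih => exact ih.imp C.exists_step_symm flip
  | trans x y z _ _ h1 h2 =>
    rcases h1 with h1 | h1 <;> rcases h2 with h2 | h2
    · exact Or.inl (comp h1 h2)
    · exact Or.inr (comp h1 h2)
    · exact Or.inr (flip (comp (C.exists_step_symm h2) (flip h1)))
    · exact Or.inl (C.exists_step_symm (comp (flip h2) (by
        obtain ⟨k, hk⟩ := C.exists_step_symm h1
        exact ⟨k, by simpa [part_part] using hk⟩)))

/-- If the first return were at h itself, the tour would leave the vertex only through h. By the
Euler property every half-edge at the vertex would then be h or its partner, but there are four. -/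
lemma exists_first_return (h : D.HalfEdge) : ∃ m, 0 < m ∧ (C.step^[m] h).1 = h.1 ∧
    C.step^[m] h ≠ h ∧ ∀ k, 0 < k → k < m → (C.step^[k] h).1 ≠ h.1 := by
  classical
  have hex : ∃ m, 0 < m ∧ (C.step^[m] h).1 = h.1 := by
    obtain ⟨p, hp, hp'⟩ := C.exists_step_eq_self h
    exact ⟨p, hp, by rw [hp']⟩
  refine ⟨Nat.find hex, (Nat.find_spec hex).1, (Nat.find_spec hex).2, ?_,
    fun k hk hlt hk' => Nat.find_min hex hlt ⟨hk, hk'⟩⟩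
  intro hself
  set m := Nat.find hex with hm
  have hm0 : 0 < m := (Nat.find_spec hex).1
  have hmod : ∀ k, (C.step^[k] h).1 = h.1 → C.step^[k] h = h := by
    intro k hk
    have h1 : C.step^[k % m] h = C.step^[k] h :=
      Function.IsPeriodicPt.iterate_mod_apply (f := C.step) hself k
    by_cases h0 : k % m = 0
    · rw [← h1, h0]; rfl
    · exfalso
      exact Nat.find_min hex (Nat.mod_lt k hm0) ⟨Nat.pos_of_ne_zero h0, by rw [h1, hk]⟩
  obtain ⟨v, x⟩ := h
  obtain ⟨y, hy, hy'⟩ : ∃ y : Bool × Bool, y ≠ x ∧ (C.transition v).partner y ≠ x := by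
    rcases x with ⟨p, q⟩
    cases C.transition v
    · exact ⟨(!p, q), by simp, by simp [Transition.partner]⟩
    · exact ⟨(!p, q), by simp, by simp [Transition.partner]⟩
    · exact ⟨(p, !q), by simp, by simp [Transition.partner]⟩
  have := C.exists_step_of_eqvGen (C.euler (v, x) (v, y) (.rel _ _ (Or.inr rfl)))
  rcases this with ⟨k, hk⟩ | ⟨k, hk⟩
  · rw [hmod k (by rw [hk])] at hk
    exact hy (congrArg Prod.snd hk).symm
  · rw [hmod k (by rw [hk]; rfl)] at hk
    exact hy' (congrArg Prod.snd hk).symm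

lemma iterate_ne_part {h : D.HalfEdge} (i j : ℕ) : C.step^[i] h ≠ C.part (C.step^[j] h) := by
  intro H
  rcases le_total j i with hij | hij
  · obtain ⟨e, rfl⟩ := Nat.exists_eq_add_of_le' hij
    rw [Function.iterate_add_apply] at H
    exact C.step_ne_part _ _ H
  · obtain ⟨e, rfl⟩ := Nat.exists_eq_add_of_le' hij
    rw [Function.iterate_add_apply] at H
    exact C.step_ne_part e (C.step^[i] h) (by rw [← C.part_part (C.step^[e] _), ← H])

/-- Of the four half-edges at a vertex a tour leaves through at most one of each pair of partners,
so through at most two. -/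
lemma three_visits {h : D.HalfEdge} {i j k : ℕ} (hij : (C.step^[i] h).1 = (C.step^[j] h).1)
    (hik : (C.step^[i] h).1 = (C.step^[k] h).1) (h1 : C.step^[i] h ≠ C.step^[j] h)
    (h2 : C.step^[i] h ≠ C.step^[k] h) : C.step^[j] h = C.step^[k] h := by
  have h3 := C.iterate_ne_part (h := h) i j
  have h4 := C.iterate_ne_part (h := h) i k
  have h5 := C.iterate_ne_part (h := h) j k
  revert hij hik h1 h2 h3 h4 h5
  obtain ⟨v, x⟩ := C.step^[i] h
  obtain ⟨w, y⟩ := C.step^[j] h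
  obtain ⟨w', z⟩ := C.step^[k] h
  rintro rfl rfl
  simp only [part, ne_eq, Prod.mk.injEq, true_and]
  generalize C.transition v = T
  revert x y z
  cases T <;> simp only [Transition.partner] <;> decide

lemma tau_mark (v : D.Vertex) : (C.mark v).tau = (C.transition v).toKlein := by
  unfold mark
  cases C.transition v <;> dsimp only <;> split_ifs <;> rfl

/-- The definition of the mark tests just one of the two transitions not used by `C`. Knowing that
one is consistent and the other is not settles all cases. -/
lemma chi_mark {v : D.Vertex} {T T' : Transition} (h : T ≠ C.transition v)
    (h' : T' ≠ C.transition v) (hT : C.IsConsistent v T) (hT' : ¬ C.IsConsistent v T') :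
    (C.mark v).chi = T.toKlein := by
  unfold mark
  generalize C.transition v = U at *
  cases U <;> cases T <;> cases T' <;> first
    | exact absurd rfl h
    | exact absurd rfl h'
    | exact absurd hT hT'
    | (simp only [hT, hT', if_true, if_false]; rfl)

/-! ### The vector of a loop of a circuit -/

open scoped Classical in
/-- The indicator of the half-edges on an initial part of a tour. -/
noncomputable def loopLabel (h : D.HalfEdge) (m : ℕ) (g : D.HalfEdge) : ZMod 2 :=
  if ∃ k < m, g = C.step^[k] h ∨ g = edge (C.step^[k] h) then 1 else 0

lemma loopLabel_edge (h : D.HalfEdge) (m : ℕ) (g : D.HalfEdge) :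
    C.loopLabel h m (edge g) = C.loopLabel h m g := by
  have : (∃ k < m, edge g = C.step^[k] h ∨ edge g = edge (C.step^[k] h)) ↔
      ∃ k < m, g = C.step^[k] h ∨ g = edge (C.step^[k] h) := by
    refine exists_congr fun k => and_congr_right fun _ => ?_
    rw [or_comm, edge_injective.eq_iff]
    exact or_congr_right ⟨fun h => by rw [← h, edge_edge], fun h => by rw [h, edge_edge]⟩
  classical
  unfold loopLabel
  exact if_congr this rfl rfl

lemma loopLabel_part {h : D.HalfEdge} {m : ℕ} (hm : (C.step^[m] h).1 = h.1) {g : D.HalfEdge}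
    (hg : g.1 ≠ h.1) : C.loopLabel h m (C.part g) = C.loopLabel h m g := by
  have key : ∀ g : D.HalfEdge, g.1 ≠ h.1 →
      (∃ k < m, g = C.step^[k] h ∨ g = edge (C.step^[k] h)) →
      ∃ k < m, C.part g = C.step^[k] h ∨ C.part g = edge (C.step^[k] h) := by
    rintro g hg ⟨k, hk, rfl | rfl⟩
    · match k with
      | 0 => exact absurd rfl hg
      | k + 1 =>
        refine ⟨k, by omega, Or.inr ?_⟩
        rw [Function.iterate_succ_apply', part_step]
    · have h1 : C.part (edge (C.step^[k] h)) = C.step^[k + 1] h := by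
        rw [Function.iterate_succ_apply']; rfl
      refine ⟨k + 1, lt_of_le_of_ne hk ?_, Or.inl h1⟩
      rintro rfl
      rw [← h1] at hm
      exact hg hm
  have : (∃ k < m, C.part g = C.step^[k] h ∨ C.part g = edge (C.step^[k] h)) ↔
      ∃ k < m, g = C.step^[k] h ∨ g = edge (C.step^[k] h) :=
    ⟨fun H => by simpa only [part_part] using key (C.part g) hg H, key g hg⟩
  classical
  unfold loopLabel
  exact if_congr this rfl rfl

/-- The vector of transitions of an initial part of a tour. -/
noncomputable def loopVec (h : D.HalfEdge) (m : ℕ) : D.Vertex → Klein := fun w =>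
  Transition.klein fun x => C.loopLabel h m (w, x)

/-- By `symp_klein` the form is the sum over all half-edges of the products of the labels, and the
two halves of an edge contribute equal terms. -/
lemma form_eq_zero_of_edge {ρ : D.HalfEdge → ZMod 2} (hρ : ∀ g, ρ (edge g) = ρ g)
    (hρ' : ∀ w, ∑ x, ρ (w, x) = 0) {b : D.Vertex → Klein} (hb : b ∈ D.space) :
    form b (fun w => Transition.klein fun x => ρ (w, x)) = 0 := by
  classical
  rw [space, mem_gaussSpace] at hb
  obtain ⟨b, j, hj, rfl⟩ := hb
  have h1 : ∀ w, symp (gaussVec D.passageComp (D.position 0) b j w)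
      (Transition.klein fun x => ρ (w, x)) =
      ∑ x, halfLabel 0 b j (w, x) * ρ (w, x) := by
    intro w
    rw [← (klein_halfLabel 0 b j w).1]
    exact Transition.symp_klein (klein_halfLabel 0 b j w).2 (hρ' w)
  rw [form_apply]
  simp only [h1]
  rw [← Fintype.sum_prod_type (f := fun g : D.HalfEdge => halfLabel 0 b j g * ρ g)]
  refine Finset.sum_involution (fun g _ => edge g) ?_ ?_ (by simp) (fun g _ => edge_edge g)
  · intro g _
    rw [halfLabel_edge 0 b hj, hρ]
    exact zmod_add_self _
  · intro g _ _
    exact edge_ne g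

/-- The loop uses at its own vertex the half-edge by which it leaves and the one by which it
arrives; the transition pairing these two is the consistent one. At any other vertex it uses
half-edges together with their partners, which gives 0 or τ. -/
lemma loopVec_spec (h : D.HalfEdge) {m : ℕ} (hm0 : 0 < m) (hm : (C.step^[m] h).1 = h.1)
    (hne : C.step^[m] h ≠ h) (hmin : ∀ k, 0 < k → k < m → (C.step^[k] h).1 ≠ h.1) :
    C.loopVec h m ∈ D.space ∧ C.loopVec h m h.1 = (C.mark h.1).chi ∧
      (∀ w ≠ h.1, C.loopVec h m w = 0 ∨ C.loopVec h m w = (C.mark w).tau) := by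
  obtain ⟨v, x⟩ := h
  set y := (C.step^[m] (v, x)).2 with hy
  have hstep : C.step^[m] (v, x) = (v, y) := Prod.ext hm rfl
  rw [hstep] at hne
  have hyx : y ≠ x := fun h => hne (by rw [h])
  have hyx' : (C.transition v).partner x ≠ y := fun h =>
    C.step_ne_part m (v, x) (by rw [hstep, part, h])
  have hyx'' : (C.transition v).partner y ≠ x := fun h =>
    hyx' (by rw [← h, Transition.partner_partner])
  obtain ⟨T', T'', h1, h2, h3, h4, h5, h6⟩ := Transition.exists_partner_eq
    (T := C.transition v) (x := x) (z := (C.transition v).partner y) hyx''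
    (by rwa [Transition.partner_partner])
  rw [Transition.partner_partner] at h5 h6
  have hback := C.exists_step_symm ⟨m, hstep⟩
  have hT'' : ¬ C.IsConsistent v T'' := fun H => H x (by
    rw [C.reflTransGen_iff, h5]; exact ⟨m, hstep⟩)
  -- In each of the four positions of x', a tour through both half-edges of a pair of `T'`, combined
  -- with the known tours between x and y, would lead from a half-edge to its own partner.
  have hT' : C.IsConsistent v T' := by
    intro x' H
    rw [C.reflTransGen_iff] at H
    obtain ⟨k, hk⟩ := H
    obtain ⟨e, he⟩ := hback
    have h7 : T'.partner ((C.transition v).partner x) = y := by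
      rw [Transition.partner_comm, h4, Transition.partner_partner]
    have h8 : T'.partner y = (C.transition v).partner x := by
      rw [← h7, Transition.partner_partner]
    have h9 : T'.partner ((C.transition v).partner y) = x := by
      rw [← h4, Transition.partner_partner]
    rcases h6 x' with rfl | rfl | rfl | rfl
    · rw [h4] at hk
      exact C.step_ne_part (k + e) (v, y) (by rw [Function.iterate_add_apply, he, hk]; rfl)
    · rw [h9] at hk
      refine C.step_ne_part (m + k) (v, (C.transition v).partner y) ?_
      rw [Function.iterate_add_apply, hk, hstep, part, Transition.partner_partner]
    · rw [h7] at hk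
      refine C.step_ne_part (e + k) (v, (C.transition v).partner x) ?_
      rw [Function.iterate_add_apply, hk, he, part, Transition.partner_partner]
    · rw [h8] at hk
      exact C.step_ne_part (k + m) (v, x) (by rw [Function.iterate_add_apply, hstep, hk]; rfl)
  have hlabel : ∀ u, C.loopLabel (v, x) m (v, u) = if u = x ∨ u = T'.partner x then 1 else 0 := by
    intro u
    have : (∃ k < m, (v, u) = C.step^[k] (v, x) ∨ (v, u) = edge (C.step^[k] (v, x))) ↔
        u = x ∨ u = T'.partner x := by
      rw [h4]
      constructor
      · rintro ⟨k, hk, h | h⟩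
        · rcases Nat.eq_zero_or_pos k with rfl | hk0
          · exact Or.inl (congrArg Prod.snd h)
          · exact absurd (by rw [← h]) (hmin k hk0 hk)
        · have h7 : C.part (v, u) = C.step^[k + 1] (v, x) := by
            rw [h, Function.iterate_succ_apply']; rfl
          have h8 : k + 1 = m := by
            by_contra hkm
            exact hmin (k + 1) (by omega) (by omega) (by rw [← h7]; rfl)
          rw [h8, hstep] at h7
          right
          have h9 : (C.transition v).partner u = y := congrArg Prod.snd h7
          rw [← h9, Transition.partner_partner]
      · rintro (rfl | rfl)
        · exact ⟨0, hm0, Or.inl rfl⟩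
        · refine ⟨m - 1, by omega, Or.inr ?_⟩
          have h7 : C.step^[m - 1 + 1] (v, x) = (v, y) := by rw [Nat.sub_add_cancel hm0, hstep]
          rw [Function.iterate_succ_apply'] at h7
          rw [← C.part_step, h7, part]
    classical
    unfold loopLabel
    exact if_congr this rfl rfl
  have hv := Transition.klein_pair x hlabel
  have hother : ∀ w ≠ v, _ := fun w hw => Transition.klein_of_partner (T := C.transition w)
    (β := fun u => C.loopLabel (v, x) m (w, u)) fun u => C.loopLabel_part hm (g := (w, u)) hw
  refine ⟨?_, ?_, ?_⟩
  -- The loop is an edge labelling with even sums, so it is orthogonal to the whole space and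
  -- therefore belongs to it.
  · refine D.isLagrangian_space.mem_of_form fun b hb => ?_
    refine form_eq_zero_of_edge (C.loopLabel_edge _ _) (fun w => ?_) hb
    by_cases hw : w = v
    · subst hw; exact hv.1
    · exact (hother w hw).1
  · rw [C.chi_mark h1 h2 hT' hT'']; exact hv.2
  · intro w hw
    rw [C.tau_mark]
    exact (hother w hw).2

lemma iterate_injOn {h : D.HalfEdge} {m : ℕ}
    (hmin : ∀ k, 0 < k → k < m → (C.step^[k] h).1 ≠ h.1) :
    Set.InjOn (fun k => C.step^[k] h) (Set.Iio m) := by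
  have key : ∀ i j, i < j → j < m → C.step^[i] h ≠ C.step^[j] h := by
    intro i j hij hj H
    obtain ⟨e, rfl⟩ := Nat.exists_eq_add_of_le hij.le
    rw [Function.iterate_add_apply] at H
    exact hmin e (by omega) (by omega) (by rw [← C.step_injective.iterate i H])
  intro i hi j hj H
  rcases lt_trichotomy i j with h1 | h1 | h1
  · exact absurd H (key i j h1 hj)
  · exact h1
  · exact absurd H.symm (key j i h1 hi)

/-- Labels around w: all zero if the loop misses w, all one if it passes twice, and one on a single
pair of partners if it passes once. Only in the last case are they not constant. -/
lemma loopVec_ne_zero_iff {h : D.HalfEdge} {m : ℕ} (hm : (C.step^[m] h).1 = h.1)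
    (hmin : ∀ k, 0 < k → k < m → (C.step^[k] h).1 ≠ h.1) {w : D.Vertex} (hw : w ≠ h.1) :
    C.loopVec h m w ≠ 0 ↔ ∃ i, 0 < i ∧ i < m ∧ (C.step^[i] h).1 = w ∧
      ∀ k, 0 < k → k < m → (C.step^[k] h).1 = w → k = i := by
  have hinj := C.iterate_injOn hmin
  have hpart := Transition.klein_of_partner (T := C.transition w)
    (β := fun u => C.loopLabel h m (w, u)) fun u => C.loopLabel_part hm (g := (w, u)) hw
  have hlabel : ∀ u, C.loopLabel h m (w, u) = 1 ↔
      ∃ k, 0 < k ∧ k < m ∧ ((w, u) = C.step^[k] h ∨ C.part (w, u) = C.step^[k] h) := by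
    intro u
    have : C.loopLabel h m (w, u) = 1 ↔
        ∃ k < m, (w, u) = C.step^[k] h ∨ (w, u) = edge (C.step^[k] h) := by
      unfold loopLabel
      split_ifs with h0 <;> simp only [h0, zero_ne_one]
    rw [this]
    constructor
    · rintro ⟨k, hk, h1 | h1⟩
      · refine ⟨k, Nat.pos_of_ne_zero ?_, hk, Or.inl h1⟩
        rintro rfl
        exact hw (congrArg Prod.fst h1)
      · have h2 : C.part (w, u) = C.step^[k + 1] h := by
          rw [h1, Function.iterate_succ_apply']; rfl
        refine ⟨k + 1, by omega, lt_of_le_of_ne hk ?_, Or.inr h2⟩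
        rintro rfl
        rw [← h2] at hm
        exact hw hm
    · rintro ⟨k, hk0, hk, h1 | h1⟩
      · exact ⟨k, hk, Or.inl h1⟩
      · refine ⟨k - 1, by omega, Or.inr ?_⟩
        have h2 : C.step (C.step^[k - 1] h) = C.step^[k] h := by
          rw [← Function.iterate_succ_apply' C.step, Nat.succ_eq_add_one, Nat.sub_add_cancel hk0]
        rw [← C.part_step, h2, ← h1, part_part]
  constructor
  · intro hne
    by_cases hvis : ∃ i, 0 < i ∧ i < m ∧ (C.step^[i] h).1 = w
    · obtain ⟨i, hi0, him, hi⟩ := hvis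
      refine ⟨i, hi0, him, hi, ?_⟩
      intro k hk0 hkm hk
      by_contra hki
      apply hne
      have hne' : C.step^[k] h ≠ C.step^[i] h := fun H => hki (hinj hkm him H)
      have hne'' := C.iterate_ne_part (h := h) k i
      have hall : ∀ u, C.loopLabel h m (w, u) = 1 := by
        intro u
        rw [hlabel]
        have : (w, u) = C.step^[i] h ∨ C.part (w, u) = C.step^[i] h ∨
            (w, u) = C.step^[k] h ∨ C.part (w, u) = C.step^[k] h := by
          clear hlabel hpart hmin hinj hm hne
          clear hw
          revert hi hk hne' hne''
          obtain ⟨w', y⟩ := C.step^[i] h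
          obtain ⟨w'', z⟩ := C.step^[k] h
          rintro rfl rfl
          simp only [part, ne_eq, Prod.mk.injEq, true_and]
          generalize C.transition _ = T
          revert u y z
          cases T <;> simp only [Transition.partner] <;> decide
        rcases this with h1 | h1 | h1 | h1
        exacts [⟨i, hi0, him, Or.inl h1⟩, ⟨i, hi0, him, Or.inr h1⟩, ⟨k, hk0, hkm, Or.inl h1⟩,
          ⟨k, hk0, hkm, Or.inr h1⟩]
      rw [loopVec]
      simp only [hall]
      decide
    · exfalso
      apply hne
      have hall : ∀ u, C.loopLabel h m (w, u) = 0 := by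
        intro u
        rcases ZMod.two_cases (C.loopLabel h m (w, u)) with h1 | h1
        · exact h1
        · obtain ⟨k, hk0, hkm, h2⟩ := (hlabel u).1 h1
          exact absurd ⟨k, hk0, hkm, by rcases h2 with h2 | h2 <;> rw [← h2]; rfl⟩ hvis
      rw [loopVec]
      simp only [hall]
      decide
  · rintro ⟨i, hi0, him, hi, huniq⟩ hzero
    have hconst := Transition.const_of_klein hpart.1 hzero
    set u := (C.step^[i] h).2 with hu
    have hiu : C.step^[i] h = (w, u) := Prod.ext hi rfl
    have h1 : ∀ y, C.loopLabel h m (w, y) = 1 := fun y =>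
      (hconst y u).trans ((hlabel u).2 ⟨i, hi0, him, Or.inl hiu.symm⟩)
    have h2 : ∀ y, y = u ∨ (C.transition w).partner y = u := by
      intro y
      obtain ⟨k, hk0, hkm, h3⟩ := (hlabel y).1 (h1 y)
      have hkw : (C.step^[k] h).1 = w := by rcases h3 with h3 | h3 <;> rw [← h3]; rfl
      rw [huniq k hk0 hkm hkw, hiu] at h3
      exact h3.imp (congrArg Prod.snd) (congrArg Prod.snd)
    revert h2
    clear_value u
    generalize C.transition w = T
    clear * -
    revert u
    cases T <;> simp only [Transition.partner] <;> decide

/-! ### The marked interlacement graph -/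

/-- The circuit returns to w, and since w occurs only once inside the loop this happens after the
return to the starting vertex. -/
lemma alternates_of_visit {h : D.HalfEdge} {m i : ℕ} (hm : (C.step^[m] h).1 = h.1)
    (hne : C.step^[m] h ≠ h)
    (hmin : ∀ k, 0 < k → k < m → (C.step^[k] h).1 ≠ h.1) {w : D.Vertex} (hw : w ≠ h.1)
    (hi0 : 0 < i) (him : i < m) (hi : (C.step^[i] h).1 = w)
    (huniq : ∀ k, 0 < k → k < m → (C.step^[k] h).1 = w → k = i) : C.Alternates h.1 w := by
  obtain ⟨e, he0, he, hene, hemin⟩ := C.exists_first_return (C.step^[i] h)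
  rw [hi] at he hemin
  rw [← Function.iterate_add_apply] at he hene
  have hei : m < e + i := by
    rcases lt_trichotomy (e + i) m with h1 | h1 | h1
    · have := huniq (e + i) (by omega) h1 he
      omega
    · rw [h1, hm] at he
      exact absurd he.symm hw
    · exact h1
  refine ⟨fun k => C.step^[k] h, i, m, e + i, fun k => ?_, hi0, him, hei, ?_, rfl, hi, hm, he⟩
  · exact (C.follows_iff).2 (Function.iterate_succ_apply' _ _ _)
  -- If the tour closed up after p steps, the second visit to w would coincide with a visit inside
  -- the loop, hence with the first visit to w, contrary to `hene`.
  have key : ∀ p, 0 < p → p ≤ e + i → C.step^[p] h ≠ h := by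
    intro p hp hpe H
    have hpm : m < p := by
      rcases lt_trichotomy p m with h1 | h1 | h1
      · exact absurd (by rw [H]) (hmin p hp h1)
      · exact absurd (h1 ▸ H) hne
      · exact h1
    have h2 : C.step^[p + i] h = C.step^[i] h := by
      rw [add_comm, Function.iterate_add_apply, H]
    have h3 : ¬ p < e := fun hlt => hemin p hp hlt (by
      rw [← Function.iterate_add_apply, h2, hi])
    obtain ⟨q, hq⟩ := Nat.exists_eq_add_of_le hpe
    have h4 : C.step^[q] h = C.step^[e + i] h := by
      rw [hq, add_comm, Function.iterate_add_apply, H]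
    have h5 : q = i := by
      refine huniq q (Nat.pos_of_ne_zero ?_) (by omega) (by rw [h4, he])
      rintro rfl
      rw [← h4] at he
      exact hw he.symm
    exact hene (by rw [← h4, h5])
  have key' : ∀ a b, a < b → b ≤ e + i → C.step^[a] h ≠ C.step^[b] h := by
    intro a b hab hb H
    obtain ⟨p, rfl⟩ := Nat.exists_eq_add_of_le hab.le
    rw [Function.iterate_add_apply] at H
    exact key p (by omega) (by omega) (C.step_injective.iterate a H).symm
  intro a ha b hb H
  rcases lt_trichotomy a b with h1 | h1 | h1
  · exact absurd H (key' a b h1 hb)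
  · exact h1
  · exact absurd H.symm (key' b a h1 ha)

/-- By `three_visits` a tour with distinct half-edges meets each vertex at most twice. So times 0
and j are all the visits to v, and times i and k are all the visits to w. -/
lemma visit_of_alternates {v w : D.Vertex} (hA : C.Alternates v w) :
    ∃ (h : D.HalfEdge) (m i : ℕ), h.1 = v ∧ 0 < m ∧ (C.step^[m] h).1 = v ∧ C.step^[m] h ≠ h ∧
      (∀ k, 0 < k → k < m → (C.step^[k] h).1 ≠ v) ∧
      0 < i ∧ i < m ∧ (C.step^[i] h).1 = w ∧
      ∀ k, 0 < k → k < m → (C.step^[k] h).1 = w → k = i := by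
  obtain ⟨s, i, j, k, hs, hi0, hij, hjk, hinj, h0, hi, hj, hk⟩ := hA
  have hit : ∀ m, C.step^[m] (s 0) = s m := by
    intro m
    induction m with
    | zero => rfl
    | succ m ih => rw [Function.iterate_succ_apply', ih, (C.follows_iff).1 (hs m)]
  have hI : ∀ a b, a ≤ k → b ≤ k → a ≠ b → s a ≠ s b := fun a b ha hb hab H => hab (hinj ha hb H)
  have h3 : ∀ a b c, (s a).1 = (s b).1 → (s a).1 = (s c).1 → s a ≠ s b → s a ≠ s c → s b = s c := by
    intro a b c
    rw [← hit a, ← hit b, ← hit c]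
    exact C.three_visits
  refine ⟨s 0, j, i, h0, by omega, by rw [hit, hj], by
    rw [hit]; exact hI j 0 (by omega) (by omega) (by omega), ?_, hi0, hij, by rw [hit, hi], ?_⟩
  · intro m hm0 hmj
    rw [hit]
    intro hm
    exact hI m j (by omega) (by omega) (by omega) (h3 0 m j (by rw [h0, hm]) (by rw [h0, hj])
      (hI 0 m (by omega) (by omega) (by omega)) (hI 0 j (by omega) (by omega) (by omega)))
  · intro m hm0 hmj
    rw [hit]
    intro hm
    by_contra hmi
    exact hI m k (by omega) (by omega) (by omega) (h3 i m k (by rw [hi, hm]) (by rw [hi, hk])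
      (hI i m (by omega) (by omega) (Ne.symm hmi)) (hI i k (by omega) (by omega) (by omega)))

/-- A labelling whose vector has entries in {0, τ} is constant along the circuits of `C`. Each
circuit covers a whole component, so the four labels at every vertex agree. -/
lemma eq_zero_of_inEuler {a : D.Vertex → Klein} (ha : a ∈ D.space) (h : InEuler C.mark a) :
    a = 0 := by
  rw [space, mem_gaussSpace] at ha
  obtain ⟨b, j, hj, rfl⟩ := ha
  have hinv : ∀ g g', Relation.EqvGen (fun g g' : D.HalfEdge =>
      D.IsEdge g g' ∨ g' = (g.1, (C.transition g.1).partner g.2)) g g' →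
      halfLabel 0 b j g = halfLabel 0 b j g' := by
    intro g g' H
    induction H with
    | rel x y h1 =>
      rcases h1 with h1 | rfl
      · rw [isEdge_iff] at h1
        rw [← h1, halfLabel_edge 0 b hj]
      · obtain ⟨v, x⟩ := x
        have h2 := klein_halfLabel 0 b j v
        refine (Transition.partner_of_klein (T := C.transition v)
          (β := fun x => halfLabel 0 b j (v, x)) h2.2 ?_ x).symm
        rw [h2.1, ← C.tau_mark]
        exact h v
    | refl x => rfl
    | symm x y _ ih => exact ih.symm
    | trans x y z _ _ h1 h2 => exact h1.trans h2
  funext v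
  have h2 := klein_halfLabel 0 b j v
  rw [← h2.1]
  have h3 : ∀ x y, halfLabel 0 b j (v, x) = halfLabel 0 b j (v, y) := fun x y =>
    hinv _ _ (C.euler _ _ (.rel _ _ (Or.inr rfl)))
  rw [Transition.klein, h3 (true, true) (false, false), h3 (true, false) (false, false)]
  exact Prod.ext (zmod_add_self _) (zmod_add_self _)

/-- The fundamental vectors of the interlacement graph are the vectors of the loops of the circuits.
-/
theorem rep : Rep C.interlacement C.mark D.space := by
  have hloop : ∀ h : D.HalfEdge, ∃ m, 0 < m ∧ (C.step^[m] h).1 = h.1 ∧ C.step^[m] h ≠ h ∧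
    ∀ k, 0 < k → k < m → (C.step^[k] h).1 ≠ h.1 := C.exists_first_return
  choose m hm0 hm hne hmin using hloop
  -- Two loops at one vertex have the same vector, since their sum has entries in {0, τ}. So the
  -- vector does not depend on the starting half-edge supplied by `Alternates`.
  have huniq : ∀ (h : D.HalfEdge) (m' : ℕ), 0 < m' → (C.step^[m'] h).1 = h.1 →
      C.step^[m'] h ≠ h → (∀ k, 0 < k → k < m' → (C.step^[k] h).1 ≠ h.1) →
      C.loopVec h m' = C.loopVec (h.1, (true, true)) (m (h.1, (true, true))) := by
    intro h m' h0 h1 h2 h3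
    obtain ⟨h4, h5, h6⟩ := C.loopVec_spec h h0 h1 h2 h3
    obtain ⟨h7, h8, h9⟩ := C.loopVec_spec _ (hm0 (h.1, (true, true))) (hm _) (hne _) (hmin _)
    have := C.eq_zero_of_inEuler (D.space.add_mem h4 h7) (by
      intro w
      rw [Pi.add_apply]
      by_cases hw : w = h.1
      · subst hw
        left
        rw [h5]
        erw [h8]
        exact Klein.add_self _
      · rcases h6 w hw with e1 | e1 <;> rcases h9 w hw with e2 | e2 <;> rw [e1, e2] <;>
          simp [Klein.add_self])
    exact eq_of_add_eq_zero this
  set A : D.Vertex → D.Vertex → Klein := fun v =>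
    C.loopVec (v, (true, true)) (m (v, (true, true))) with hA
  have hspec : ∀ v, A v ∈ D.space ∧ A v v = (C.mark v).chi ∧
      (∀ w ≠ v, A v w = 0 ∨ A v w = (C.mark w).tau) := fun v =>
    C.loopVec_spec _ (hm0 _) (hm _) (hne _) (hmin _)
  have halt : ∀ v w, w ≠ v → (A v w ≠ 0 ↔ C.Alternates v w) := by
    intro v w hw
    constructor
    · intro h
      obtain ⟨i, hi0, him, hi, hiu⟩ := (C.loopVec_ne_zero_iff (hm _) (hmin _)
        (h := (v, (true, true))) hw).1 h
      exact C.alternates_of_visit (hm _) (hne _) (hmin _) hw hi0 him hi hiu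
    · intro h
      obtain ⟨g, m', i, rfl, h0, h1, h2, h3, hi0, him, hi, hiu⟩ := C.visit_of_alternates h
      simp only [hA]
      rw [← huniq g m' h0 h1 h2 h3]
      exact (C.loopVec_ne_zero_iff h1 h3 hw).2 ⟨i, hi0, him, hi, hiu⟩
  -- Interlacement is symmetric because the space is isotropic: a nonzero entry on one side only
  -- would make the form equal to 1.
  have hsymm : ∀ v w, w ≠ v → A v w ≠ 0 → A w v ≠ 0 := by
    classical
    intro v w hw h h'
    have hz := D.isLagrangian_space.form_eq_zero (hspec v).1 (hspec w).1
    rw [form_apply, Finset.sum_eq_single w] at hz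
    · rw [(hspec w).2.1, ((hspec v).2.2 w hw).resolve_left h, symp_comm, Mark.symp_chi_tau] at hz
      exact one_ne_zero hz
    · intro x _ hx
      by_cases hxv : x = v
      · subst hxv; rw [h', symp_zero_right]
      · rcases (hspec v).2.2 x hxv with e1 | e1 <;> rcases (hspec w).2.2 x hx with e2 | e2 <;>
          rw [e1, e2] <;> simp
    · simp
  refine ⟨fun v => ?_, fun a ha h => C.eq_zero_of_inEuler ha h⟩
  convert (hspec v).1 using 1
  funext w
  by_cases hw : w = v
  · subst hw; rw [fund_self, (hspec w).2.1]
  · have hadj : C.interlacement.Adj v w ↔ A v w ≠ 0 := by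
      rw [interlacement, SimpleGraph.fromRel_adj]
      constructor
      · rintro ⟨_, h | h⟩
        · exact (halt v w hw).2 h
        · exact hsymm w v (Ne.symm hw) ((halt w v (Ne.symm hw)).2 h)
      · intro h
        exact ⟨Ne.symm hw, Or.inl ((halt v w hw).1 h)⟩
    by_cases h : C.interlacement.Adj v w
    · rw [fund_adj h, ((hspec v).2.2 w hw).resolve_left (hadj.1 h)]
    · rw [fund_not_adj hw h]
      by_contra h0
      exact h (hadj.2 (Ne.symm h0))

end EulerSystem

theorem obtainable_of_equiv {D D' : LinkDiagram n} (h : D.toState.Equiv D'.toState)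
    (C : D.EulerSystem) (C' : D'.EulerSystem) :
    MarkedGraph.ObtainableFrom (D'.markedInterlacementGraph C') (D.markedInterlacementGraph C) :=
  h.1 C.interlacement C.mark C'.interlacement C'.mark C.rep C'.rep

end LinkDiagram

/-! ### The components of the universe graph -/

section Quot

variable {α : Type} {r r' : α → α → Prop} {i i' : α}

/-- The indicator of a class separates it from the others. This links counting components to
labellings by ℤ/2. -/
lemma quot_mk_eq_iff {a b : α} : Quot.mk r a = Quot.mk r b ↔
    ∀ c : α → ZMod 2, (∀ x y, r x y → c x = c y) → c a = c b := by
  classical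
  constructor
  · intro h c hc
    exact congrArg (Quot.lift c hc) h
  · intro h
    have := h (fun x => if Quot.mk r a = Quot.mk r x then 1 else 0) (fun x y hxy => by
      rw [Quot.sound hxy])
    simpa using this

/-- Adding one pair to a relation whose classes already agree does not change the quotient. -/
lemma card_quot_of_eq (h1 : ∀ a b, r a b → r' a b)
    (h2 : ∀ a b, r' a b → r a b ∨ a = i ∧ b = i' ∨ a = i' ∧ b = i)
    (h : Quot.mk r i = Quot.mk r i') : Nat.card (Quot r) = Nat.card (Quot r') := by
  refine Nat.card_congr ⟨Quot.map id h1, Quot.lift (Quot.mk r) ?_, ?_, ?_⟩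
  · intro a b hab
    rcases h2 a b hab with h3 | ⟨rfl, rfl⟩ | ⟨rfl, rfl⟩
    exacts [Quot.sound h3, h, h.symm]
  · rintro ⟨a⟩; rfl
  · rintro ⟨a⟩; rfl

/-- Adding one pair to a relation identifies two different classes. -/
lemma card_quot_of_ne [Finite α] (h1 : ∀ a b, r a b → r' a b)
    (h2 : ∀ a b, r' a b → r a b ∨ a = i ∧ b = i' ∨ a = i' ∧ b = i)
    (h3 : r' i i' ∨ r' i' i) (h : Quot.mk r i ≠ Quot.mk r i') :
    Nat.card (Quot r) = Nat.card (Quot r') + 1 := by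
  classical
  have h3' : Quot.mk r' i = Quot.mk r' i' := h3.elim (fun h => Quot.sound h)
    fun h => (Quot.sound h).symm
  let g : α → {q : Quot r // q ≠ Quot.mk r i'} := fun a =>
    if ha : Quot.mk r a = Quot.mk r i' then ⟨Quot.mk r i, h⟩ else ⟨Quot.mk r a, ha⟩
  have hg : ∀ a b, r' a b → g a = g b := by
    intro a b hab
    rcases h2 a b hab with h4 | ⟨rfl, rfl⟩ | ⟨rfl, rfl⟩
    · simp only [g, Quot.sound h4]
    · simp [g, h]
    · simp [g, h]
  have e : Quot r' ≃ {q : Quot r // q ≠ Quot.mk r i'} := by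
    refine ⟨Quot.lift g hg, fun q => Quot.map id h1 q.1, ?_, ?_⟩
    · rintro ⟨a⟩
      change Quot.map id h1 (g a).1 = Quot.mk r' a
      simp only [g]
      split_ifs with ha
      · change Quot.mk r' i = _
        rw [h3']
        exact (congrArg (Quot.map id h1) ha).symm
      · rfl
    · rintro ⟨⟨a⟩, ha⟩
      change g a = _
      simp only [g]
      rw [dif_neg ha]
  rw [Nat.card_congr e, Nat.card_congr (Equiv.optionSubtypeNe (Quot.mk r i')).symm,
    Finite.card_option]

end Quot

namespace LinkDiagram

open Isotropic Gauss

variable {n : ℕ} (D : LinkDiagram n)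

/-- Two link components cross each other in a classical crossing. -/
def Meets (i i' : Fin n) : Prop := ∃ x ∈ D.crossings, x.1.1 = i ∧ x.2.1 = i'

/-- Two vertices are joined by an edge. -/
def Joined (x y : D.Vertex) : Prop := ∃ h h' : D.HalfEdge, D.IsEdge h h' ∧ h.1 = x ∧ h'.1 = y

variable {D}

lemma joined_of_isNextPassage {p q : D.Passage} (h : D.IsNextPassage p q) : D.Joined p.1 q.1 :=
  ⟨_, _, ⟨p, q, h, Or.inl ⟨rfl, rfl⟩⟩, rfl, rfl⟩

/-- Take the last passage not beyond q whose vertex is in the class of p. If it were not q, its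
successor would be a later one. -/
lemma joined_of_le {p q : D.Passage} (h : D.passageComp p = D.passageComp q)
    (hle : D.position 0 p ≤ D.position 0 q) : Quot.mk D.Joined p.1 = Quot.mk D.Joined q.1 := by
  classical
  obtain ⟨m, hm, hmax⟩ := Finset.exists_max_image (Finset.univ.filter fun m : D.Passage =>
    D.passageComp m = D.passageComp q ∧ Quot.mk D.Joined p.1 = Quot.mk D.Joined m.1 ∧
      D.position 0 m ≤ D.position 0 q) (D.position 0) ⟨p, by simp [h, hle]⟩
  simp only [Finset.mem_filter, Finset.mem_univ, true_and] at hm hmax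
  obtain ⟨hm1, hm2, hm3⟩ := hm
  by_cases hmq : m = q
  · rw [hm2, hmq]
  exfalso
  have hlt : D.position 0 m < D.position 0 q :=
    lt_of_le_of_ne hm3 fun h => hmq (D.position_injective 0 m q hm1 h)
  obtain ⟨r, hr⟩ := exists_isNextPassage m
  obtain ⟨i, s, e, he, hp, hq, hn⟩ := id hr
  have hs : ((D.position 0 m : ℝ) : UnitAddCircle) = s := by
    rw [position, coe_circleRep, hp]
  have hi : D.passageComp m = i := by rw [passageComp, hp]
  have hle' : e ≤ D.position 0 q - D.position 0 m := by
    by_contra hlt'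
    refine hn _ ⟨sub_pos.2 hlt, not_le.1 hlt'⟩ q (Prod.ext (hm1.symm.trans hi) ?_)
    rw [AddCircle.coe_add, ← hs, ← AddCircle.coe_add, add_sub_cancel, position, coe_circleRep]
  have hmem := D.position_mem 0 q
  have hmem' := D.position_mem 0 m
  simp only [Pi.zero_apply, zero_add, Set.mem_Ico] at hmem hmem'
  have hpos : D.position 0 r = D.position 0 m + e := by
    conv_lhs => rw [position, hq]
    simp only
    rw [AddCircle.coe_add, ← hs, ← AddCircle.coe_add]
    refine circleRep_coe ?_
    simp only [Pi.zero_apply, zero_add, Set.mem_Ico]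
    constructor <;> linarith
  have := hmax r ⟨by rw [passageComp, hq, hm1.symm.trans hi],
    hm2.trans (Quot.sound (joined_of_isNextPassage hr)), by rw [hpos]; linarith⟩
  rw [hpos] at this
  linarith

lemma joined_of_passageComp {p q : D.Passage} (h : D.passageComp p = D.passageComp q) :
    Quot.mk D.Joined p.1 = Quot.mk D.Joined q.1 :=
  (le_total (D.position 0 p) (D.position 0 q)).elim (joined_of_le h)
    fun hle => (joined_of_le h.symm hle).symm

/-- All vertices on one link component lie in one class, so classes of vertices correspond to
classes of link components with crossings. Each link component without crossings is a class by
itself and accounts for one free loop. -/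
lemma componentCount_eq : D.componentCount = Nat.card (Quot D.Meets) := by
  classical
  have hmeets : ∀ (v : D.Vertex) (b c : Bool), Quot.mk D.Meets (D.passageComp (v, b)) =
      Quot.mk D.Meets (D.passageComp (v, c)) := by
    intro v
    have h : Quot.mk D.Meets (D.passageComp (v, true)) =
      Quot.mk D.Meets (D.passageComp (v, false)) := Quot.sound ⟨v.1, v.2, rfl, rfl⟩
    rintro (_ | _) (_ | _)
    exacts [rfl, h.symm, h, rfl]
  have hfree : ∀ i, (¬ ∃ p : D.Passage, D.passageComp p = i) ↔
      ∀ s : UnitAddCircle, ¬ D.IsPassage (i, s) := by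
    intro i
    constructor
    · rintro h s ⟨x, hx, h1 | h1⟩
      · exact h ⟨(⟨x, hx⟩, true), by simp [passageComp, passageParam, ← h1]⟩
      · exact h ⟨(⟨x, hx⟩, false), by simp [passageComp, passageParam, ← h1]⟩
    · rintro h ⟨⟨⟨x, hx⟩, b⟩, rfl⟩
      refine h (D.passageParam (⟨x, hx⟩, b)).2 ⟨x, hx, ?_⟩
      cases b <;> simp [passageComp, passageParam]
  let F : Quot D.Joined → Quot D.Meets := Quot.lift
    (fun v => Quot.mk D.Meets (D.passageComp (v, true))) (by
      rintro x y ⟨h, h', hh, rfl, rfl⟩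
      have : ∀ {p q : D.Passage}, D.IsNextPassage p q → D.passageComp p = D.passageComp q := by
        rintro p q ⟨i, s, e, -, hp, hq, -⟩
        rw [passageComp, passageComp, hp, hq]
      change Quot.mk D.Meets (D.passageComp (h.1, true)) =
        Quot.mk D.Meets (D.passageComp (h'.1, true))
      obtain ⟨p, q, hpq, ⟨rfl, rfl⟩ | ⟨rfl, rfl⟩⟩ := hh
      · have h1 := this hpq
        exact (hmeets _ _ p.2).trans ((congrArg (Quot.mk D.Meets) h1).trans (hmeets _ q.2 _))
      · have h1 := this hpq
        exact (hmeets _ _ q.2).trans ((congrArg (Quot.mk D.Meets) h1.symm).trans (hmeets _ p.2 _)))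
  let G : Fin n → Quot D.Joined ⊕ {i : Fin n // ∀ s : UnitAddCircle, ¬ D.IsPassage (i, s)} :=
    fun i => if h : ∃ p : D.Passage, D.passageComp p = i then .inl (Quot.mk _ h.choose.1)
      else .inr ⟨i, (hfree i).1 h⟩
  have hG : ∀ p : D.Passage, G (D.passageComp p) = .inl (Quot.mk _ p.1) := by
    intro p
    have h : ∃ q : D.Passage, D.passageComp q = D.passageComp p := ⟨p, rfl⟩
    simp only [G]
    rw [dif_pos h]
    exact congrArg _ (joined_of_passageComp h.choose_spec)
  change Nat.card (Quot D.Joined) + _ = _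
  rw [← Nat.card_sum]
  refine Nat.card_congr ⟨Sum.elim F fun i => Quot.mk _ i.1, Quot.lift G ?_, ?_, ?_⟩
  · rintro i i' ⟨x, hx, rfl, rfl⟩
    have h1 := hG (⟨x, hx⟩, true)
    have h2 := hG (⟨x, hx⟩, false)
    exact h1.trans h2.symm
  · rintro (v | ⟨i, hi⟩)
    · obtain ⟨v, rfl⟩ := Quot.exists_rep v
      exact hG (v, true)
    · change G i = _
      simp only [G]
      rw [dif_neg ((hfree i).2 hi)]
  · rintro ⟨i⟩
    change Sum.elim F _ (G i) = _
    by_cases h : ∃ p : D.Passage, D.passageComp p = i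
    · obtain ⟨p, rfl⟩ := h
      rw [hG]
      exact hmeets p.1 true p.2
    · simp only [G]
      rw [dif_neg h]
      rfl

lemma componentCount_pos (v : D.Vertex) : 0 < D.componentCount := by
  rw [componentCount_eq]
  have : Nonempty (Quot D.Meets) := ⟨Quot.mk _ v.1.1.1⟩
  exact Nat.card_pos

/-- A vector with only straight entries comes from a labelling without jumps, that is, a coloring of
the link components by ℤ/2. The colors must differ at v and w and agree at all other crossings,
which is possible exactly if the two strands at v belong to different classes once v and w are
ignored. -/
lemma pair_s_mem_iff {v w : D.Vertex} (hvw : v ≠ w)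
    (hw : ∀ b : Fin n → ZMod 2, b w.1.1.1 + b w.1.2.1 = b v.1.1.1 + b v.1.2.1)
    {r : Fin n → Fin n → Prop}
    (hr : ∀ i i', r i i' ↔ ∃ x ∈ D.crossings, x ≠ v.1 ∧ x ≠ w.1 ∧ x.1.1 = i ∧ x.2.1 = i') :
    pair v w s ∈ D.space ↔ Quot.mk r v.1.1.1 ≠ Quot.mk r v.1.2.1 := by
  classical
  have hvec : ∀ (b : Fin n → ZMod 2) (x : D.Vertex),
      gaussVec D.passageComp (D.position 0) b 0 x = (b x.1.1.1 + b x.1.2.1, 0) := by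
    intro b x
    simp [gaussVec, inVal, passageComp, passageParam]
  have hs : s = ((1, 0) : Klein) := rfl
  rw [space, mem_gaussSpace, Ne, quot_mk_eq_iff]
  push Not
  constructor
  · rintro ⟨b, j, hj, h⟩
    have hj0 : j = 0 := by
      funext x
      rw [← gaussVec_snd (κ := D.passageComp) (t := D.position 0) b j x, h]
      by_cases hxv : x = v
      · subst hxv; rw [pair_left hvw]; rfl
      · by_cases hxw : x = w
        · subst hxw; rw [pair_right hvw]; rfl
        · rw [pair_ne hxv hxw]; rfl
    subst hj0
    have hx := fun x => (hvec b x).symm.trans (congrFun h x)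
    refine ⟨b, ?_, ?_⟩
    · intro i i' hii
      obtain ⟨x, hx0, hxv, hxw, rfl, rfl⟩ := (hr i i').1 hii
      have := hx ⟨x, hx0⟩
      rw [pair_ne (fun h => hxv (congrArg Subtype.val h)) fun h => hxw (congrArg Subtype.val h)]
        at this
      have h1 : b x.1.1 + b x.2.1 = 0 := congrArg Prod.fst this
      exact (show ∀ x y : ZMod 2, x + y = 0 → x = y by decide) _ _ h1
    · intro h1
      have := hx v
      rw [pair_left hvw] at this
      have h2 : b v.1.1.1 + b v.1.2.1 = 1 := congrArg Prod.fst this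
      rw [h1, zmod_add_self] at h2
      exact zero_ne_one h2
  · rintro ⟨b, hb, hne⟩
    have h1 : b v.1.1.1 + b v.1.2.1 = 1 :=
      (show ∀ x y : ZMod 2, x ≠ y → x + y = 1 by decide) _ _ hne
    refine ⟨b, 0, ?_, ?_⟩
    · funext i; simp [totalJump]
    · funext x
      rw [hvec]
      by_cases hxv : x = v
      · subst hxv; rw [pair_left hvw, h1, hs]
      · by_cases hxw : x = w
        · subst hxw; rw [pair_right hvw, hw, h1, hs]
        · rw [pair_ne hxv hxw, hb x.1.1.1 x.1.2.1 ((hr _ _).2 ⟨x.1, x.2,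
            fun h => hxv (Subtype.ext h), fun h => hxw (Subtype.ext h), rfl, rfl⟩), zmod_add_self]
          rfl

end LinkDiagram

/-! ### Plane geometry -/

lemma planeDet_map (A : ℂ →L[ℝ] ℂ) (u v : ℂ) :
    planeDet (A u) (A v) = A.det * planeDet u v := by
  have hA : ∀ z : ℂ, A z = z.re • A 1 + z.im • A Complex.I := by
    intro z
    conv_lhs => rw [← Complex.re_add_im z, mul_comm]
    have h1 : ((z.re : ℂ)) = z.re • (1 : ℂ) := by simp
    have h2 : Complex.I * (z.im : ℂ) = z.im • Complex.I := by
      rw [Complex.real_smul, mul_comm]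
    rw [map_add, h2, h1, map_smul, map_smul]
  have hdet : A.det = planeDet (A 1) (A Complex.I) := by
    rw [ContinuousLinearMap.det, ← LinearMap.det_toMatrix Complex.basisOneI, Matrix.det_fin_two]
    simp [LinearMap.toMatrix_apply, planeDet]
    ring
  rw [hdet, hA u, hA v]
  simp only [planeDet, Complex.add_re, Complex.add_im, Complex.real_smul, Complex.mul_re,
    Complex.mul_im, Complex.ofReal_re, Complex.ofReal_im]
  ring

lemma planeDet_smul (a b : ℝ) (u v : ℂ) : planeDet (a • u) (b • v) = a * b * planeDet u v := by
  simp only [planeDet, Complex.real_smul, Complex.mul_re, Complex.mul_im, Complex.ofReal_re,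
    Complex.ofReal_im]
  ring

lemma mul_neg_iff_neg_of_pos {a b : ℝ} (hb : 0 < b) : a * b < 0 ↔ a < 0 :=
  ⟨fun h => by_contra fun h' => absurd h (not_lt.2 (mul_nonneg (not_lt.1 h') hb.le)),
    fun h => mul_neg_of_neg_of_pos h hb⟩

namespace IsPlaneDiffeo

variable {φ : ℂ ≃ ℂ}

lemma differentiableAt (h : IsPlaneDiffeo φ) (z : ℂ) : DifferentiableAt ℝ φ z :=
  h.1.contDiffAt.differentiableAt (by simp)

lemma det_ne_zero (h : IsPlaneDiffeo φ) (z : ℂ) : (fderiv ℝ φ z).det ≠ 0 := by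
  have h1 : DifferentiableAt ℝ φ.symm (φ z) := h.2.contDiffAt.differentiableAt (by simp)
  have h2 : HasFDerivAt (φ.symm ∘ φ) ((fderiv ℝ φ.symm (φ z)).comp (fderiv ℝ φ z)) z :=
    h1.hasFDerivAt.comp z (h.differentiableAt z).hasFDerivAt
  rw [Equiv.symm_comp_self] at h2
  have h3 := h2.unique (hasFDerivAt_id z)
  intro h0
  have h4 := congrArg ContinuousLinearMap.det h3
  rw [ContinuousLinearMap.det, ContinuousLinearMap.toLinearMap_comp, LinearMap.det_comp] at h4
  rw [ContinuousLinearMap.det] at h0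
  rw [h0, mul_zero] at h4
  simp [ContinuousLinearMap.det] at h4

/-- The Jacobian determinant is continuous and never zero on the connected plane, so it has constant
sign. -/
lemma exists_orientation (h : IsPlaneDiffeo φ) : ∃ o : ℝ, o ≠ 0 ∧ ∀ z, 0 < o * (fderiv ℝ φ z).det := by
  have hc : Continuous fun z => (fderiv ℝ φ z).det :=
    ContinuousLinearMap.continuous_det.comp (h.1.continuous_fderiv (by simp))
  have hp : IsPreconnected (Set.range fun z => (fderiv ℝ φ z).det) := isPreconnected_range hc
  have h0 : (0 : ℝ) ∉ Set.range fun z => (fderiv ℝ φ z).det := by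
    rintro ⟨z, hz⟩
    exact h.det_ne_zero z hz
  rcases lt_or_gt_of_ne (h.det_ne_zero 0) with h1 | h1
  · refine ⟨-1, by norm_num, fun z => ?_⟩
    rcases lt_or_gt_of_ne (h.det_ne_zero z) with h2 | h2
    · linarith
    · exact absurd (hp.ordConnected.out ⟨0, rfl⟩ ⟨z, rfl⟩ ⟨h1.le, h2.le⟩) h0
  · refine ⟨1, by norm_num, fun z => ?_⟩
    rcases lt_or_gt_of_ne (h.det_ne_zero z) with h2 | h2
    · exact absurd (hp.ordConnected.out ⟨z, rfl⟩ ⟨0, rfl⟩ ⟨h2.le, h1.le⟩) h0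
    · linarith

end IsPlaneDiffeo

/-! ### Local moves inside a disk -/

namespace LinkDiagram

open Isotropic Gauss

variable {n : ℕ}

lemma velocity_congr {D D' : LinkDiagram n} {p : CurveParam n} {U : Set (CurveParam n)}
    (hU : IsClosed U) (hp : p ∉ U) (h : ∀ q, q ∉ U → D'.pt q = D.pt q) :
    D'.velocity p = D.velocity p := by
  apply Filter.EventuallyEq.deriv_eq
  have hc : Continuous fun x : ℝ => ((p.1, p.2 + (x : UnitAddCircle)) : CurveParam n) :=
    continuous_const.prodMk (continuous_const.add (AddCircle.continuous_mk' 1))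
  have h1 : ∀ᶠ x : ℝ in nhds 0, ((p.1, p.2 + (x : UnitAddCircle)) : CurveParam n) ∈ Uᶜ := by
    refine hc.continuousAt.eventually_mem ?_
    refine hU.isOpen_compl.mem_nhds ?_
    simpa using hp
  filter_upwards [h1] with x hx
  exact h _ hx

/-- The data of a local move. -/
structure LocalMoveData {k : ℕ} (T T' : Tangle k) (D D' : LinkDiagram n) where
  φ : ℂ ≃ ℂ
  comp : Fin k → Fin n
  a : Fin k → ℝ
  l : Fin k → ℝ
  f : Fin k × ℝ → CurveParam n
  diffeo : IsPlaneDiffeo φ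
  f_eq : ∀ x, f x = (comp x.1, ((a x.1 + l x.1 * x.2 : ℝ) : UnitAddCircle))
  injOn : Set.InjOn f {x | x.2 ∈ Set.Icc (-1 : ℝ) 1}
  pt_outside : ∀ p, p ∉ f '' {x | x.2 ∈ Set.Icc (-1 : ℝ) 1} →
    D'.pt p = D.pt p ∧ D.pt p ∉ φ '' Metric.closedBall 0 1
  crossings_outside : ∀ p q, p ∉ f '' {x | x.2 ∈ Set.Icc (-1 : ℝ) 1} →
    q ∉ f '' {x | x.2 ∈ Set.Icc (-1 : ℝ) 1} → ((p, q) ∈ D'.crossings ↔ (p, q) ∈ D.crossings)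
  pt_inside : ∀ j, ∀ t ∈ Set.Icc (-1 : ℝ) 1,
    D.pt (f (j, t)) = φ (T.path j t) ∧ D'.pt (f (j, t)) = φ (T'.path j t)
  crossings_inside : ∀ x y : Fin k × ℝ, x.2 ∈ Set.Icc (-1 : ℝ) 1 → y.2 ∈ Set.Icc (-1 : ℝ) 1 →
    ((f x, f y) ∈ D.crossings ↔ (x, y) ∈ T.crossings) ∧
    ((f x, f y) ∈ D'.crossings ↔ (x, y) ∈ T'.crossings)

lemma IsLocalMove.exists_data {k : ℕ} {T T' : Tangle k} {D D' : LinkDiagram n}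
    (h : IsLocalMove T T' D D') : Nonempty (LocalMoveData T T' D D') := by
  obtain ⟨φ, comp, a, l, f, h1, h2, h3, h4, h5, h6, h7⟩ := h
  exact ⟨⟨φ, comp, a, l, f, h1, h2, h3, h4, h5, h6, h7⟩⟩

/-- The arcs of a tangle lie in the unit disk. -/
def _root_.Tangle.InDisk {k : ℕ} (T : Tangle k) : Prop :=
  ∀ j, ∀ t ∈ Set.Icc (-1 : ℝ) 1, T.path j t ∈ Metric.closedBall (0 : ℂ) 1

namespace LocalMoveData

variable {k : ℕ} {T T' : Tangle k} {D D' : LinkDiagram n} (M : LocalMoveData T T' D D')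

/-- The parameters on the arcs of the tangle. -/
def inside : Set (CurveParam n) := M.f '' {x | x.2 ∈ Set.Icc (-1 : ℝ) 1}

/-- The inverse of a local move. -/
def symm : LocalMoveData T' T D' D where
  φ := M.φ
  comp := M.comp
  a := M.a
  l := M.l
  f := M.f
  diffeo := M.diffeo
  f_eq := M.f_eq
  injOn := M.injOn
  pt_outside p hp := ⟨(M.pt_outside p hp).1.symm, by
    rw [(M.pt_outside p hp).1]; exact (M.pt_outside p hp).2⟩
  crossings_outside p q hp hq := (M.crossings_outside p q hp hq).symm
  pt_inside j t ht := (M.pt_inside j t ht).symm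
  crossings_inside x y hx hy := (M.crossings_inside x y hx hy).symm

lemma l_ne_zero (j : Fin k) : M.l j ≠ 0 := by
  intro h
  have : ((j, (0 : ℝ)) : Fin k × ℝ) = (j, 1) := M.injOn (by simp) (by simp) (by
    rw [M.f_eq, M.f_eq]; simp [h])
  simp at this

lemma isClosed_inside : IsClosed M.inside := by
  have hf : Continuous M.f := by
    have : M.f = fun x => (M.comp x.1, ((M.a x.1 + M.l x.1 * x.2 : ℝ) : UnitAddCircle)) :=
      funext M.f_eq
    rw [this]
    have h1 : Continuous fun x : Fin k × ℝ => M.comp x.1 :=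
      continuous_of_discreteTopology.comp continuous_fst
    have h2 : Continuous fun x : Fin k × ℝ => M.a x.1 :=
      continuous_of_discreteTopology.comp continuous_fst
    have h3 : Continuous fun x : Fin k × ℝ => M.l x.1 :=
      continuous_of_discreteTopology.comp continuous_fst
    exact h1.prodMk ((AddCircle.continuous_mk' 1).comp (h2.add (h3.mul continuous_snd)))
  have hK : IsCompact {x : Fin k × ℝ | x.2 ∈ Set.Icc (-1 : ℝ) 1} := by
    have : {x : Fin k × ℝ | x.2 ∈ Set.Icc (-1 : ℝ) 1} = Set.univ ×ˢ Set.Icc (-1 : ℝ) 1 := by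
      ext x; simp
    rw [this]
    exact isCompact_univ.prod isCompact_Icc
  exact (hK.image hf).isClosed

lemma velocity_outside {p : CurveParam n} (hp : p ∉ M.inside) : D'.velocity p = D.velocity p :=
  velocity_congr M.isClosed_inside hp fun q hq => (M.pt_outside q hq).1

lemma isNegative_outside {x : CurveParam n × CurveParam n} (h : x.1 ∉ M.inside)
    (h' : x.2 ∉ M.inside) : D'.IsNegative x ↔ D.IsNegative x := by
  rw [IsNegative, IsNegative, M.velocity_outside h, M.velocity_outside h']

lemma velocity_inside {j : Fin k} {t : ℝ} (ht : t ∈ Set.Ioo (-1 : ℝ) 1) {w : ℂ}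
    (hw : HasDerivAt (T.path j) w t) :
    D.velocity (M.f (j, t)) = (M.l j)⁻¹ • fderiv ℝ M.φ (T.path j t) w := by
  have hl := M.l_ne_zero j
  have h1 : HasDerivAt (fun x : ℝ => t + (M.l j)⁻¹ * x) (M.l j)⁻¹ 0 := by
    simpa using ((hasDerivAt_id (0 : ℝ)).const_mul (M.l j)⁻¹).const_add t
  have h2 : HasDerivAt (fun x : ℝ => T.path j (t + (M.l j)⁻¹ * x)) ((M.l j)⁻¹ • w) 0 :=
    HasDerivAt.scomp (h := fun x : ℝ => t + (M.l j)⁻¹ * x) 0 (by simpa using hw) h1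
  have h3 : HasDerivAt (fun x : ℝ => M.φ (T.path j (t + (M.l j)⁻¹ * x)))
      (fderiv ℝ M.φ (T.path j t) ((M.l j)⁻¹ • w)) 0 := by
    have h4 := (M.diffeo.differentiableAt (T.path j t)).hasFDerivAt
    exact HasFDerivAt.comp_hasDerivAt 0 (by simpa using h4) h2
  rw [map_smul] at h3
  rw [← h3.deriv]
  apply Filter.EventuallyEq.deriv_eq
  have h5 : ∀ᶠ x : ℝ in nhds 0, t + (M.l j)⁻¹ * x ∈ Set.Ioo (-1 : ℝ) 1 := by
    refine h1.continuousAt.eventually_mem (isOpen_Ioo.mem_nhds ?_)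
    simpa using ht
  filter_upwards [h5] with x hx
  rw [← (M.pt_inside j _ (Set.Ioo_subset_Icc_self hx)).1, pt, M.f_eq, M.f_eq]
  simp only
  rw [← AddCircle.coe_add]
  congr 2
  field_simp
  ring

lemma planeDet_velocity {x y : Fin k × ℝ} (hx : x.2 ∈ Set.Ioo (-1 : ℝ) 1)
    (hy : y.2 ∈ Set.Ioo (-1 : ℝ) 1) (hxy : T.path x.1 x.2 = T.path y.1 y.2) {u w : ℂ}
    (hu : HasDerivAt (T.path x.1) u x.2) (hw : HasDerivAt (T.path y.1) w y.2) :
    planeDet (D.velocity (M.f x)) (D.velocity (M.f y)) =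
      (M.l x.1)⁻¹ * (M.l y.1)⁻¹ * ((fderiv ℝ M.φ (T.path x.1 x.2)).det * planeDet u w) := by
  rw [M.velocity_inside (j := x.1) hx hu, M.velocity_inside (j := y.1) hy hw, ← hxy,
    planeDet_smul, planeDet_map]

/-- An orientation of the disk. -/
noncomputable def orient : ℝ := M.diffeo.exists_orientation.choose

lemma orient_ne_zero : M.orient ≠ 0 := M.diffeo.exists_orientation.choose_spec.1

/-- By the chain rule the velocities are images of the tangle velocities under the differential of
φ, divided by the speeds `l`. Only the signs of the speeds and of the Jacobian matter, so
reciprocals are replaced by multiplying with positive quantities. -/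
lemma isNegative_inside {x y : Fin k × ℝ} (hx : x.2 ∈ Set.Ioo (-1 : ℝ) 1)
    (hy : y.2 ∈ Set.Ioo (-1 : ℝ) 1) (hxy : T.path x.1 x.2 = T.path y.1 y.2) {u w : ℂ}
    (hu : HasDerivAt (T.path x.1) u x.2) (hw : HasDerivAt (T.path y.1) w y.2) :
    D.IsNegative (M.f x, M.f y) ↔ M.orient * (M.l x.1 * M.l y.1) * planeDet u w < 0 := by
  rw [IsNegative, M.planeDet_velocity hx hy hxy hu hw]
  have ho := M.diffeo.exists_orientation.choose_spec.2 (T.path x.1 x.2)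
  change 0 < M.orient * _ at ho
  set e := (fderiv ℝ M.φ (T.path x.1 x.2)).det
  set o := M.orient
  have hl := M.l_ne_zero x.1
  have hl' := M.l_ne_zero y.1
  have h1 : 0 < (M.l x.1 * M.l y.1) ^ 2 := by positivity
  have h2 : o * (M.l x.1 * M.l y.1) * planeDet u w * e ^ 2 =
      (M.l x.1)⁻¹ * (M.l y.1)⁻¹ * (e * planeDet u w) * ((o * e) * (M.l x.1 * M.l y.1) ^ 2) := by
    field_simp
  have he : 0 < e ^ 2 := by
    have : e ≠ 0 := fun h => by rw [h, mul_zero] at ho; exact lt_irrefl _ ho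
    positivity
  rw [← mul_neg_iff_neg_of_pos (mul_pos ho h1), ← h2, mul_neg_iff_neg_of_pos he]

/-- Both passages are at the same point of the plane, and a point lies in the disk exactly if its
parameters are inside. So no crossing has just one passage inside. -/
lemma crossing_cases (hT : T.InDisk) {x : CurveParam n × CurveParam n} (hx : x ∈ D.crossings) :
    (x.1 ∉ M.inside ∧ x.2 ∉ M.inside) ∨ ∃ y ∈ T.crossings, y.1.2 ∈ Set.Icc (-1 : ℝ) 1 ∧
      y.2.2 ∈ Set.Icc (-1 : ℝ) 1 ∧ x = (M.f y.1, M.f y.2) := by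
  have hin : ∀ p ∈ M.inside, D.pt p ∈ M.φ '' Metric.closedBall 0 1 := by
    rintro _ ⟨⟨j, t⟩, ht, rfl⟩
    rw [(M.pt_inside j t ht).1]
    exact ⟨_, hT j t ht, rfl⟩
  have hpt : D.pt x.1 = D.pt x.2 := (D.crossing_double x hx).2
  by_cases h1 : x.1 ∈ M.inside
  · by_cases h2 : x.2 ∈ M.inside
    · right
      obtain ⟨p, q⟩ := x
      obtain ⟨y, hy, rfl⟩ := h1
      obtain ⟨z, hz, rfl⟩ := h2
      exact ⟨(y, z), ((M.crossings_inside y z hy hz).1).1 hx, hy, hz, rfl⟩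
    · exact absurd (hpt ▸ hin _ h1) (M.pt_outside _ h2).2
  · by_cases h2 : x.2 ∈ M.inside
    · exact absurd (hpt ▸ hin _ h2) (M.pt_outside _ h1).2
    · exact Or.inl ⟨h1, h2⟩

/-! ### Positions on the arcs -/

open scoped Classical in
/-- Base points of the link components which are not in the interior of an arc. -/
noncomputable def base (i : Fin n) : ℝ :=
  if h : ∃ j, M.comp j = i then M.a h.choose + M.l h.choose else 0

/-- The base point is an end of one of the arcs on the component and the arcs are disjoint, so it is
interior to none of them. Each open arc therefore lifts into a single interval between consecutive
lifts of the base point. -/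
lemma exists_center (j : Fin k) : ∃ c : ℝ, ((c : ℝ) : UnitAddCircle) = (M.a j : ℝ) ∧
    ∀ t ∈ Set.Ioo (-1 : ℝ) 1,
      c + M.l j * t ∈ Set.Ioo (M.base (M.comp j)) (M.base (M.comp j) + 1) := by
  have hex : ∃ j', M.comp j' = M.comp j := ⟨j, rfl⟩
  set j' := hex.choose with hj'
  have hcomp : M.comp j' = M.comp j := hex.choose_spec
  have hbase : M.base (M.comp j) = M.a j' + M.l j' := by
    rw [base, dif_pos hex]
  set θ := M.base (M.comp j)
  have hl := M.l_ne_zero j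
  have hne : ∀ t ∈ Set.Ioo (-1 : ℝ) 1, ∀ m : ℤ, M.a j + M.l j * t ≠ θ + m := by
    intro t ht m h
    have h1 : ((j, t) : Fin k × ℝ) = (j', 1) := by
      refine M.injOn (Set.Ioo_subset_Icc_self ht) (by simp) ?_
      rw [M.f_eq, M.f_eq]
      simp only
      rw [h, hcomp, hbase, circle_coe_add_int, mul_one]
    have h2 : t = 1 := congrArg Prod.snd h1
    exact absurd ht.2 (by rw [h2]; exact lt_irrefl _)
  have hne' : ∀ (t : ℝ), t ∈ Set.Ioo (-1 : ℝ) 1 → ∀ m : ℤ, |M.l j * t| < |θ + m - M.a j| := by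
    intro t ht m
    by_contra hlt
    rw [not_lt, abs_mul] at hlt
    have ht1 : |t| < 1 := abs_lt.2 ⟨ht.1, ht.2⟩
    have h1 : |(θ + m - M.a j) / M.l j| < 1 := by
      rw [abs_div, div_lt_one (abs_pos.2 hl)]
      exact hlt.trans_lt (mul_lt_of_lt_one_right (abs_pos.2 hl) ht1)
    refine hne _ (Set.mem_Ioo.2 (abs_lt.1 h1)) m ?_
    field_simp
    ring
  set m := ⌊M.a j - θ⌋
  have hm1 : (m : ℝ) ≤ M.a j - θ := Int.floor_le _
  have hm2 : M.a j - θ < m + 1 := Int.lt_floor_add_one _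
  refine ⟨M.a j - m, ?_, fun t ht => ?_⟩
  · rw [← circle_coe_add_int _ m, sub_add_cancel]
  · have h1 := hne' t ht m
    have h2 := hne' t ht (m + 1)
    push_cast at h2
    rw [abs_of_nonpos (by linarith : θ + m - M.a j ≤ 0)] at h1
    rw [abs_of_nonneg (by linarith : 0 ≤ θ + (m + 1) - M.a j)] at h2
    have h3 := abs_lt.1 h1
    have h4 := abs_lt.1 h2
    exact ⟨by linarith [h3.1], by linarith [h4.2]⟩

/-- The position of the center of an arc. -/
noncomputable def center (j : Fin k) : ℝ := (M.exists_center j).choose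

lemma circleRep_f {j : Fin k} {t : ℝ} (ht : t ∈ Set.Ioo (-1 : ℝ) 1) :
    circleRep (M.base (M.comp j)) (M.f (j, t)).2 = M.center j + M.l j * t := by
  have h := (M.exists_center j).choose_spec
  have h1 : (M.f (j, t)).2 = ((M.center j + M.l j * t : ℝ) : UnitAddCircle) := by
    rw [M.f_eq]
    simp only
    rw [AddCircle.coe_add, AddCircle.coe_add, ← h.1]
    rfl
  rw [h1]
  exact circleRep_coe (Set.Ioo_subset_Ico_self (h.2 t ht))

/-- The open arc fills all positions at distance less than |l| from its center. -/
lemma abs_l_le {j : Fin k} {q : CurveParam n} (hq : q.1 = M.comp j)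
    (h : ∀ t ∈ Set.Ioo (-1 : ℝ) 1, q ≠ M.f (j, t)) :
    |M.l j| ≤ |circleRep (M.base (M.comp j)) q.2 - M.center j| := by
  by_contra hlt
  rw [not_le] at hlt
  have hl := M.l_ne_zero j
  set r := circleRep (M.base (M.comp j)) q.2
  have h1 : |(r - M.center j) / M.l j| < 1 := by
    rwa [abs_div, div_lt_one (abs_pos.2 hl)]
  have h2 := Set.mem_Ioo.2 (abs_lt.1 h1)
  refine h _ h2 ?_
  refine Prod.ext (by rw [hq, M.f_eq]) ?_
  have h3 := M.circleRep_f (j := j) h2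
  have h4 : M.center j + M.l j * ((r - M.center j) / M.l j) = r := by field_simp; ring
  rw [h4] at h3
  exact (circleRep_injective _ h3).symm

/-- The order of passages with respect to an arc does not depend on the point of the arc. -/
lemma order_iff {j : Fin k} {q : CurveParam n} (hq : q.1 = M.comp j)
    (h : ∀ t ∈ Set.Ioo (-1 : ℝ) 1, q ≠ M.f (j, t)) {t t' : ℝ} (ht : t ∈ Set.Ioo (-1 : ℝ) 1)
    (ht' : t' ∈ Set.Ioo (-1 : ℝ) 1) :
    (M.center j + M.l j * t < circleRep (M.base (M.comp j)) q.2 ↔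
      M.center j + M.l j * t' < circleRep (M.base (M.comp j)) q.2) ∧
    (circleRep (M.base (M.comp j)) q.2 < M.center j + M.l j * t ↔
      circleRep (M.base (M.comp j)) q.2 < M.center j + M.l j * t') := by
  have h1 := M.abs_l_le hq h
  have hl := abs_pos.2 (M.l_ne_zero j)
  have h2 : ∀ {t : ℝ}, t ∈ Set.Ioo (-1 : ℝ) 1 →
      |M.l j * t| < |circleRep (M.base (M.comp j)) q.2 - M.center j| := by
    intro t ht
    rw [abs_mul]
    exact (mul_lt_of_lt_one_right hl (abs_lt.2 ⟨ht.1, ht.2⟩)).trans_le h1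
  have h3 := h2 ht
  have h4 := h2 ht'
  rcases le_total 0 (circleRep (M.base (M.comp j)) q.2 - M.center j) with h5 | h5
  · rw [abs_of_nonneg h5] at h3 h4
    rw [abs_lt] at h3 h4
    constructor <;> constructor <;> intro h6 <;> linarith
  · rw [abs_of_nonpos h5] at h3 h4
    rw [abs_lt] at h3 h4
    constructor <;> constructor <;> intro h6 <;> linarith

end LocalMoveData

end LinkDiagram

namespace LinkDiagram

open Isotropic Gauss

variable {n : ℕ}

/-! ### Adding crossings -/

lemma isSmoothing_of_subset {D D' : LinkDiagram n} (h : D.crossings ⊆ D'.crossings) :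
    IsSmoothing (fun v : D.Vertex => (⟨v.1, h v.2⟩ : D'.Vertex)) D.space D'.space := by
  refine isSmoothing_gaussSpace (fun v w hvw => Subtype.ext (congrArg (fun x => x.1) hvw))
    (Equiv.refl _) (fun v b => ?_) fun p q _ => ?_
  · rfl
  · rfl

namespace LocalMoveData

variable {k : ℕ} {T T' : Tangle k} {D D' : LinkDiagram n} (M : LocalMoveData T T' D D')

lemma position_eq {E : LinkDiagram n} {p : E.Passage} {j : Fin k} {t : ℝ}
    (ht : t ∈ Set.Ioo (-1 : ℝ) 1) (h : E.passageParam p = M.f (j, t)) :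
    E.position M.base p = M.center j + M.l j * t := by
  rw [position, passageComp, h, M.f_eq]
  simp only
  rw [← M.circleRep_f ht, M.f_eq]

lemma passageComp_eq {E : LinkDiagram n} {p : E.Passage} {x : Fin k × ℝ}
    (h : E.passageParam p = M.f x) : E.passageComp p = M.comp x.1 := by
  rw [passageComp, h, M.f_eq]

lemma position_order {E : LinkDiagram n} {p p' q : E.Passage} {j : Fin k} {t t' : ℝ}
    (ht : t ∈ Set.Ioo (-1 : ℝ) 1) (ht' : t' ∈ Set.Ioo (-1 : ℝ) 1)
    (h : E.passageParam p = M.f (j, t)) (h' : E.passageParam p' = M.f (j, t'))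
    (hq : E.passageComp q = E.passageComp p)
    (hq' : ∀ t ∈ Set.Ioo (-1 : ℝ) 1, E.passageParam q ≠ M.f (j, t)) :
    (E.position M.base p < E.position M.base q ↔ E.position M.base p' < E.position M.base q) ∧
    (E.position M.base q < E.position M.base p ↔
      E.position M.base q < E.position M.base p') := by
  have hq1 : E.passageComp q = M.comp j := hq.trans (M.passageComp_eq h)
  rw [M.position_eq ht h, M.position_eq ht' h']
  have := M.order_iff hq1 hq' ht ht'
  rwa [← hq1] at this

lemma ne_of_notMem_inside {p : CurveParam n} (hp : p ∉ M.inside) (j : Fin k) :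
    ∀ t ∈ Set.Ioo (-1 : ℝ) 1, p ≠ M.f (j, t) := fun t ht h =>
  hp ⟨(j, t), Set.Ioo_subset_Icc_self ht, h.symm⟩

section Empty

variable (hT : T.InDisk) (hT' : T'.InDisk) (h0 : T.crossings = ∅)

include hT h0 in
lemma outside_of_mem {x : CurveParam n × CurveParam n} (hx : x ∈ D.crossings) :
    x.1 ∉ M.inside ∧ x.2 ∉ M.inside := by
  rcases M.crossing_cases hT hx with h | ⟨y, hy, -⟩
  · exact h
  · rw [h0] at hy; exact hy.elim

include M hT h0 in
lemma crossings_subset : D.crossings ⊆ D'.crossings := fun x hx =>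
  (M.crossings_outside x.1 x.2 (M.outside_of_mem hT h0 hx).1 (M.outside_of_mem hT h0 hx).2).2 hx

include hT' in
lemma mem_or_of_mem {x : CurveParam n × CurveParam n} (hx : x ∈ D'.crossings) :
    x ∈ D.crossings ∨ ∃ y ∈ T'.crossings, x = (M.f y.1, M.f y.2) := by
  rcases M.symm.crossing_cases hT' hx with h | ⟨y, hy, h1, h2, rfl⟩
  · exact Or.inl ((M.crossings_outside x.1 x.2 h.1 h.2).1 hx)
  · exact Or.inr ⟨y, hy, rfl⟩

end Empty

end LocalMoveData

lemma hasDerivAt_complex_mk {x y : ℝ → ℝ} {x' y' t : ℝ} (hx : HasDerivAt x x' t)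
    (hy : HasDerivAt y y' t) : HasDerivAt (fun s => (⟨x s, y s⟩ : ℂ)) ⟨x', y'⟩ t := by
  have h := hx.ofReal_comp.add (hy.ofReal_comp.mul_const Complex.I)
  have h1 : (fun s => (⟨x s, y s⟩ : ℂ)) =
      (fun s => (x s : ℂ)) + fun s => (y s : ℂ) * Complex.I := by
    funext s; simp [Complex.ext_iff]
  rw [h1]
  exact h.congr_deriv (by simp [Complex.ext_iff])

/-! ### The first Reidemeister move -/

lemma _root_.Tangle.inDisk_line : Tangle.line.InDisk := by
  intro j t ht
  rw [mem_closedBall_zero_iff, ← abs_of_nonneg (norm_nonneg _), ← sq_le_one_iff_abs_le_one,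
    Complex.sq_norm, Complex.normSq_apply]
  simp only [Tangle.line]
  nlinarith [ht.1, ht.2]

lemma _root_.Tangle.inDisk_kink (b : Bool) : (Tangle.kink b).InDisk := by
  intro j t ht
  rw [mem_closedBall_zero_iff, ← abs_of_nonneg (norm_nonneg _), ← sq_le_one_iff_abs_le_one,
    Complex.sq_norm, Complex.normSq_apply]
  simp only [Tangle.kink]
  have h1 : t ^ 2 ≤ 1 := by nlinarith [ht.1, ht.2]
  have h0 : 0 ≤ t ^ 2 := sq_nonneg t
  generalize hx : t ^ 2 = x at *
  -- The squared norm is 1 minus a multiple of 1 - t², with a cofactor that is positive.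
  have : (4 * t ^ 3 - t) / 3 * ((4 * t ^ 3 - t) / 3) + (1 - x) / 2 * ((1 - x) / 2) =
    1 - (1 - x) * (27 + 41 * x + 64 * x ^ 2) / 36 := by
    subst hx; ring
  rw [this]
  have : 0 ≤ (1 - x) * (27 + 41 * x + 64 * x ^ 2) := by
    have h2 : 0 ≤ 1 - x := by linarith
    positivity
  linarith

/-- Matching the two passages of the new crossing describes the monogon. It leaves the crossing
through one passage and arrives through the other, so its vector is `o` there. -/
theorem equiv_of_reidemeister1 {D D' : LinkDiagram n} {b : Bool}
    (h : IsLocalMove Tangle.line (Tangle.kink b) D D') : D.toState.Equiv D'.toState := by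
  classical
  obtain ⟨M⟩ := h.exists_data
  have hD := fun {x} => M.outside_of_mem (x := x) Tangle.inDisk_line rfl
  have hsub := M.crossings_subset Tangle.inDisk_line rfl
  obtain ⟨t, t', ht, ht', hne, hc⟩ : ∃ t t' : ℝ, t ∈ Set.Ioo (-1 : ℝ) 1 ∧
      t' ∈ Set.Ioo (-1 : ℝ) 1 ∧ t ≠ t' ∧ (Tangle.kink b).crossings = {((0, t), (0, t'))} := by
    cases b
    · exact ⟨-1 / 2, 1 / 2, by norm_num, by norm_num, by norm_num, by simp [Tangle.kink]⟩
    · exact ⟨1 / 2, -1 / 2, by norm_num, by norm_num, by norm_num, by simp [Tangle.kink]⟩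
  have hmem : (M.f (0, t), M.f (0, t')) ∈ D'.crossings :=
    (M.crossings_inside (0, t) (0, t') (Set.Ioo_subset_Icc_self ht)
      (Set.Ioo_subset_Icc_self ht')).2.2 (by rw [hc]; rfl)
  let v : D'.Vertex := ⟨_, hmem⟩
  have hv : ∀ x : D'.Vertex, x ≠ v → x.1 ∈ D.crossings := by
    intro x hx
    rcases M.mem_or_of_mem (Tangle.inDisk_kink b) x.2 with h1 | ⟨y, hy, h1⟩
    · exact h1
    · rw [hc, Set.mem_singleton_iff] at hy
      subst hy
      exact absurd (Subtype.ext h1) hx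
  have hvn : v.1 ∉ D.crossings := fun h1 =>
    (hD h1).1 ⟨(0, t), Set.Ioo_subset_Icc_self ht, rfl⟩
  have hpar : ∀ b, D'.passageParam (v, b) = M.f (0, if b then t else t') := by
    intro b; cases b <;> simp [passageParam, v]
  have hpar' : ∀ b : Bool, (if b then t else t') ∈ Set.Ioo (-1 : ℝ) 1 := by
    intro b; cases b <;> simpa
  have hcomp : ∀ b, D'.passageComp (v, b) = M.comp 0 := fun b => M.passageComp_eq (hpar b)
  have hmatch : IsMatching D'.passageComp (D'.position M.base) {v} fun p => (p.1, !p.2) := by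
    refine ⟨fun p hp => hp, fun p _ => by simp, fun p _ h => ?_, ?_, ?_⟩
    · have h1 := congrArg Prod.snd h
      simp at h1
    · rintro ⟨p, c⟩ hp
      rw [Finset.mem_singleton] at hp
      subst hp
      rw [hcomp, hcomp]
    · rintro ⟨p, c⟩ hp q hq1 hq2 hq
      rw [Finset.mem_singleton] at hp
      dsimp only at hp
      subst hp
      refine (M.position_order (hpar' c) (hpar' (!c)) (hpar c) (hpar (!c)) hq ?_).1
      apply M.ne_of_notMem_inside
      have hqv : q.1 ≠ v := by
        rintro h1
        obtain ⟨q1, q2⟩ := q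
        dsimp only at h1
        subst h1
        cases c <;> cases q2 <;> simp at hq1 hq2
      have h2 := hD (hv q.1 hqv)
      obtain ⟨q1, q2⟩ := q
      cases q2
      · exact h2.2
      · exact h2.1
  have ho : (Pi.single (v : D'.toState.V) o : D'.toState.V → Klein) ∈ D'.toState.L := by
    change (Pi.single (v : D'.toState.V) o : D'.toState.V → Klein) ∈ D'.space
    rw [D'.space_eq M.base]
    have hvec : matchVec (D'.position M.base) {v} (fun p => (p.1, !p.2)) =
        (Pi.single (v : D'.toState.V) o : D'.toState.V → Klein) := ?_
    · rw [← hvec]; exact hmatch.matchVec_mem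
    funext x
    symm
    by_cases hx : x = v
    · rw [hx]
      refine (Pi.single_eq_same (M := fun _ : D'.toState.V => Klein) v o).trans ?_
      rw [matchVec, if_pos (Finset.mem_singleton_self v), if_neg]
      intro h1
      replace h1 : D'.position M.base (v, false) < D'.position M.base (v, true) ↔
        D'.position M.base (v, true) < D'.position M.base (v, false) := h1
      rcases lt_trichotomy (D'.position M.base (v, false)) (D'.position M.base (v, true))
        with h3 | h3 | h3
      · exact absurd (h1.1 h3) (not_lt.2 h3.le)
      · have := D'.position_injective M.base _ _ ((hcomp _).trans (hcomp _).symm) h3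
        exact Bool.false_ne_true (congrArg Prod.snd this)
      · exact absurd (h1.2 h3) (not_lt.2 h3.le)
    · refine (Pi.single_eq_of_ne (M := fun _ : D'.toState.V => Klein) hx o).trans ?_
      rw [matchVec, if_neg (fun h => hx (Finset.mem_singleton.1 h))]
  -- The new crossing is one of a link component with itself and joins nothing new.
  have hcc : D.componentCount = D'.componentCount := by
    rw [componentCount_eq, componentCount_eq]
    refine card_quot_of_eq (i := M.comp 0) (i' := M.comp 0) ?_ ?_ rfl
    · rintro _ _ ⟨x, hx, rfl, rfl⟩
      exact ⟨x, hsub hx, rfl, rfl⟩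
    · rintro _ _ ⟨x, hx, rfl, rfl⟩
      by_cases hxv : (⟨x, hx⟩ : D'.Vertex) = v
      · right; left
        have h1 : x = v.1 := congrArg Subtype.val hxv
        rw [h1]
        exact ⟨hcomp true, hcomp false⟩
      · exact Or.inl ⟨x, hv ⟨x, hx⟩ hxv, rfl, rfl⟩
  refine (State.reidemeister1 (S := D.toState) (S' := D'.toState)
    (fun v : D.Vertex => (⟨v.1, hsub v.2⟩ : D'.Vertex))
    (fun v w hvw => Subtype.ext (congrArg (fun x => x.1) hvw)) v ?_
    (isSmoothing_of_subset hsub) ?_ ?_ ho).symm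
  · intro x
    constructor
    · intro hx
      by_contra hxv
      exact hx ⟨⟨x.1, hv x hxv⟩, rfl⟩
    · rintro rfl ⟨y, hy⟩
      exact hvn (by rw [← hy]; exact y.2)
  · intro x
    exact M.isNegative_outside (hD x.2).1 (hD x.2).2
  · change D.componentCount - 1 = D'.componentCount - 1
    rw [hcc]

/-! ### The second Reidemeister move -/

lemma _root_.Tangle.inDisk_parallel (height : Equiv.Perm (Fin 2)) :
    (Tangle.parallel height).InDisk := by
  intro j t ht
  rw [mem_closedBall_zero_iff, ← abs_of_nonneg (norm_nonneg _), ← sq_le_one_iff_abs_le_one,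
    Complex.sq_norm, Complex.normSq_apply]
  fin_cases j <;> simp [Tangle.parallel, Tangle.layered] <;> nlinarith [ht.1, ht.2]

lemma _root_.Tangle.inDisk_clasp (height : Equiv.Perm (Fin 2)) :
    (Tangle.clasp height).InDisk := by
  intro j t ht
  rw [mem_closedBall_zero_iff, ← abs_of_nonneg (norm_nonneg _), ← sq_le_one_iff_abs_le_one,
    Complex.sq_norm, Complex.normSq_apply]
  have h1 : t ^ 2 ≤ 1 := by nlinarith [ht.1, ht.2]
  have h0 : 0 ≤ t ^ 2 := sq_nonneg t
  fin_cases j <;> simp [Tangle.clasp, Tangle.layered] <;> nlinarith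

lemma _root_.Tangle.crossings_parallel (height : Equiv.Perm (Fin 2)) :
    (Tangle.parallel height).crossings = ∅ := by
  ext ⟨⟨i, t⟩, ⟨j, t'⟩⟩
  simp only [Tangle.parallel, Tangle.layered, Set.mem_ofPred_eq, Set.mem_empty_iff_false,
    iff_false, not_and]
  intro _ _ hlt h
  have h2 := congrArg Complex.im h
  fin_cases i <;> fin_cases j <;> simp at hlt h2 <;> norm_num at h2

lemma _root_.Tangle.exists_crossings_clasp (height : Equiv.Perm (Fin 2)) : ∃ i j : Fin 2, i ≠ j ∧
    ∀ x, x ∈ (Tangle.clasp height).crossings ↔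
      x = ((i, -1 / 2), (j, -1 / 2)) ∨ x = ((i, 1 / 2), (j, 1 / 2)) := by
  obtain ⟨i, j, hij, h1⟩ : ∃ i j : Fin 2, i ≠ j ∧ ∀ i' j', height j' < height i' ↔
      i' = i ∧ j' = j := by
    revert height; decide
  refine ⟨i, j, hij, ?_⟩
  rintro ⟨⟨i', t⟩, ⟨j', t'⟩⟩
  simp only [Tangle.clasp, Tangle.layered, Set.mem_ofPred_eq, h1, Prod.mk.injEq]
  constructor
  · rintro ⟨-, -, ⟨rfl, rfl⟩, h⟩
    have h2 := congrArg Complex.re h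
    have h3 := congrArg Complex.im h
    have htt : t = t' := by
      fin_cases i' <;> fin_cases j' <;> simp at h2 hij <;> linarith
    subst htt
    have h4 : (t - 1 / 2) * (t + 1 / 2) = 0 := by
      fin_cases i' <;> fin_cases j' <;> simp at h3 hij <;> linarith
    rcases mul_eq_zero.1 h4 with h5 | h5
    · right; constructor <;> exact ⟨rfl, by linarith⟩
    · left; constructor <;> exact ⟨rfl, by linarith⟩
  · rintro (⟨⟨rfl, rfl⟩, ⟨rfl, rfl⟩⟩ | ⟨⟨rfl, rfl⟩, ⟨rfl, rfl⟩⟩) <;>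
      refine ⟨by norm_num, by norm_num, ⟨rfl, rfl⟩, ?_⟩ <;>
      apply Complex.ext <;> fin_cases i' <;> fin_cases j' <;> norm_num

/-- The velocity of the arcs of a clasp. -/
lemma _root_.Tangle.hasDerivAt_clasp (height : Equiv.Perm (Fin 2)) (j : Fin 2) (t : ℝ) :
    HasDerivAt ((Tangle.clasp height).path j) ⟨4 / 5, if j = 0 then 8 * t / 5 else -(8 * t / 5)⟩
      t := by
  have h1 : HasDerivAt (fun s : ℝ => 4 * s / 5) (4 / 5) t := by
    simpa using ((hasDerivAt_id t).const_mul 4).div_const 5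
  have h2 : HasDerivAt (fun s : ℝ => (4 * s ^ 2 - 1) / 5) (8 * t / 5) t :=
    ((((hasDerivAt_pow 2 t).const_mul 4).sub_const 1).div_const 5).congr_deriv (by
      simp; ring)
  have h3 : HasDerivAt (fun s : ℝ => -(4 * s ^ 2 - 1) / 5) (-(8 * t / 5)) t :=
    ((((hasDerivAt_pow 2 t).const_mul 4).sub_const 1).neg.div_const 5).congr_deriv (by
      simp; ring)
  fin_cases j
  · exact hasDerivAt_complex_mk h1 h2
  · exact hasDerivAt_complex_mk h1 h3

/-- Matching the passages of the two new crossings on each arc describes the bigon. It is oriented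
at both crossings or disoriented at both, and their signs are opposite. Whether the crossings join
two separate components of the universe graph is decided by `pair_s_mem_iff`. -/
theorem equiv_of_reidemeister2 {D D' : LinkDiagram n} {height : Equiv.Perm (Fin 2)}
    (h : IsLocalMove (Tangle.parallel height) (Tangle.clasp height) D D') :
    D.toState.Equiv D'.toState := by
  classical
  obtain ⟨M⟩ := h.exists_data
  have hD := fun {x} => M.outside_of_mem (x := x) (Tangle.inDisk_parallel height)
    (Tangle.crossings_parallel height)
  have hsub := M.crossings_subset (Tangle.inDisk_parallel height)
    (Tangle.crossings_parallel height)
  obtain ⟨i, j, hij, hc⟩ := Tangle.exists_crossings_clasp height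
  have hm : (-1 / 2 : ℝ) ∈ Set.Ioo (-1 : ℝ) 1 := by norm_num
  have hp : (1 / 2 : ℝ) ∈ Set.Ioo (-1 : ℝ) 1 := by norm_num
  have hmv : (M.f (i, -1 / 2), M.f (j, -1 / 2)) ∈ D'.crossings :=
    (M.crossings_inside (i, -1 / 2) (j, -1 / 2) (Set.Ioo_subset_Icc_self hm)
      (Set.Ioo_subset_Icc_self hm)).2.2 ((hc _).2 (Or.inl rfl))
  have hmw : (M.f (i, 1 / 2), M.f (j, 1 / 2)) ∈ D'.crossings :=
    (M.crossings_inside (i, 1 / 2) (j, 1 / 2) (Set.Ioo_subset_Icc_self hp)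
      (Set.Ioo_subset_Icc_self hp)).2.2 ((hc _).2 (Or.inr rfl))
  let v : D'.Vertex := ⟨_, hmv⟩
  let w : D'.Vertex := ⟨_, hmw⟩
  have hvw : v ≠ w := by
    intro h
    have h1 : M.f (i, -1 / 2) = M.f (i, 1 / 2) := congrArg (fun x : D'.Vertex => x.1.1) h
    have h2 := congrArg Prod.snd (M.injOn (Set.Ioo_subset_Icc_self hm)
      (Set.Ioo_subset_Icc_self hp) h1)
    norm_num at h2
  have hv : ∀ x : D'.Vertex, x ≠ v → x ≠ w → x.1 ∈ D.crossings := by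
    intro x hx hx'
    rcases M.mem_or_of_mem (Tangle.inDisk_clasp height) x.2 with h1 | ⟨y, hy, h1⟩
    · exact h1
    · rcases (hc y).1 hy with rfl | rfl
      · exact absurd (Subtype.ext h1) hx
      · exact absurd (Subtype.ext h1) hx'
  have hvn : v.1 ∉ D.crossings := fun h1 =>
    (hD h1).1 ⟨(i, -1 / 2), Set.Ioo_subset_Icc_self hm, rfl⟩
  have hwn : w.1 ∉ D.crossings := fun h1 =>
    (hD h1).1 ⟨(i, 1 / 2), Set.Ioo_subset_Icc_self hp, rfl⟩
  have hparv : ∀ b, D'.passageParam (v, b) = M.f (if b then i else j, -1 / 2) := by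
    intro b; cases b <;> simp [passageParam, v]
  have hparw : ∀ b, D'.passageParam (w, b) = M.f (if b then i else j, 1 / 2) := by
    intro b; cases b <;> simp [passageParam, w]
  have hcompv : ∀ b, D'.passageComp (v, b) = M.comp (if b then i else j) :=
    fun b => M.passageComp_eq (hparv b)
  have hcompw : ∀ b, D'.passageComp (w, b) = M.comp (if b then i else j) :=
    fun b => M.passageComp_eq (hparw b)
  let σ : D'.Passage → D'.Passage := fun p => (if p.1 = v then w else v, p.2)
  have hσv : ∀ b, σ (v, b) = (w, b) := fun b => by simp [σ]
  have hσw : ∀ b, σ (w, b) = (v, b) := fun b => by simp [σ, hvw.symm]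
  have hout : ∀ p q : D'.Passage, (p.1 = v ∨ p.1 = w) → q ≠ p → q ≠ σ p →
      ∀ t ∈ Set.Ioo (-1 : ℝ) 1, D'.passageParam q ≠ M.f (if p.2 then i else j, t) := by
    rintro ⟨p, b⟩ ⟨q, c⟩ hpS hq hq' t ht
    by_cases hqS : q = v ∨ q = w
    · have hbc : c ≠ b := by
        rintro rfl
        rcases hpS with rfl | rfl <;> rcases hqS with rfl | rfl
        exacts [hq rfl, hq' (hσv _).symm, hq' (hσw _).symm, hq rfl]
      have hne : (if c then i else j) ≠ (if b then i else j) := by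
        cases b <;> cases c
        exacts [absurd rfl hbc, hij, hij.symm, absurd rfl hbc]
      rcases hqS with rfl | rfl
      · rw [hparv]
        exact fun h1 => hne (congrArg Prod.fst (M.injOn (Set.Ioo_subset_Icc_self hm)
          (Set.Ioo_subset_Icc_self ht) h1))
      · rw [hparw]
        exact fun h1 => hne (congrArg Prod.fst (M.injOn (Set.Ioo_subset_Icc_self hp)
          (Set.Ioo_subset_Icc_self ht) h1))
    · push Not at hqS
      have h2 := hD (hv q hqS.1 hqS.2)
      refine M.ne_of_notMem_inside ?_ _ t ht
      cases c
      · exact h2.2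
      · exact h2.1
  have hmatch : IsMatching D'.passageComp (D'.position M.base) {v, w} σ := by
    refine ⟨?_, ?_, ?_, ?_, ?_⟩ <;> rintro ⟨p, b⟩ hpS <;>
      simp only [Finset.mem_insert, Finset.mem_singleton] at hpS <;> rcases hpS with rfl | rfl
    · simp [hσv]
    · simp [hσw]
    · simp [hσv, hσw]
    · simp [hσv, hσw]
    · rw [hσv]; exact fun h => hvw (congrArg Prod.fst h).symm
    · rw [hσw]; exact fun h => hvw (congrArg Prod.fst h)
    · rw [hσv, hcompv, hcompw]
    · rw [hσw, hcompv, hcompw]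
    · intro q hq1 hq2 hq
      have := hout (v, b) q (Or.inl rfl) hq1 hq2
      rw [hσv]
      exact (M.position_order hm hp (hparv b) (hparw b) hq this).1
    · intro q hq1 hq2 hq
      have := hout (w, b) q (Or.inr rfl) hq1 hq2
      rw [hσw]
      exact (M.position_order hp hm (hparw b) (hparv b) hq this).1
  have hmv' := hmatch.matchVec_mem
  rw [← D'.space_eq M.base] at hmv'
  have hvS : v ∈ ({v, w} : Finset D'.Vertex) := Finset.mem_insert_self _ _
  have hwS : w ∈ ({v, w} : Finset D'.Vertex) :=
    Finset.mem_insert_of_mem (Finset.mem_singleton_self _)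
  set x := matchVec (D'.position M.base) {v, w} σ v with hx
  have hxo : x = o ∨ x = d := by
    rw [hx, matchVec, if_pos hvS]
    split_ifs
    · exact Or.inr rfl
    · exact Or.inl rfl
  have hposne : ∀ b, D'.position M.base (v, b) ≠ D'.position M.base (w, b) := fun b h =>
    hvw (congrArg Prod.fst (D'.position_injective M.base _ _
      ((hcompv b).trans (hcompw b).symm) h))
  -- Passing from v to w reverses the order on both arcs, so the two comparisons in `matchVec` are
  -- both negated and the entry is the same.
  have hpair : pair v w x = matchVec (D'.position M.base) {v, w} σ := by
    funext y
    by_cases hyv : y = v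
    · rw [hyv, pair_left hvw]
    · by_cases hyw : y = w
      · rw [hyw, pair_right hvw, hx, matchVec, matchVec, if_pos hvS, if_pos hwS]
        simp only [hσv, hσw]
        have key : ∀ b, (D'.position M.base (w, b) < D'.position M.base (v, b) ↔
            ¬ D'.position M.base (v, b) < D'.position M.base (w, b)) := fun b =>
          ⟨fun h => not_lt.2 h.le, fun h => lt_of_le_of_ne (not_lt.1 h) (hposne b).symm⟩
        simp only [key, not_iff_not]
      · rw [pair_ne hyv hyw, matchVec, if_neg]
        rw [Finset.mem_insert, Finset.mem_singleton]
        exact fun h => h.elim hyv hyw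
  have hxL : pair v w x ∈ D'.space := by rw [hpair]; exact hmv'
  have hcci : ∀ a b, D.Meets a b ↔
      ∃ x ∈ D'.crossings, x ≠ v.1 ∧ x ≠ w.1 ∧ x.1.1 = a ∧ x.2.1 = b := by
    intro a b
    constructor
    · rintro ⟨x, hx, h1⟩
      exact ⟨x, hsub hx, fun h => hvn (h ▸ hx), fun h => hwn (h ▸ hx), h1⟩
    · rintro ⟨x, hx, h1, h2, h3⟩
      exact ⟨x, hv ⟨x, hx⟩ (fun h => h1 (congrArg Subtype.val h))
        fun h => h2 (congrArg Subtype.val h), h3⟩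
  have hci : v.1.1.1 = M.comp i := hcompv true
  have hcj : v.1.2.1 = M.comp j := hcompv false
  have hci' : w.1.1.1 = M.comp i := hcompw true
  have hcj' : w.1.2.1 = M.comp j := hcompw false
  have hs := pair_s_mem_iff hvw (fun b => by rw [hci, hcj, hci', hcj']) hcci
  rw [hci, hcj] at hs
  have hr1 : ∀ a b, D.Meets a b → D'.Meets a b := by
    rintro _ _ ⟨x, hx, rfl, rfl⟩
    exact ⟨x, hsub hx, rfl, rfl⟩
  have hr2 : ∀ a b, D'.Meets a b → D.Meets a b ∨ a = M.comp i ∧ b = M.comp j ∨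
      a = M.comp j ∧ b = M.comp i := by
    rintro _ _ ⟨x, hx, rfl, rfl⟩
    by_cases hxv : (⟨x, hx⟩ : D'.Vertex) = v
    · right; left
      rw [show x = v.1 from congrArg Subtype.val hxv]
      exact ⟨hci, hcj⟩
    · by_cases hxw : (⟨x, hx⟩ : D'.Vertex) = w
      · right; left
        rw [show x = w.1 from congrArg Subtype.val hxw]
        exact ⟨hci', hcj'⟩
      · exact Or.inl ⟨x, hv ⟨x, hx⟩ hxv hxw, rfl, rfl⟩
  refine (State.reidemeister2 (S := D.toState) (S' := D'.toState)
    (fun v : D.Vertex => (⟨v.1, hsub v.2⟩ : D'.Vertex))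
    (fun v w hvw => Subtype.ext (congrArg (fun x => x.1) hvw)) v w hvw ?_
    (isSmoothing_of_subset hsub) ?_ x hxo hxL ?_ ?_ ?_).symm
  · intro x
    constructor
    · intro hx
      by_contra hxv
      push Not at hxv
      exact hx ⟨⟨x.1, hv x hxv.1 hxv.2⟩, rfl⟩
    · rintro (rfl | rfl) ⟨y, hy⟩
      · exact hvn (by rw [← hy]; exact y.2)
      · exact hwn (by rw [← hy]; exact y.2)
  · intro x
    exact M.isNegative_outside (hD x.2).1 (hD x.2).2
  · intro hns
    change D.componentCount - 1 = D'.componentCount - 1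
    rw [componentCount_eq, componentCount_eq, card_quot_of_eq hr1 hr2]
    by_contra h
    exact hns (hs.2 h)
  · intro hps
    change D.componentCount - 1 = D'.componentCount - 1 + 1
    have h1 := card_quot_of_ne hr1 hr2 (Or.inl ⟨v.1, v.2, hci, hcj⟩) (hs.1 hps)
    rw [← componentCount_eq, ← componentCount_eq] at h1
    have := componentCount_pos v
    omega
  · have hpath : ∀ y ∈ (Tangle.clasp height).crossings,
        (Tangle.clasp height).path y.1.1 y.1.2 = (Tangle.clasp height).path y.2.1 y.2.2 :=
      fun y hy => hy.2.2.2
    have h1 := M.symm.isNegative_inside (x := (i, -1 / 2)) (y := (j, -1 / 2)) hm hm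
      (hpath _ ((hc _).2 (Or.inl rfl))) (Tangle.hasDerivAt_clasp height i _)
      (Tangle.hasDerivAt_clasp height j _)
    have h2 := M.symm.isNegative_inside (x := (i, 1 / 2)) (y := (j, 1 / 2)) hp hp
      (hpath _ ((hc _).2 (Or.inr rfl))) (Tangle.hasDerivAt_clasp height i _)
      (Tangle.hasDerivAt_clasp height j _)
    change D'.IsNegative (M.symm.f (i, -1 / 2), M.symm.f (j, -1 / 2)) ↔
      ¬ D'.IsNegative (M.symm.f (i, 1 / 2), M.symm.f (j, 1 / 2))
    rw [h1, h2]
    have hne : M.symm.orient * (M.symm.l i * M.symm.l j) ≠ 0 :=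
      mul_ne_zero M.symm.orient_ne_zero (mul_ne_zero (M.symm.l_ne_zero i) (M.symm.l_ne_zero j))
    dsimp only
    set e := M.symm.orient * (M.symm.l i * M.symm.l j)
    -- The vertical velocities change sign between the two crossings of the clasp, and so does the
    -- determinant.
    have hdet : ∃ c : ℝ, c ≠ 0 ∧
        planeDet ⟨4 / 5, if i = 0 then 8 * (-1 / 2) / 5 else -(8 * (-1 / 2) / 5)⟩
          ⟨4 / 5, if j = 0 then 8 * (-1 / 2) / 5 else -(8 * (-1 / 2) / 5)⟩ = c ∧
        planeDet ⟨4 / 5, if i = 0 then 8 * (1 / 2) / 5 else -(8 * (1 / 2) / 5)⟩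
          ⟨4 / 5, if j = 0 then 8 * (1 / 2) / 5 else -(8 * (1 / 2) / 5)⟩ = -c := by
      refine ⟨_, ?_, rfl, ?_⟩ <;> fin_cases i <;> fin_cases j <;> simp [planeDet] at hij ⊢ <;>
        norm_num
    obtain ⟨c, hc0, hc1, hc2⟩ := hdet
    rw [hc1, hc2, mul_neg, neg_lt_zero, not_lt]
    exact ⟨le_of_lt, fun h => lt_of_le_of_ne h (mul_ne_zero hne hc0)⟩

end LinkDiagram

lemma mul_pos_iff_of_ne {a b : ℝ} (ha : a ≠ 0) (hb : b ≠ 0) : 0 < a * b ↔ (0 < a ↔ 0 < b) := by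
  rcases lt_or_gt_of_ne ha with h1 | h1 <;> rcases lt_or_gt_of_ne hb with h2 | h2
  · simp [mul_pos_of_neg_of_neg h1 h2, not_lt.2 h1.le, not_lt.2 h2.le]
  · simp [not_lt.2 (mul_neg_of_neg_of_pos h1 h2).le, not_lt.2 h1.le, h2]
  · simp [not_lt.2 (mul_neg_of_pos_of_neg h1 h2).le, not_lt.2 h2.le, h1]
  · simp [mul_pos h1 h2, h1, h2]

lemma planeDet_comm (u v : ℂ) : planeDet v u = -planeDet u v := by
  simp only [planeDet]; ring

/-! ### The arcs of a triangle -/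

namespace Tangle

lemma inDisk_triangle {ε : ℝ} (hε : ε ^ 2 = 1) (height : Equiv.Perm (Fin 3)) :
    (triangle ε height).InDisk := by
  intro j t ht
  rw [mem_closedBall_zero_iff, ← abs_of_nonneg (norm_nonneg _), ← sq_le_one_iff_abs_le_one,
    Complex.sq_norm, Complex.normSq_apply]
  have h1 : t ^ 2 ≤ 1 := by nlinarith [ht.1, ht.2]
  have h0 : 0 ≤ t ^ 2 := sq_nonneg t
  fin_cases j
  · simp only [triangle, layered, Fin.zero_eta, Matrix.cons_val_zero]
    have h2 : ε * (8 / 9) * (1 - t ^ 2) * (ε * (8 / 9) * (1 - t ^ 2)) =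
        64 / 81 * (1 - t ^ 2) ^ 2 := by
      linear_combination (64 / 81 * (1 - t ^ 2) ^ 2) * hε
    rw [h2]
    nlinarith
  · simp only [triangle, layered, Fin.mk_one, Matrix.cons_val_one, Matrix.cons_val_zero]
    nlinarith
  · simp only [triangle, layered, Fin.reduceFinMk, Matrix.cons_val]
    nlinarith

/-- The velocity of the arcs of a triangle. -/
noncomputable def triangleVelocity (ε : ℝ) (j : Fin 3) (t : ℝ) : ℂ :=
  ![⟨1, -(16 / 9) * (ε * t)⟩, ⟨3 / 5, 4 / 5⟩, ⟨3 / 5, -(4 / 5)⟩] j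

lemma hasDerivAt_triangle (ε : ℝ) (height : Equiv.Perm (Fin 3)) (j : Fin 3) (t : ℝ) :
    HasDerivAt ((triangle ε height).path j) (triangleVelocity ε j t) t := by
  have h3 : HasDerivAt (fun s : ℝ => 3 * s / 5) (3 / 5) t := by
    simpa using ((hasDerivAt_id t).const_mul 3).div_const 5
  have h4 : HasDerivAt (fun s : ℝ => 4 * s / 5) (4 / 5) t := by
    simpa using ((hasDerivAt_id t).const_mul 4).div_const 5
  have h5 : HasDerivAt (fun s : ℝ => ε * (8 / 9) * (1 - s ^ 2)) (-(16 / 9) * (ε * t)) t :=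
    (((hasDerivAt_pow 2 t).const_sub 1).const_mul (ε * (8 / 9))).congr_deriv (by simp; ring)
  fin_cases j
  · exact LinkDiagram.hasDerivAt_complex_mk (hasDerivAt_id t) h5
  · exact LinkDiagram.hasDerivAt_complex_mk h3 h4
  · exact LinkDiagram.hasDerivAt_complex_mk h3 h4.neg

/-- The half turn about the center carries one triangle to the other and reverses every arc.
Accordingly the crossing at parameter t before the move corresponds to the one at -t after it. -/
lemma triangle_neg (ε : ℝ) (height : Equiv.Perm (Fin 3)) (j : Fin 3) (t : ℝ) :
    (triangle (-ε) height).path j (-t) = -(triangle ε height).path j t := by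
  fin_cases j <;> apply Complex.ext <;> simp [triangle, layered] <;> ring

lemma crossings_triangle_neg (ε : ℝ) (height : Equiv.Perm (Fin 3)) {x y : Fin 3 × ℝ}
    (h : (x, y) ∈ (triangle ε height).crossings) :
    ((x.1, -x.2), (y.1, -y.2)) ∈ (triangle (-ε) height).crossings := by
  obtain ⟨h1, h2, h3, h4⟩ := h
  refine ⟨⟨by linarith [h1.2], by linarith [h1.1]⟩, ⟨by linarith [h2.2], by linarith [h2.1]⟩,
    h3, ?_⟩
  have h5 := triangle_neg ε height x.1 x.2
  have h6 := triangle_neg ε height y.1 y.2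
  exact h5.trans ((congrArg Neg.neg h4).trans h6.symm)

/-- The parameter, on the first arc, of the crossing of two arcs of a triangle. -/
noncomputable def param : Fin 3 → Fin 3 → ℝ :=
  ![![0, 1 / 2, -1 / 2], ![5 / 6, 0, 0], ![-5 / 6, 0, 0]]

lemma param_mem (i j : Fin 3) : param i j ∈ Set.Ioo (-1 : ℝ) 1 := by
  fin_cases i <;> fin_cases j <;> simp [param] <;> norm_num

lemma path_eq_iff (height : Equiv.Perm (Fin 3)) {i j : Fin 3} (hij : i ≠ j) {t t' : ℝ}
    (ht : t ∈ Set.Icc (-1 : ℝ) 1) (ht' : t' ∈ Set.Icc (-1 : ℝ) 1) :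
    (triangle 1 height).path i t = (triangle 1 height).path j t' ↔
      t = param i j ∧ t' = param j i := by
  have h01 : ∀ {t t' : ℝ}, t ∈ Set.Icc (-1 : ℝ) 1 → (t = 3 * t' / 5 ∧
      1 * (8 / 9) * (1 - t ^ 2) = 4 * t' / 5 ↔ t = 1 / 2 ∧ t' = 5 / 6) := by
    intro t t' ht
    constructor
    · rintro ⟨h1, h2⟩
      -- The second intersection of the parabola with the line is at t = -2, outside the arc.
      have h3 : (2 * t - 1) * (t + 2) = 0 := by nlinarith
      rcases mul_eq_zero.1 h3 with h4 | h4
      · constructor <;> linarith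
      · linarith [ht.1]
    · rintro ⟨rfl, rfl⟩; norm_num
  have h02 : ∀ {t t' : ℝ}, t ∈ Set.Icc (-1 : ℝ) 1 → (t = 3 * t' / 5 ∧
      1 * (8 / 9) * (1 - t ^ 2) = -(4 * t' / 5) ↔ t = -1 / 2 ∧ t' = -5 / 6) := by
    intro t t' ht
    constructor
    · rintro ⟨h1, h2⟩
      have h3 : (2 * t + 1) * (t - 2) = 0 := by nlinarith
      rcases mul_eq_zero.1 h3 with h4 | h4
      · constructor <;> linarith
      · linarith [ht.2]
    · rintro ⟨rfl, rfl⟩; norm_num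
  have h12 : ∀ {t t' : ℝ}, (3 * t / 5 = 3 * t' / 5 ∧ 4 * t / 5 = -(4 * t' / 5)) ↔
      t = 0 ∧ t' = 0 := by
    intro t t'
    constructor
    · rintro ⟨h1, h2⟩
      constructor <;> linarith
    · rintro ⟨rfl, rfl⟩; norm_num
  rw [Complex.ext_iff]
  have hji : ∀ {a b c e : ℝ} {P Q : Prop}, (a = b ∧ c = e ↔ P ∧ Q) → (b = a ∧ e = c ↔ Q ∧ P) :=
    fun h => by rw [eq_comm, @eq_comm _ _ _, and_comm (a := _)]; tauto
  fin_cases i <;> fin_cases j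
  · exact absurd rfl hij
  · exact h01 ht
  · exact h02 ht
  · exact hji (h01 ht')
  · exact absurd rfl hij
  · exact h12
  · exact hji (h02 ht')
  · exact hji h12
  · exact absurd rfl hij

lemma mem_crossings_triangle {height : Equiv.Perm (Fin 3)} {x y : Fin 3 × ℝ} :
    (x, y) ∈ (triangle 1 height).crossings ↔ height y.1 < height x.1 ∧
      x.2 = param x.1 y.1 ∧ y.2 = param y.1 x.1 := by
  constructor
  · rintro ⟨h1, h2, h3, h4⟩
    have h5 : x.1 ≠ y.1 := fun h => by
      have h3' : height y.1 < height x.1 := h3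
      rw [h] at h3'; exact lt_irrefl _ h3'
    exact ⟨h3, (path_eq_iff height h5 h1 h2).1 h4⟩
  · rintro ⟨h3, h1, h2⟩
    have h5 : x.1 ≠ y.1 := fun h => by rw [h] at h3; exact lt_irrefl _ h3
    have hx : x.2 ∈ Set.Icc (-1 : ℝ) 1 := h1 ▸ Set.Ioo_subset_Icc_self (param_mem _ _)
    have hy : y.2 ∈ Set.Icc (-1 : ℝ) 1 := h2 ▸ Set.Ioo_subset_Icc_self (param_mem _ _)
    exact ⟨hx, hy, h3, (path_eq_iff height h5 hx hy).2 ⟨h1, h2⟩⟩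

end Tangle

namespace LinkDiagram

open Isotropic Gauss

variable {n : ℕ}

namespace LocalMoveData

variable {k : ℕ} {T T' : Tangle k} {D D' : LinkDiagram n} (M : LocalMoveData T T' D D')

/-! ### Reversing the arcs of a tangle -/

open scoped Classical in
/-- The reversal of all arcs of the tangle. -/
noncomputable def flip (p : CurveParam n) : CurveParam n :=
  if h : p ∈ M.inside then M.f (h.choose.1, -h.choose.2) else p

lemma flip_outside {p : CurveParam n} (h : p ∉ M.inside) : M.flip p = p := dif_neg h

lemma flip_f {j : Fin k} {t : ℝ} (ht : t ∈ Set.Icc (-1 : ℝ) 1) :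
    M.flip (M.f (j, t)) = M.f (j, -t) := by
  have h : M.f (j, t) ∈ M.inside := ⟨_, ht, rfl⟩
  have h1 : h.choose = (j, t) := M.injOn h.choose_spec.1 ht h.choose_spec.2
  rw [flip, dif_pos h, h1]

lemma flip_fst (p : CurveParam n) : (M.flip p).1 = p.1 := by
  by_cases h : p ∈ M.inside
  · obtain ⟨⟨j, t⟩, ht, rfl⟩ := h
    rw [M.flip_f ht, M.f_eq, M.f_eq]
  · rw [M.flip_outside h]

lemma flip_flip (p : CurveParam n) : M.flip (M.flip p) = p := by
  by_cases h : p ∈ M.inside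
  · obtain ⟨⟨j, t⟩, ht, rfl⟩ := h
    have ht : t ∈ Set.Icc (-1 : ℝ) 1 := ht
    rw [M.flip_f ht, M.flip_f ⟨by linarith [ht.2], by linarith [ht.1]⟩, neg_neg]
  · rw [M.flip_outside h, M.flip_outside h]

lemma flip_mem (hT : T.InDisk) (hneg : ∀ x y : Fin k × ℝ, (x, y) ∈ T.crossings →
    ((x.1, -x.2), (y.1, -y.2)) ∈ T'.crossings) {x : CurveParam n × CurveParam n}
    (hx : x ∈ D.crossings) : (M.flip x.1, M.flip x.2) ∈ D'.crossings := by
  rcases M.crossing_cases hT hx with ⟨h1, h2⟩ | ⟨⟨y, z⟩, hyz, hy, hz, rfl⟩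
  · rw [M.flip_outside h1, M.flip_outside h2]
    exact (M.crossings_outside _ _ h1 h2).2 hx
  · simp only at hy hz ⊢
    rw [M.flip_f (j := y.1) hy, M.flip_f (j := z.1) hz]
    exact ((M.crossings_inside (y.1, -y.2) (z.1, -z.2) ⟨by linarith [hy.2], by linarith [hy.1]⟩
      ⟨by linarith [hz.2], by linarith [hz.1]⟩).2).2 (hneg _ _ hyz)

/-- The position of a point on its link component. -/
noncomputable def pos (p : CurveParam n) : ℝ := circleRep (M.base p.1) p.2

lemma pos_f {j : Fin k} {t : ℝ} (ht : t ∈ Set.Ioo (-1 : ℝ) 1) :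
    M.pos (M.f (j, t)) = M.center j + M.l j * t := by
  rw [← M.circleRep_f ht, pos, M.f_eq]

lemma pos_order {j : Fin k} {t t' : ℝ} (ht : t ∈ Set.Ioo (-1 : ℝ) 1)
    (ht' : t' ∈ Set.Ioo (-1 : ℝ) 1) {q : CurveParam n} (hq : q.1 = M.comp j)
    (hq' : ∀ t ∈ Set.Ioo (-1 : ℝ) 1, q ≠ M.f (j, t)) :
    (M.pos (M.f (j, t)) < M.pos q ↔ M.pos (M.f (j, t')) < M.pos q) ∧
    (M.pos q < M.pos (M.f (j, t)) ↔ M.pos q < M.pos (M.f (j, t'))) := by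
  rw [M.pos_f ht, M.pos_f ht', pos, hq]
  exact M.order_iff hq hq' ht ht'

/-- The reversal moves a point only within its arc, which does not affect its order relative to
points that are not on the same arc. -/
lemma pos_flip_lt_iff {p q : CurveParam n} (hpq : q.1 = p.1)
    (hp : p ∉ M.inside ∨ ∃ j, ∃ t ∈ Set.Ioo (-1 : ℝ) 1, p = M.f (j, t))
    (hq : q ∉ M.inside ∨ ∃ j, ∃ t ∈ Set.Ioo (-1 : ℝ) 1, q = M.f (j, t))
    (hne : ∀ j, ∀ t ∈ Set.Ioo (-1 : ℝ) 1, ∀ t' ∈ Set.Ioo (-1 : ℝ) 1, p = M.f (j, t) →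
      q ≠ M.f (j, t')) : M.pos (M.flip q) < M.pos (M.flip p) ↔ M.pos q < M.pos p := by
  have hIoo : ∀ {t : ℝ}, t ∈ Set.Ioo (-1 : ℝ) 1 → -t ∈ Set.Ioo (-1 : ℝ) 1 :=
    fun ht => ⟨by linarith [ht.2], by linarith [ht.1]⟩
  have h1 : M.pos (M.flip q) < M.pos (M.flip p) ↔ M.pos (M.flip q) < M.pos p := by
    rcases hp with hp | ⟨j, t, ht, rfl⟩
    · rw [M.flip_outside hp]
    · rw [M.flip_f (Set.Ioo_subset_Icc_self ht)]
      refine (M.pos_order (hIoo ht) ht ?_ ?_).2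
      · rw [M.flip_fst, hpq, M.f_eq]
      · intro t' ht' h
        refine hne j t ht (-t') (hIoo ht') rfl ?_
        rw [← M.flip_f (Set.Ioo_subset_Icc_self ht'), ← h, M.flip_flip]
  rw [h1]
  rcases hq with hq | ⟨j, t, ht, rfl⟩
  · rw [M.flip_outside hq]
  · rw [M.flip_f (Set.Ioo_subset_Icc_self ht)]
    refine (M.pos_order (hIoo ht) ht ?_ fun t' ht' h => hne j t' ht' t ht h rfl).1
    rw [← hpq, M.f_eq]

end LocalMoveData

end LinkDiagram

namespace LinkDiagram

open Isotropic Gauss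

variable {n : ℕ}

/-! ### The third Reidemeister move -/

/-- The third arc of a triangle. -/
def third (i j : Fin 3) : Fin 3 := -(i + j)

/-- The three elements of `Fin 3` have sum zero. -/
lemma third_ne_left {i j : Fin 3} (h : i ≠ j) : third i j ≠ i := by revert i j; decide

lemma third_ne_right {i j : Fin 3} (h : i ≠ j) : third i j ≠ j := by revert i j; decide

lemma third_third {i j : Fin 3} (h : i ≠ j) : third i (third i j) = j := by revert i j; decide

lemma eq_third {i j k : Fin 3} (h : i ≠ j) (hk : k ≠ i) (hk' : k ≠ j) : k = third i j := by
  revert i j k; decide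

lemma param_ne_param {i j k : Fin 3} (hj : j ≠ i) (hk : k ≠ i) (hjk : j ≠ k) :
    Tangle.param i j ≠ Tangle.param i k := by
  fin_cases i <;> fin_cases j <;> fin_cases k <;> first
    | exact absurd rfl hj
    | exact absurd rfl hk
    | exact absurd rfl hjk
    | (simp [Tangle.param]; norm_num)
    | simp [Tangle.param]

namespace LocalMoveData

variable {height : Equiv.Perm (Fin 3)} {D D' : LinkDiagram n}
  (M : LocalMoveData (Tangle.triangle 1 height) (Tangle.triangle (-1) height) D D')

/-- The crossing of two arcs of a triangle, as a pair of parameters. -/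
noncomputable def corner (i j : Fin 3) : CurveParam n × CurveParam n :=
  if height j < height i then (M.f (i, Tangle.param i j), M.f (j, Tangle.param j i))
  else (M.f (j, Tangle.param j i), M.f (i, Tangle.param i j))

lemma corner_comm {i j : Fin 3} (h : i ≠ j) : M.corner i j = M.corner j i := by
  rcases lt_or_gt_of_ne (height.injective.ne h) with h1 | h1
  · rw [corner, corner, if_neg (not_lt.2 h1.le), if_pos h1]
  · rw [corner, corner, if_pos h1, if_neg (not_lt.2 h1.le)]

lemma corner_of_lt {i j : Fin 3} (h : height j < height i) :
    M.corner i j = (M.f (i, Tangle.param i j), M.f (j, Tangle.param j i)) := if_pos h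

lemma corner_mem {i j : Fin 3} (h : i ≠ j) : M.corner i j ∈ D.crossings := by
  have key : ∀ {i j : Fin 3}, height j < height i → M.corner i j ∈ D.crossings := by
    intro i j h1
    rw [M.corner_of_lt h1]
    exact ((M.crossings_inside (i, _) (j, _) (Set.Ioo_subset_Icc_self (Tangle.param_mem i j))
      (Set.Ioo_subset_Icc_self (Tangle.param_mem j i))).1).2
      (Tangle.mem_crossings_triangle.2 ⟨h1, rfl, rfl⟩)
  rcases lt_or_gt_of_ne (height.injective.ne h) with h1 | h1
  · rw [M.corner_comm h]; exact key h1
  · exact key h1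

/-- The crossing of two arcs of a triangle. -/
noncomputable def vert (i j : Fin 3) (h : i ≠ j) : D.Vertex := ⟨M.corner i j, M.corner_mem h⟩

lemma vert_comm {i j : Fin 3} (h : i ≠ j) : M.vert i j h = M.vert j i h.symm :=
  Subtype.ext (M.corner_comm h)

/-- The passage, on the first arc, through the crossing of two arcs of a triangle. -/
noncomputable def pass (i j : Fin 3) (h : i ≠ j) : D.Passage :=
  (M.vert i j h, decide (height j < height i))

lemma passageParam_pass {i j : Fin 3} (h : i ≠ j) :
    D.passageParam (M.pass i j h) = M.f (i, Tangle.param i j) := by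
  by_cases h1 : height j < height i <;> simp [passageParam, pass, vert, corner, h1]

lemma pass_injective {i j i' j' : Fin 3} {h : i ≠ j} {h' : i' ≠ j'}
    (H : M.pass i j h = M.pass i' j' h') : i = i' ∧ j = j' := by
  have h1 := congrArg D.passageParam H
  rw [passageParam_pass, passageParam_pass] at h1
  have h2 := M.injOn (Set.Ioo_subset_Icc_self (Tangle.param_mem i j))
    (Set.Ioo_subset_Icc_self (Tangle.param_mem i' j')) h1
  have h3 : i = i' := congrArg Prod.fst h2
  subst h3
  refine ⟨rfl, ?_⟩
  by_contra h4
  exact param_ne_param h.symm h'.symm h4 (congrArg Prod.snd h2)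

lemma vert_cases {i j : Fin 3} (h : i ≠ j) (b : Bool) :
    (M.vert i j h, b) = M.pass i j h ∨ (M.vert i j h, b) = M.pass j i h.symm := by
  rcases lt_or_gt_of_ne (height.injective.ne h) with h1 | h1 <;> cases b <;>
    simp [pass, M.vert_comm h, h1, h1.le]

lemma pass_cases {i j : Fin 3} (h : i ≠ j) :
    ((M.vert i j h, true) = M.pass i j h ∧ (M.vert i j h, false) = M.pass j i h.symm) ∨
      ((M.vert i j h, true) = M.pass j i h.symm ∧ (M.vert i j h, false) = M.pass i j h) := by
  rcases lt_or_gt_of_ne (height.injective.ne h) with h1 | h1 <;>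
    simp [pass, M.vert_comm h, h1, h1.le]

open scoped Classical in
/-- The three crossings of a triangle. -/
noncomputable def corners : Finset D.Vertex :=
  {M.vert 0 1 (by decide), M.vert 0 2 (by decide), M.vert 1 2 (by decide)}

lemma mem_corners_iff {x : D.Vertex} : x ∈ M.corners ↔ x = M.vert 0 1 (by decide) ∨
    x = M.vert 0 2 (by decide) ∨ x = M.vert 1 2 (by decide) := by
  simp [corners]

lemma vert_mem {i j : Fin 3} (h : i ≠ j) : M.vert i j h ∈ M.corners := by
  rw [mem_corners_iff]
  fin_cases i <;> fin_cases j
  · exact absurd rfl h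
  · exact Or.inl rfl
  · exact Or.inr (Or.inl rfl)
  · exact Or.inl (M.vert_comm h)
  · exact absurd rfl h
  · exact Or.inr (Or.inr rfl)
  · exact Or.inr (Or.inl (M.vert_comm h))
  · exact Or.inr (Or.inr (M.vert_comm h))
  · exact absurd rfl h

lemma exists_vert {x : D.Vertex} (hx : x ∈ M.corners) : ∃ i j h, x = M.vert i j h := by
  rcases M.mem_corners_iff.1 hx with h | h | h <;> exact ⟨_, _, _, h⟩

lemma exists_pass {p : D.Passage} (hp : p.1 ∈ M.corners) : ∃ i j h, p = M.pass i j h := by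
  obtain ⟨x, b⟩ := p
  obtain ⟨i, j, h, rfl⟩ := M.exists_vert hp
  rcases M.vert_cases h b with h1 | h1
  · exact ⟨_, _, _, h1⟩
  · exact ⟨_, _, _, h1⟩

lemma outside_of_notMem {x : D.Vertex} (hx : x ∉ M.corners) :
    x.1.1 ∉ M.inside ∧ x.1.2 ∉ M.inside := by
  rcases M.crossing_cases (Tangle.inDisk_triangle (by norm_num) height) x.2 with h |
    ⟨⟨y, z⟩, hyz, -, -, hx'⟩
  · exact h
  · exfalso
    obtain ⟨h1, h2, h3⟩ := Tangle.mem_crossings_triangle.1 hyz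
    have hne : y.1 ≠ z.1 := fun h => by rw [h] at h1; exact lt_irrefl _ h1
    apply hx
    have : x = M.vert y.1 z.1 hne := by
      refine Subtype.ext (hx'.trans ?_)
      change _ = M.corner y.1 z.1
      rw [M.corner_of_lt h1, ← h2, ← h3]
    rw [this]
    exact M.vert_mem hne

lemma passage_outside {p : D.Passage} (hp : p.1 ∉ M.corners) : D.passageParam p ∉ M.inside := by
  have h := M.outside_of_notMem hp
  obtain ⟨x, b⟩ := p
  cases b
  · exact h.2
  · exact h.1

lemma vert_ne {a b c : Fin 3} (h : a ≠ b) (h' : a ≠ c) (hbc : b ≠ c) :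
    M.vert a b h ≠ M.vert a c h' := by
  intro H
  rcases M.vert_cases h (decide (height c < height a)) with h1 | h1
  · exact hbc (M.pass_injective (h1.symm.trans (by rw [H]; rfl) : _ = M.pass a c h')).2
  · exact h (M.pass_injective (h1.symm.trans (by rw [H]; rfl) : _ = M.pass a c h')).1.symm

lemma vert_ne₁ : M.vert 0 1 (by decide) ≠ M.vert 0 2 (by decide) := M.vert_ne _ _ (by decide)

lemma vert_ne₂ : M.vert 0 1 (by decide) ≠ M.vert 1 2 (by decide) := by
  rw [M.vert_comm (by decide : (0 : Fin 3) ≠ 1)]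
  exact M.vert_ne _ _ (by decide)

lemma vert_ne₃ : M.vert 0 2 (by decide) ≠ M.vert 1 2 (by decide) := by
  rw [M.vert_comm (by decide : (0 : Fin 3) ≠ 2), M.vert_comm (by decide : (1 : Fin 3) ≠ 2)]
  exact M.vert_ne _ _ (by decide)

lemma sum_corners (j : D.Vertex → ZMod 2) {a b : Fin 3} (h : a ≠ b) : ∑ x ∈ M.corners, j x =
    j (M.vert a b h) + j (M.vert a (third a b) (third_ne_left h).symm) +
      j (M.vert b (third a b) (third_ne_right h).symm) := by
  rw [sum_three M.vert_ne₁ M.vert_ne₂ M.vert_ne₃ (fun x => M.mem_corners_iff)]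
  have h10 := M.vert_comm (by decide : (1 : Fin 3) ≠ 0)
  have h20 := M.vert_comm (by decide : (2 : Fin 3) ≠ 0)
  have h21 := M.vert_comm (by decide : (2 : Fin 3) ≠ 1)
  fin_cases a <;> fin_cases b
  · exact absurd rfl h
  · change _ = j (M.vert 0 1 _) + j (M.vert 0 2 _) + j (M.vert 1 2 _)
    rfl
  · change _ = j (M.vert 0 2 _) + j (M.vert 0 1 _) + j (M.vert 2 1 _)
    rw [h21]; abel
  · change _ = j (M.vert 1 0 _) + j (M.vert 1 2 _) + j (M.vert 0 2 _)
    rw [h10]; abel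
  · exact absurd rfl h
  · change _ = j (M.vert 1 2 _) + j (M.vert 1 0 _) + j (M.vert 2 0 _)
    rw [h10, h20]; abel
  · change _ = j (M.vert 2 0 _) + j (M.vert 2 1 _) + j (M.vert 0 1 _)
    rw [h20, h21]; abel
  · change _ = j (M.vert 2 1 _) + j (M.vert 2 0 _) + j (M.vert 1 0 _)
    rw [h10, h20, h21]; abel
  · exact absurd rfl h

open scoped Classical in
/-- The other passage on the same arc of a triangle. -/
noncomputable def other (p : D.Passage) : D.Passage :=
  if h : ∃ x : {x : Fin 3 × Fin 3 // x.1 ≠ x.2}, p = M.pass x.1.1 x.1.2 x.2 then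
    M.pass h.choose.1.1 (third h.choose.1.1 h.choose.1.2) (third_ne_left h.choose.2).symm
  else p

lemma other_pass {i j : Fin 3} (h : i ≠ j) :
    M.other (M.pass i j h) = M.pass i (third i j) (third_ne_left h).symm := by
  have hex : ∃ x : {x : Fin 3 × Fin 3 // x.1 ≠ x.2},
    M.pass i j h = M.pass x.1.1 x.1.2 x.2 := ⟨⟨(i, j), h⟩, rfl⟩
  rw [other, dif_pos hex]
  have h1 := M.pass_injective hex.choose_spec
  have key : ∀ {i' j' : Fin 3} (h' : i' ≠ j'), i = i' → j = j' →
      M.pass i' (third i' j') (third_ne_left h').symm =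
        M.pass i (third i j) (third_ne_left h).symm := by
    rintro _ _ _ rfl rfl; rfl
  exact key hex.choose.2 h1.1 h1.2

lemma passageParam_ne {i j : Fin 3} (h : i ≠ j) {q : D.Passage} (hq : q ≠ M.pass i j h)
    (hq' : q ≠ M.other (M.pass i j h)) :
    ∀ t ∈ Set.Ioo (-1 : ℝ) 1, D.passageParam q ≠ M.f (i, t) := by
  intro t ht H
  by_cases hqS : q.1 ∈ M.corners
  · obtain ⟨i', j', h', rfl⟩ := M.exists_pass hqS
    rw [passageParam_pass] at H
    have h1 : i' = i := congrArg Prod.fst (M.injOn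
      (Set.Ioo_subset_Icc_self (Tangle.param_mem i' j')) (Set.Ioo_subset_Icc_self ht) H)
    subst h1
    have h2 : j' ≠ j := fun h2 => by subst h2; exact hq rfl
    rw [other_pass] at hq'
    have h3 := eq_third h h'.symm h2
    subst h3
    exact hq' rfl
  · exact M.ne_of_notMem_inside (M.passage_outside hqS) i t ht H

/-- The sides of the triangle join the two corners on each arc. -/
lemma isMatching_other :
    IsMatching D.passageComp (D.position M.base) M.corners M.other := by
  refine ⟨?_, ?_, ?_, ?_, ?_⟩ <;> intro p hp <;> obtain ⟨i, j, h, rfl⟩ := M.exists_pass hp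
  · rw [other_pass]; exact M.vert_mem (third_ne_left h).symm
  · rw [other_pass, other_pass]
    congr 1
    exact third_third h
  · rw [other_pass]
    exact fun H => third_ne_right h (M.pass_injective H).2
  · rw [other_pass, M.passageComp_eq (M.passageParam_pass (third_ne_left h).symm),
      M.passageComp_eq (M.passageParam_pass h)]
  · intro q hq hq' hqc
    have h1 := M.passageParam_ne h hq hq'
    rw [other_pass]
    exact (M.position_order (Tangle.param_mem _ _) (Tangle.param_mem _ _)
      (M.passageParam_pass _) (M.passageParam_pass _) hqc h1).1

/-! #### The diagram after the move -/

lemma flip_crossing {x : CurveParam n × CurveParam n} (hx : x ∈ D.crossings) :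
    (M.flip x.1, M.flip x.2) ∈ D'.crossings :=
  M.flip_mem (Tangle.inDisk_triangle (by norm_num) height)
    (fun _ _ h => Tangle.crossings_triangle_neg 1 height h) hx

lemma flip_crossing_symm {x : CurveParam n × CurveParam n} (hx : x ∈ D'.crossings) :
    (M.flip x.1, M.flip x.2) ∈ D.crossings :=
  M.symm.flip_mem (Tangle.inDisk_triangle (by norm_num) height)
    (fun _ _ h => by simpa using Tangle.crossings_triangle_neg (-1) height h) hx

/-- The correspondence of the crossings. -/
noncomputable def moveVertex (v : D.Vertex) : D'.Vertex :=
  ⟨(M.flip v.1.1, M.flip v.1.2), M.flip_crossing v.2⟩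

lemma moveVertex_bijective : Function.Bijective M.moveVertex := by
  refine Function.bijective_iff_has_inverse.2
    ⟨fun v => ⟨(M.flip v.1.1, M.flip v.1.2), M.flip_crossing_symm v.2⟩, fun v => ?_, fun v => ?_⟩
  · exact Subtype.ext (Prod.ext (M.flip_flip _) (M.flip_flip _))
  · exact Subtype.ext (Prod.ext (M.flip_flip _) (M.flip_flip _))

lemma passageParam_moveVertex (p : D.Passage) :
    D'.passageParam (M.moveVertex p.1, p.2) = M.flip (D.passageParam p) := by
  obtain ⟨v, b⟩ := p
  cases b <;> rfl

lemma position_moveVertex (p : D.Passage) :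
    D'.position M.base (M.moveVertex p.1, p.2) = M.pos (M.flip (D.passageParam p)) := by
  rw [position, passageComp, passageParam_moveVertex]; rfl

/-- Reversing the arcs exchanges the two corners on each arc and changes no other order. The
partners of a corner along its two arcs are the other two corners, which gives the formula for
`phi`. -/
lemma gaussSpace_moveVertex : gaussSpace D.passageComp
    (fun p => D'.position M.base (M.moveVertex p.1, p.2)) = phiSpace M.corners D.space := by
  rw [D.space_eq M.base]
  have hposn : ∀ p, D.position M.base p = M.pos (D.passageParam p) := fun _ => rfl
  refine M.isMatching_other.gaussSpace_eq_phiSpace ?_ ?_ ?_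
  · intro p q hqp hne hnot
    rw [position_moveVertex, position_moveVertex, hposn, hposn]
    have hpos : ∀ p : D.Passage, D.passageParam p ∉ M.inside ∨
        ∃ j, ∃ t ∈ Set.Ioo (-1 : ℝ) 1, D.passageParam p = M.f (j, t) := by
      intro p
      by_cases hp : p.1 ∈ M.corners
      · obtain ⟨i, j, h, rfl⟩ := M.exists_pass hp
        exact Or.inr ⟨i, _, Tangle.param_mem i j, M.passageParam_pass h⟩
      · exact Or.inl (M.passage_outside hp)
    refine M.pos_flip_lt_iff hqp (hpos p) (hpos q) ?_
    intro j t ht t' ht' hpt hqt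
    have hpS : p.1 ∈ M.corners := by
      by_contra hpS
      exact M.ne_of_notMem_inside (M.passage_outside hpS) j t ht hpt
    obtain ⟨i, j', h, rfl⟩ := M.exists_pass hpS
    have hij : i = j := congrArg Prod.fst (M.injOn
      (Set.Ioo_subset_Icc_self (Tangle.param_mem i j')) (Set.Ioo_subset_Icc_self ht)
      ((M.passageParam_pass h).symm.trans hpt))
    subst hij
    exact M.passageParam_ne h hne (fun H => hnot ⟨hpS, H⟩) t' ht' hqt
  · intro p hp
    obtain ⟨i, j, h, rfl⟩ := M.exists_pass hp
    have hIoo : ∀ i j, -Tangle.param i j ∈ Set.Ioo (-1 : ℝ) 1 := fun i j =>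
      ⟨by linarith [(Tangle.param_mem i j).2], by linarith [(Tangle.param_mem i j).1]⟩
    rw [position_moveVertex, position_moveVertex, other_pass, hposn, hposn, passageParam_pass,
      passageParam_pass, M.flip_f (Set.Ioo_subset_Icc_self (Tangle.param_mem _ _)),
      M.flip_f (Set.Ioo_subset_Icc_self (Tangle.param_mem _ _)), M.pos_f (hIoo _ _),
      M.pos_f (hIoo _ _), M.pos_f (Tangle.param_mem _ _), M.pos_f (Tangle.param_mem _ _)]
    have hne : M.l i * Tangle.param i j ≠ M.l i * Tangle.param i (third i j) :=
      fun H => param_ne_param h.symm (third_ne_left h) (third_ne_right h).symm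
        (mul_left_cancel₀ (M.l_ne_zero i) H)
    rw [not_lt]
    constructor
    · intro h1; linarith
    · intro h1
      have := lt_of_le_of_ne (by linarith) hne
      linarith
  · intro v hv j
    obtain ⟨a, b, h, rfl⟩ := M.exists_vert hv
    rw [M.sum_corners j h]
    have h3 : third b a = third a b := by rw [third, third, add_comm]
    have key : j (M.other (M.pass a b h)).1 + j (M.other (M.pass b a h.symm)).1 =
        j (M.vert a b h) + j (M.vert a (third a b) (third_ne_left h).symm) +
        j (M.vert b (third a b) (third_ne_right h).symm) + j (M.vert a b h) := by
      rw [other_pass, other_pass]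
      simp only [pass, h3]
      linear_combination (-1 : ZMod 2) * zmod_add_self (j (M.vert a b h))
    rcases M.pass_cases h with ⟨h1, h2⟩ | ⟨h1, h2⟩
    · rw [h1, h2, key]
    · rw [h1, h2, add_comm, key]

lemma mem_space_moveVertex (a : D'.Vertex → Klein) :
    a ∘ M.moveVertex ∈ phiSpace M.corners D.space ↔ a ∈ D'.space := by
  rw [← M.gaussSpace_moveVertex, D'.space_eq M.base]
  rw [isSmoothing_gaussSpace (κ' := D'.passageComp) (t' := D'.position M.base)
    M.moveVertex_bijective.1 (Equiv.refl _) (fun v b => ?_) (fun p q _ => Iff.rfl)]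
  · constructor
    · rintro ⟨a', ha', h, -⟩
      rwa [← M.moveVertex_bijective.2.injective_comp_right h]
    · intro h
      exact ⟨a, h, rfl, fun w hw => absurd (M.moveVertex_bijective.2 w) hw⟩
  · rw [passageComp, M.passageParam_moveVertex (v, b), M.flip_fst]; rfl

include M in
lemma meets_iff (a b : Fin n) : D.Meets a b ↔ D'.Meets a b := by
  constructor
  · rintro ⟨x, hx, rfl, rfl⟩
    exact ⟨_, M.flip_crossing hx, M.flip_fst _, M.flip_fst _⟩
  · rintro ⟨x, hx, rfl, rfl⟩
    exact ⟨_, M.flip_crossing_symm hx, M.flip_fst _, M.flip_fst _⟩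

/-- The half turn and the reversal of the parameter cancel in the derivative, so the velocities at
corresponding corners agree. -/
lemma isNegative_moveVertex (v : D.Vertex) :
    D'.IsNegative (M.moveVertex v).1 ↔ D.IsNegative v.1 := by
  by_cases hv : v ∈ M.corners
  · have key : ∀ {i j : Fin 3} (h : i ≠ j), height j < height i →
        (D'.IsNegative (M.moveVertex (M.vert i j h)).1 ↔ D.IsNegative (M.vert i j h).1) := by
      intro i j h hlt
      have h1 : (M.vert i j h).1 = (M.f (i, Tangle.param i j), M.f (j, Tangle.param j i)) :=
        M.corner_of_lt hlt
      have h2 : (M.moveVertex (M.vert i j h)).1 =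
          (M.f (i, -Tangle.param i j), M.f (j, -Tangle.param j i)) := by
        change (M.flip (M.vert i j h).1.1, M.flip (M.vert i j h).1.2) = _
        rw [h1, M.flip_f (Set.Ioo_subset_Icc_self (Tangle.param_mem _ _)),
          M.flip_f (Set.Ioo_subset_Icc_self (Tangle.param_mem _ _))]
      have hIoo : ∀ i j, -Tangle.param i j ∈ Set.Ioo (-1 : ℝ) 1 := fun i j =>
        ⟨by linarith [(Tangle.param_mem i j).2], by linarith [(Tangle.param_mem i j).1]⟩
      have hpath := (Tangle.path_eq_iff height h
        (Set.Ioo_subset_Icc_self (Tangle.param_mem i j))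
        (Set.Ioo_subset_Icc_self (Tangle.param_mem j i))).2 ⟨rfl, rfl⟩
      have hpath' : (Tangle.triangle (-1) height).path i (-Tangle.param i j) =
          (Tangle.triangle (-1) height).path j (-Tangle.param j i) := by
        rw [Tangle.triangle_neg, Tangle.triangle_neg, hpath]
      rw [h1, h2]
      have h3 := M.isNegative_inside (x := (i, Tangle.param i j)) (y := (j, Tangle.param j i))
        (Tangle.param_mem i j) (Tangle.param_mem j i) hpath
        (Tangle.hasDerivAt_triangle 1 height i _) (Tangle.hasDerivAt_triangle 1 height j _)
      have h4 := M.symm.isNegative_inside (x := (i, -Tangle.param i j))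
        (y := (j, -Tangle.param j i)) (hIoo i j) (hIoo j i) hpath'
        (Tangle.hasDerivAt_triangle (-1) height i _) (Tangle.hasDerivAt_triangle (-1) height j _)
      have h5 : ∀ i t, Tangle.triangleVelocity (-1) i (-t) = Tangle.triangleVelocity 1 i t := by
        intro i t; simp [Tangle.triangleVelocity]
      rw [h5, h5] at h4
      exact h4.trans h3.symm
    obtain ⟨i, j, h, rfl⟩ := M.exists_vert hv
    rcases lt_or_gt_of_ne (height.injective.ne h) with h1 | h1
    · rw [M.vert_comm h]; exact key _ h1
    · exact key h h1
  · have h1 := M.outside_of_notMem hv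
    have h2 : (M.moveVertex v).1 = v.1 :=
      Prod.ext (M.flip_outside h1.1) (M.flip_outside h1.2)
    rw [h2]
    exact M.isNegative_outside h1.1 h1.2

/-! #### Types and signs of the crossings -/

lemma other_lt_iff {i j : Fin 3} (h : i ≠ j) :
    D.position M.base (M.other (M.pass i j h)) < D.position M.base (M.pass i j h) ↔
      (0 < M.l i ↔ 0 < Tangle.param i j - Tangle.param i (third i j)) := by
  have hne : Tangle.param i j - Tangle.param i (third i j) ≠ 0 :=
    sub_ne_zero.2 (param_ne_param h.symm (third_ne_left h) (third_ne_right h).symm)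
  rw [other_pass, M.position_eq (Tangle.param_mem _ _) (M.passageParam_pass _),
    M.position_eq (Tangle.param_mem _ _) (M.passageParam_pass _),
    ← mul_pos_iff_of_ne (M.l_ne_zero i) hne, mul_sub, sub_pos, add_lt_add_iff_left]

/-- The corner is oriented if one of its two sides arrives and the other leaves. On an arc this is
decided by the order of the parameters of its corners and by the sign of its speed. -/
lemma matchVec_eq_o {i j : Fin 3} (h : i ≠ j) :
    matchVec (D.position M.base) M.corners M.other (M.vert i j h) = o ↔
      ¬ ((0 < M.l i ↔ 0 < Tangle.param i j - Tangle.param i (third i j)) ↔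
        (0 < M.l j ↔ 0 < Tangle.param j i - Tangle.param j (third i j))) := by
  have h3 : third j i = third i j := by rw [third, third, add_comm]
  have h4 := M.other_lt_iff h
  have h5 := M.other_lt_iff h.symm
  rw [h3] at h5
  have hdo : ¬ (d = o) := by decide
  rw [matchVec, if_pos (M.vert_mem h), ← h4, ← h5]
  rcases M.pass_cases h with ⟨h1, h2⟩ | ⟨h1, h2⟩
  · rw [h1, h2]
    split_ifs with h6
    exacts [iff_of_false hdo (not_not.2 h6), iff_of_true rfl h6]
  · rw [h1, h2]
    split_ifs with h6
    exacts [iff_of_false hdo (not_not.2 h6.symm), iff_of_true rfl fun h => h6 h.symm]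

lemma isNegative_vert {i j : Fin 3} (h : i ≠ j) {c : ℝ} (hc : c ≠ 0)
    (hdet : planeDet (Tangle.triangleVelocity 1 i (Tangle.param i j))
      (Tangle.triangleVelocity 1 j (Tangle.param j i)) = c) :
    D.IsNegative (M.vert i j h).1 ↔
      ¬ (((0 < M.orient ↔ (0 < M.l i ↔ 0 < M.l j)) ↔ 0 < c) ↔ height j < height i) := by
  have hpath := (Tangle.path_eq_iff height h
    (Set.Ioo_subset_Icc_self (Tangle.param_mem i j))
    (Set.Ioo_subset_Icc_self (Tangle.param_mem j i))).2 ⟨rfl, rfl⟩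
  have hll := mul_ne_zero (M.l_ne_zero i) (M.l_ne_zero j)
  have holl := mul_ne_zero M.orient_ne_zero hll
  have hsign := mul_pos_iff_of_ne holl hc
  rw [mul_pos_iff_of_ne M.orient_ne_zero hll,
    mul_pos_iff_of_ne (M.l_ne_zero i) (M.l_ne_zero j)] at hsign
  rw [← hsign]
  rcases lt_or_gt_of_ne (height.injective.ne h) with h1 | h1
  · have h2 : (M.vert i j h).1 = (M.f (j, Tangle.param j i), M.f (i, Tangle.param i j)) :=
      (M.corner_comm h).trans (M.corner_of_lt h1)
    rw [h2, M.isNegative_inside (x := (j, Tangle.param j i)) (y := (i, Tangle.param i j))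
        (Tangle.param_mem j i) (Tangle.param_mem i j) hpath.symm
        (Tangle.hasDerivAt_triangle 1 height j _) (Tangle.hasDerivAt_triangle 1 height i _),
      planeDet_comm, hdet, mul_neg, neg_lt_zero, mul_comm (M.l j)]
    simp [not_lt.2 h1.le]
  · have h2 : (M.vert i j h).1 = (M.f (i, Tangle.param i j), M.f (j, Tangle.param j i)) :=
      M.corner_of_lt h1
    rw [h2, M.isNegative_inside (x := (i, Tangle.param i j)) (y := (j, Tangle.param j i))
        (Tangle.param_mem i j) (Tangle.param_mem j i) hpath
        (Tangle.hasDerivAt_triangle 1 height i _) (Tangle.hasDerivAt_triangle 1 height j _), hdet]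
    simp only [h1, iff_true, not_lt]
    exact ⟨le_of_lt, fun h => lt_of_le_of_ne h (mul_ne_zero holl hc)⟩

end LocalMoveData

/-- At each corner, comparing the sign with the type eliminates the directions of the arcs: only the
orientation of the disk and the relative height of the two strands remain. Equality at all three
corners would make the heights cyclically ordered. -/
theorem equiv_of_reidemeister3 {D D' : LinkDiagram n} {height : Equiv.Perm (Fin 3)}
    (h : IsLocalMove (Tangle.triangle 1 height) (Tangle.triangle (-1) height) D D') :
    D.toState.Equiv D'.toState := by
  classical
  obtain ⟨M⟩ := h.exists_data
  have hm := M.isMatching_other.matchVec_mem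
  rw [← D.space_eq M.base] at hm
  -- The constant c is the determinant of the two tangle velocities at the corner; only its sign
  -- matters.
  have hu : (D.IsNegative (M.vert 0 1 (by decide)).1 ↔
      matchVec (D.position M.base) M.corners M.other (M.vert 0 1 (by decide)) = o) ↔
      (0 < M.orient ↔ height 1 < height 0) := by
    rw [M.matchVec_eq_o, M.isNegative_vert (c := 4 / 3) _ (by norm_num)
      (by simp [planeDet, Tangle.triangleVelocity, Tangle.param]; norm_num)]
    have e1 : (0 : ℝ) < Tangle.param 0 1 - Tangle.param 0 (third 0 1) := by
      change (0 : ℝ) < 1 / 2 - -1 / 2; norm_num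
    have e2 : (0 : ℝ) < Tangle.param 1 0 - Tangle.param 1 (third 0 1) := by
      change (0 : ℝ) < 5 / 6 - 0; norm_num
    simp only [e1, e2, show (0 : ℝ) < 4 / 3 by norm_num, iff_true]
    generalize (0 < M.orient) = O
    generalize (0 < M.l 0) = P
    generalize (0 < M.l 1) = Q
    generalize (height 1 < height 0) = R
    by_cases O <;> by_cases P <;> by_cases Q <;> by_cases R <;> simp [*]
  have hv : (D.IsNegative (M.vert 0 2 (by decide)).1 ↔
      matchVec (D.position M.base) M.corners M.other (M.vert 0 2 (by decide)) = o) ↔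
      ¬ (0 < M.orient ↔ height 2 < height 0) := by
    rw [M.matchVec_eq_o, M.isNegative_vert (c := -4 / 3) _ (by norm_num)
      (by simp [planeDet, Tangle.triangleVelocity, Tangle.param]; norm_num)]
    have e1 : ¬ (0 : ℝ) < Tangle.param 0 2 - Tangle.param 0 (third 0 2) := by
      change ¬ (0 : ℝ) < -1 / 2 - 1 / 2; norm_num
    have e2 : ¬ (0 : ℝ) < Tangle.param 2 0 - Tangle.param 2 (third 0 2) := by
      change ¬ (0 : ℝ) < -5 / 6 - 0; norm_num
    simp only [e1, e2, show ¬ (0 : ℝ) < -4 / 3 by norm_num, iff_false]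
    generalize (0 < M.orient) = O
    generalize (0 < M.l 0) = P
    generalize (0 < M.l 2) = Q
    generalize (height 2 < height 0) = R
    by_cases O <;> by_cases P <;> by_cases Q <;> by_cases R <;> simp [*]
  have hw : (D.IsNegative (M.vert 1 2 (by decide)).1 ↔
      matchVec (D.position M.base) M.corners M.other (M.vert 1 2 (by decide)) = o) ↔
      (0 < M.orient ↔ height 2 < height 1) := by
    rw [M.matchVec_eq_o, M.isNegative_vert (c := -24 / 25) _ (by norm_num)
      (by simp [planeDet, Tangle.triangleVelocity]; norm_num)]
    have e1 : ¬ (0 : ℝ) < Tangle.param 1 2 - Tangle.param 1 (third 1 2) := by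
      change ¬ (0 : ℝ) < 0 - 5 / 6; norm_num
    have e2 : (0 : ℝ) < Tangle.param 2 1 - Tangle.param 2 (third 1 2) := by
      change (0 : ℝ) < 0 - -5 / 6; norm_num
    simp only [e1, e2, show ¬ (0 : ℝ) < -24 / 25 by norm_num, iff_false, iff_true]
    generalize (0 < M.orient) = O
    generalize (0 < M.l 1) = P
    generalize (0 < M.l 2) = Q
    generalize (height 2 < height 1) = R
    by_cases O <;> by_cases P <;> by_cases Q <;> by_cases R <;> simp [*]
  have h3 := State.reidemeister3 D.isLagrangian_space (fun v => D.IsNegative v.1)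
    (D.componentCount - 1) (u := M.vert 0 1 (by decide)) (v := M.vert 0 2 (by decide))
    (w := M.vert 1 2 (by decide)) M.vert_ne₁ M.vert_ne₂ M.vert_ne₃ (fun x => M.mem_corners_iff) _ hm
    (fun x hx => by rw [matchVec, if_neg hx]) (fun x hx => by
      rw [matchVec, if_pos hx]; split_ifs; exacts [Or.inr rfl, Or.inl rfl]) (by
      rw [hu, hv, hw]
      by_cases hO : 0 < M.orient
      · simp only [hO, true_iff]
        rintro ⟨h1, h2⟩
        omega
      · simp only [hO, false_iff]
        rintro ⟨h1, h2⟩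
        have h4 := height.injective.ne (by decide : (0 : Fin 3) ≠ 1)
        have h5 := height.injective.ne (by decide : (0 : Fin 3) ≠ 2)
        have h6 := height.injective.ne (by decide : (1 : Fin 3) ≠ 2)
        omega)
  refine State.Equiv.trans h3 (State.Equiv.symm ?_)
  refine State.equiv_of_bijective
    (S := State.mk D.Vertex (phiSpace M.corners D.space) (fun v => D.IsNegative v.1)
      (D.componentCount - 1) (D.isLagrangian_space.phiSpace _)) (S' := D'.toState)
    M.moveVertex M.moveVertex_bijective M.mem_space_moveVertex M.isNegative_moveVertex ?_
  change D.componentCount - 1 = D'.componentCount - 1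
  rw [componentCount_eq, componentCount_eq]
  have : D.Meets = D'.Meets := funext fun a => funext fun b => propext (M.meets_iff a b)
  rw [this]

end LinkDiagram

namespace LinkDiagram

open Isotropic Gauss Filter Topology

variable {n : ℕ} {D D' : LinkDiagram n}

/-! ### Moves which preserve the crossings -/

/-- The order of the passages and the components of the universe graph depend only on the set of
classical crossings; the curves enter through the signs alone. -/
lemma equiv_of_crossings_eq (h : D'.crossings = D.crossings)
    (hneg : ∀ x ∈ D.crossings, (D'.IsNegative x ↔ D.IsNegative x)) :
    D.toState.Equiv D'.toState := by
  have hsub : D.crossings ⊆ D'.crossings := h.ge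
  let ι : D.Vertex → D'.Vertex := fun v => ⟨v.1, hsub v.2⟩
  have hι : Function.Bijective ι :=
    ⟨fun v w hvw => Subtype.ext (congrArg (fun x => x.1) hvw), fun v => ⟨⟨v.1, h ▸ v.2⟩, rfl⟩⟩
  refine (State.equiv_of_bijective (S := D.toState) (S' := D'.toState) ι hι ?_
    (fun v => hneg v.1 v.2) ?_).symm
  · intro a
    refine (isSmoothing_of_subset hsub _).trans ⟨?_, fun ha => ?_⟩
    · rintro ⟨a', ha', h, -⟩
      rwa [← hι.2.injective_comp_right h]
    · exact ⟨a, ha, rfl, fun w hw => absurd (hι.2 w) hw⟩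
  · change D.componentCount - 1 = D'.componentCount - 1
    have : D.Meets = D'.Meets := by
      funext i i'
      rw [Meets, Meets, h]
    rw [componentCount_eq, componentCount_eq, this]

lemma differentiableAt_crossing {x : CurveParam n × CurveParam n} (hx : x ∈ D.crossings) :
    HasDerivAt (fun t : ℝ => D.curve x.1.1 (x.1.2 + (t : UnitAddCircle))) (D.velocity x.1) 0 ∧
    HasDerivAt (fun t : ℝ => D.curve x.2.1 (x.2.2 + (t : UnitAddCircle))) (D.velocity x.2) 0 ∧
    planeDet (D.velocity x.1) (D.velocity x.2) ≠ 0 := by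
  obtain ⟨h1, h2⟩ := D.crossing_double x hx
  obtain ⟨h3, h4, h5⟩ := D.transverse _ _ h1 h2
  exact ⟨h3.hasDerivAt, h4.hasDerivAt, h5⟩

theorem equiv_of_isotopy (h : IsPlanarIsotopy D D') : D.toState.Equiv D'.toState := by
  obtain ⟨φ, hφ, hdet, hpt, hc⟩ := h
  refine equiv_of_crossings_eq hc fun x hx => ?_
  obtain ⟨h1, h2, -⟩ := differentiableAt_crossing hx
  have key : ∀ {p : CurveParam n} {v : ℂ},
      HasDerivAt (fun t : ℝ => D.curve p.1 (p.2 + (t : UnitAddCircle))) v 0 →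
      D'.velocity p = fderiv ℝ φ (D.pt p) v := by
    intro p v hv
    have h3 : D.curve p.1 (p.2 + ((0 : ℝ) : UnitAddCircle)) = D.pt p := by simp [pt]
    have h4 : HasFDerivAt φ (fderiv ℝ φ (D.pt p))
        (D.curve p.1 (p.2 + ((0 : ℝ) : UnitAddCircle))) := by
      rw [h3]; exact (hφ.differentiableAt _).hasFDerivAt
    have h5 := (HasFDerivAt.comp_hasDerivAt 0 h4 hv).deriv
    rw [← h5]
    exact congrArg (fun f : ℝ → ℂ => deriv f 0) (funext fun t => hpt (p.1, p.2 + t))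
  have hdbl : D.pt x.1 = D.pt x.2 := (D.crossing_double x hx).2
  rw [IsNegative, IsNegative, key h1, key h2, ← hdbl, planeDet_map, mul_comm,
    mul_neg_iff_neg_of_pos (hdet _)]

theorem equiv_of_detour (h : IsDetourMove D D') : D.toState.Equiv D'.toState := by
  obtain ⟨i, a, b, -, -, hpass, hpt, hc⟩ := h
  refine equiv_of_crossings_eq hc fun x hx => ?_
  let U : Set (CurveParam n) := (fun t : ℝ => (i, (t : UnitAddCircle))) '' Set.Icc a b
  have hU : IsClosed U :=
    (isCompact_Icc.image (continuous_const.prodMk (AddCircle.continuous_mk' 1))).isClosed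
  have hUpt : ∀ q, q ∉ U → D'.pt q = D.pt q := fun q hq =>
    hpt q fun t ht h => hq ⟨t, Set.Ioo_subset_Icc_self ht, h.symm⟩
  have hUp : ∀ p, D.IsPassage p → p ∉ U := by
    rintro _ hp ⟨t, ht, rfl⟩
    exact hpass t ht hp
  rw [IsNegative, IsNegative, velocity_congr hU (hUp _ ⟨x, hx, Or.inl rfl⟩) hUpt,
    velocity_congr hU (hUp _ ⟨x, hx, Or.inr rfl⟩) hUpt]

/-! ### Reparametrizations -/

/-- The change of parameter need not be assumed differentiable. The difference quotients of c and c'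
differ by a positive factor, which is the quotient of their norms and hence converges to ‖v‖ / ‖v'‖.
-/
lemma exists_pos_smul {c c' : ℝ → ℂ} {θ : ℝ ≃o ℝ} {s : ℝ} {v v' : ℂ} (hc : HasDerivAt c v s)
    (hc' : HasDerivAt c' v' (θ s)) (h : ∀ t, c' (θ t) = c t) (hv : v ≠ 0) (hv' : v' ≠ 0) :
    ∃ r : ℝ, 0 < r ∧ v = r • v' := by
  rw [hasDerivAt_iff_tendsto_slope] at hc hc'
  have hθ : Tendsto θ (𝓝[≠] s) (𝓝[≠] (θ s)) :=
    θ.continuous.continuousAt.continuousWithinAt.tendsto_nhdsWithin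
      fun t ht => θ.injective.ne ht
  have h1 := hc'.comp hθ
  let r : ℝ → ℝ := fun t => (t - s)⁻¹ * (θ t - θ s)
  have hslope : ∀ t, t ≠ s → slope c s t = r t • slope c' (θ s) (θ t) := by
    intro t ht
    have hne : θ t - θ s ≠ 0 := sub_ne_zero.2 (θ.injective.ne ht)
    simp only [slope, vsub_eq_sub, h, r]
    rw [smul_smul, mul_assoc, mul_inv_cancel₀ hne, mul_one]
  have hr : ∀ t, t ≠ s → 0 < r t := by
    intro t ht
    rcases lt_or_gt_of_ne ht with h2 | h2
    · exact mul_pos_of_neg_of_neg (inv_lt_zero.2 (sub_neg.2 h2))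
        (sub_neg.2 (θ.strictMono h2))
    · exact mul_pos (inv_pos.2 (sub_pos.2 h2)) (sub_pos.2 (θ.strictMono h2))
  have h2 : Tendsto (fun t => ‖slope c s t‖ / ‖slope c' (θ s) (θ t)‖) (𝓝[≠] s)
      (𝓝 (‖v‖ / ‖v'‖)) := hc.norm.div h1.norm (norm_ne_zero_iff.2 hv')
  have h3 : ∀ᶠ t in 𝓝[≠] s, ‖slope c s t‖ / ‖slope c' (θ s) (θ t)‖ = r t := by
    have h4 : ∀ᶠ t in 𝓝[≠] s, slope c' (θ s) (θ t) ≠ 0 := h1.eventually_ne hv'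
    filter_upwards [h4, self_mem_nhdsWithin] with t ht hts
    rw [hslope t hts, norm_smul, Real.norm_of_nonneg (hr t hts).le,
      mul_div_cancel_right₀ _ (norm_ne_zero_iff.2 ht)]
  have h4 : Tendsto r (𝓝[≠] s) (𝓝 (‖v‖ / ‖v'‖)) := h2.congr' h3
  have h5 : Tendsto (fun t => r t • slope c' (θ s) (θ t)) (𝓝[≠] s) (𝓝 ((‖v‖ / ‖v'‖) • v')) :=
    h4.smul h1
  have h6 : Tendsto (slope c s) (𝓝[≠] s) (𝓝 ((‖v‖ / ‖v'‖) • v')) := by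
    refine h5.congr' ?_
    filter_upwards [self_mem_nhdsWithin] with t ht
    exact (hslope t ht).symm
  exact ⟨‖v‖ / ‖v'‖, div_pos (norm_pos_iff.2 hv) (norm_pos_iff.2 hv'),
    tendsto_nhds_unique hc h6⟩

lemma hasDerivAt_curve {i : Fin n} {s : ℝ} {v : ℂ}
    (h : HasDerivAt (fun t : ℝ => D.curve i ((s : UnitAddCircle) + (t : UnitAddCircle))) v 0) :
    HasDerivAt (fun t : ℝ => D.curve i (t : UnitAddCircle)) v s := by
  rw [← sub_self s] at h
  have h1 := h.comp_sub_const s s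
  refine h1.congr_of_eventuallyEq (Eventually.of_forall fun t => ?_)
  simp only
  rw [← AddCircle.coe_add, add_sub_cancel]

theorem equiv_of_reparametrization (h : IsReparametrization D D') :
    D.toState.Equiv D'.toState := by
  obtain ⟨e, θ, hθ, hpt, hcr⟩ := h
  have hθm : ∀ i t (m : ℤ), θ i (t + m) = θ i t + m := by
    intro i t m
    induction m using Int.induction_on with
    | zero => simp
    | succ m ih =>
      push_cast at ih ⊢
      rw [← add_assoc, hθ, ih, add_assoc]
    | pred m ih =>
      push_cast at ih ⊢
      have := hθ i (t + (-(m : ℝ) - 1))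
      rw [show t + (-(m : ℝ) - 1) + 1 = t + -m by ring, ih] at this
      linarith
  let ψ : CurveParam n → CurveParam n := fun p =>
    (e p.1, ((θ p.1 (circleRep 0 p.2) : ℝ) : UnitAddCircle))
  have hψ : ∀ i (s : ℝ), ψ (i, (s : UnitAddCircle)) = (e i, ((θ i s : ℝ) : UnitAddCircle)) := by
    intro i s
    obtain ⟨m, hm⟩ := circle_coe_eq_iff.1 (coe_circleRep 0 (s : UnitAddCircle))
    refine Prod.ext rfl ?_
    change ((θ i (circleRep 0 (s : UnitAddCircle)) : ℝ) : UnitAddCircle) = _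
    have h1 : θ i s = θ i (circleRep 0 (s : UnitAddCircle)) + m := by rw [← hθm, ← hm]
    change _ = ((θ i s : ℝ) : UnitAddCircle)
    rw [h1, circle_coe_add_int]
  have hrep : ∀ p : CurveParam n, p = (p.1, ((circleRep 0 p.2 : ℝ) : UnitAddCircle)) := fun p =>
    Prod.ext rfl (coe_circleRep 0 p.2).symm
  have hψc : ∀ p q, (ψ p, ψ q) ∈ D'.crossings ↔ (p, q) ∈ D.crossings := by
    intro p q
    rw [hrep p, hrep q, hψ, hψ]
    exact hcr _ _ _ _
  have hinj : Function.Injective ψ := by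
    intro p q hpq
    rw [hrep p, hrep q, hψ, hψ, Prod.mk.injEq] at hpq
    obtain ⟨h1, h2⟩ := hpq
    have h3 : p.1 = q.1 := e.injective h1
    rw [h3] at h2
    obtain ⟨m, hm⟩ := circle_coe_eq_iff.1 h2
    rw [← hθm] at hm
    have h4 := (θ q.1).injective hm
    rw [hrep p, hrep q, h3, h4, circle_coe_add_int]
  have hsurj : Function.Surjective ψ := by
    intro p
    refine ⟨(e.symm p.1, (((θ (e.symm p.1)).symm (circleRep 0 p.2) : ℝ) : UnitAddCircle)), ?_⟩
    rw [hψ]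
    simp only [Equiv.apply_symm_apply, OrderIso.apply_symm_apply]
    exact (hrep p).symm
  let ι : D.Vertex → D'.Vertex := fun v => ⟨(ψ v.1.1, ψ v.1.2), (hψc _ _).2 v.2⟩
  have hι : Function.Bijective ι := by
    constructor
    · intro v w hvw
      have h1 := congrArg (fun x => x.1) hvw
      exact Subtype.ext (Prod.ext (hinj (congrArg Prod.fst h1)) (hinj (congrArg Prod.snd h1)))
    · rintro ⟨⟨p, q⟩, hpq⟩
      obtain ⟨p, rfl⟩ := hsurj p
      obtain ⟨q, rfl⟩ := hsurj q
      exact ⟨⟨(p, q), (hψc p q).1 hpq⟩, rfl⟩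
  have hpar : ∀ v b, D'.passageParam (ι v, b) = ψ (D.passageParam (v, b)) := by
    intro v b; cases b <;> rfl
  -- The images of the old base points; with these the change of parameter is monotone on positions.
  let base : Fin n → ℝ := fun i => θ (e.symm i) 0
  have hpos : ∀ p : D.Passage, D'.position base (ι p.1, p.2) =
      θ (D.passageComp p) (D.position 0 p) := by
    intro p
    rw [position, passageComp, hpar, position]
    have hmem := D.position_mem 0 p
    simp only [Pi.zero_apply, zero_add, Set.mem_Ico] at hmem
    have hb : base (e (D.passageComp p)) = θ (D.passageComp p) 0 := by simp [base]
    change circleRep (base (e (D.passageComp p)))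
      ((θ (D.passageComp p) (D.position 0 p) : ℝ) : UnitAddCircle) = _
    rw [hb]
    refine circleRep_coe ⟨(θ _).monotone hmem.1, ?_⟩
    rw [← hθ, zero_add]
    exact (θ _).strictMono hmem.2
  have hsm : IsSmoothing ι D.space D'.space := by
    rw [D'.space_eq base]
    refine isSmoothing_gaussSpace hι.1 e (fun v b => ?_) fun p q hpq => ?_
    · rw [passageComp, hpar]; rfl
    · rw [hpos, hpos, hpq]
      exact (θ _).lt_iff_lt
  have hvel : ∀ {p : CurveParam n}, HasDerivAt
      (fun t : ℝ => D.curve p.1 (p.2 + (t : UnitAddCircle))) (D.velocity p) 0 →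
      HasDerivAt (fun t : ℝ => D'.curve (ψ p).1 ((ψ p).2 + (t : UnitAddCircle)))
        (D'.velocity (ψ p)) 0 →
      D.velocity p ≠ 0 → D'.velocity (ψ p) ≠ 0 →
      ∃ r : ℝ, 0 < r ∧ D.velocity p = r • D'.velocity (ψ p) := by
    intro p h1 h2 h3 h4
    obtain ⟨i, x⟩ := p
    rw [← coe_circleRep 0 x] at h1
    have h5 : HasDerivAt (fun t : ℝ => D'.curve (e i) ((θ i (circleRep 0 x) : UnitAddCircle) +
      (t : UnitAddCircle))) (D'.velocity (ψ (i, x))) 0 := h2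
    have h6 := hasDerivAt_curve h1
    simp only [coe_circleRep] at h6
    exact exists_pos_smul h6 (hasDerivAt_curve h5) (fun t => hpt i t) h3 h4
  refine (State.equiv_of_bijective (S := D.toState) (S' := D'.toState) ι hι ?_ ?_ ?_).symm
  · intro a
    refine (hsm _).trans ⟨?_, fun ha => ?_⟩
    · rintro ⟨a', ha', h, -⟩
      rwa [← hι.2.injective_comp_right h]
    · exact ⟨a, ha, rfl, fun w hw => absurd (hι.2 w) hw⟩
  · intro v
    obtain ⟨h1, h2, h3⟩ := differentiableAt_crossing v.2
    obtain ⟨h1', h2', h3'⟩ := differentiableAt_crossing (ι v).2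
    have hne : ∀ {u w : ℂ}, planeDet u w ≠ 0 → u ≠ 0 ∧ w ≠ 0 := by
      intro u w h
      constructor
      · rintro rfl; simp [planeDet] at h
      · rintro rfl; simp [planeDet] at h
    obtain ⟨r, hr, hr'⟩ := hvel h1 h1' (hne h3).1 (hne h3').1
    obtain ⟨r₂, hr₂, hr₂'⟩ := hvel h2 h2' (hne h3).2 (hne h3').2
    change planeDet (D'.velocity (ψ v.1.1)) (D'.velocity (ψ v.1.2)) < 0 ↔
      planeDet (D.velocity v.1.1) (D.velocity v.1.2) < 0
    rw [hr', hr₂', planeDet_smul, mul_comm (r * r₂), mul_neg_iff_neg_of_pos (mul_pos hr hr₂)]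
  · change D.componentCount - 1 = D'.componentCount - 1
    rw [componentCount_eq, componentCount_eq]
    congr 1
    refine Nat.card_congr (Quot.congr e fun a b => ?_)
    constructor
    · rintro ⟨x, hx, rfl, rfl⟩
      exact ⟨(ψ x.1, ψ x.2), (hψc _ _).2 hx, rfl, rfl⟩
    · rintro ⟨⟨p, q⟩, hx, h1, h2⟩
      obtain ⟨p, rfl⟩ := hsurj p
      obtain ⟨q, rfl⟩ := hsurj q
      exact ⟨(p, q), (hψc p q).1 hx, e.injective h1, e.injective h2⟩

theorem equiv_of_sameVirtualLinkType (h : D.SameVirtualLinkType D') :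
    D.toState.Equiv D'.toState := by
  induction h with
  | rel D D' h =>
    cases h with
    | reparametrization h => exact equiv_of_reparametrization h
    | isotopy h => exact equiv_of_isotopy h
    | detour h => exact equiv_of_detour h
    | reidemeister1 b h => exact equiv_of_reidemeister1 h
    | reidemeister2 height h => exact equiv_of_reidemeister2 h
    | reidemeister3 height h => exact equiv_of_reidemeister3 h
  | refl D => exact State.Equiv.refl _
  | symm D D' _ ih => exact ih.symm
  | trans D D' D'' _ _ ih ih' => exact ih.trans ih'

end LinkDiagram

theorem mainTheorem6 {n : ℕ} (D D' : LinkDiagram n) (h : D.SameVirtualLinkType D')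
    (C : D.EulerSystem) (C' : D'.EulerSystem) :
    MarkedGraph.ObtainableFrom (D'.markedInterlacementGraph C') (D.markedInterlacementGraph C) :=
  LinkDiagram.obtainable_of_equiv (LinkDiagram.equiv_of_sameVirtualLinkType h) C C'
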